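/- Let $\mathcal D=(0,1)$, $0<H\le 1/2$, and let $W=\{W(x):x\in[0,1]\}$ be a fractional Brownian motion with Hurst index $H$ on a filtered probability space $(\Omega,\mathscr F,(\mathscr F_x)_{x\in[0,1]},\mathbb P)$, i.e. an $(\mathscr F_x)$-adapted centered Gaussian process with $\mathbb E[W(x)W(y)]=\frac12(x^{2H}+y^{2H}-|x-y|^{2H})$. Let $g\in L^2(\mathcal D)$, let $f:\mathcal D\times\mathbb R\to\mathbb R$ be measurable with $f(\cdot,0)\in L^2(\mathcal D)$ (for instance $f(\cdot,0)=0$), and assume that there are constants $0<L<\gamma$ and $\beta>0$ such that for all $x\in\mathcal D$, $r,s\in\mathbb R$ $$(f(x,r)-f(x,s))(r-s)\ge -L|r-s|^2,\qquad |f(x,r)-f(x,s)|\le\beta(1+|r-s|),$$ where $\gamma>0$ is a constant in the Poincaré inequality $\|v'\|^2\ge\gamma\|v\|^2$ for all $v\in H^1_0(\mathcal D)$, with $\|\cdot\|$ the norm of $L^2(\mathcal D)$. Consider $$-u''(x)+f(x,u(x))=g(x)+\dot W(x)\ \ (x\in\mathcal D),\qquad u(0)=u(1)=0. \tag{1}$$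 Let $G(x,y)=x\wedge y-xy$. For a measurable $\varphi:\mathcal D\to\mathbb R$ put $$\|\varphi\|_{\Phi^H}^2=\frac{H(1-2H)}2\int_{\mathcal D}\!\int_{\mathcal D}\frac{|\varphi(x)-\varphi(y)|^2}{|x-y|^{2-2H}}\,dx\,dy+H\int_{\mathcal D}\varphi(x)^2\big(x^{2H-1}+(1-x)^{2H-1}\big)dx .$$ The stochastic integral of a step function $\sum_{j<N} c_j\chi_{(a_j,a_{j+1}]}$, $0=a_0<\dots<a_N=1$, is $\sum_{j<N} c_j(W(a_{j+1})-W(a_j))$, and $\int_{\mathcal D}\varphi\,dW$ is the $L^2(\mathbb P)$-limit of the integrals of step functions that converge to $\varphi$ in $\|\cdot\|_{\Phi^H}$. A mild solution of (1) is a process $u=\{u(x):x\in\mathcal D\}$, jointly measurable in $(x,\omega)$ with respect to $\mathcal B(\mathcal D)\otimes\mathscr F_1$, such that for every $x\in\mathcal D$, almost surely, $G(x,\cdot)f(\cdot,u(\cdot))$ is integrable on $\mathcal D$ and $$u(x)+\int_{\mathcal D}G(x,y)f(y,u(y))\,dy=\int_{\mathcal D}G(x,y)g(y)\,dy+\int_{\mathcal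 D}G(x,y)\,dW(y).$$ For $n\ge1$ and $x_i=i/n$ let $\dot W^n=\sum_{i=0}^{n-1}n\,(W(x_{i+1})-W(x_i))\,\chi_{(x_i,x_{i+1}]}$. A solution $u^n$ of the approximate problem $$-(u^n)''+f(x,u^n)=g+\dot W^n\ \text{ in }\mathcal D,\qquad u^n(0)=u^n(1)=0 \tag{2}$$ is a $\mathcal B(\mathcal D)\otimes\mathscr F_1$-measurable process that almost surely has paths in $H^1_0(\mathcal D)$ and satisfies $((u^n)',\varphi')+(f(\cdot,u^n),\varphi)=(g+\dot W^n,\varphi)$ for all $\varphi\in H^1_0(\mathcal D)$. **Theorem.** (i) Equation (1) has a mild solution $u$. It is unique: every mild solution $v$ satisfies, for each $x\in\mathcal D$, $v(x)=u(x)$ almost surely. Moreover $u\in L^2(\mathcal D\times\Omega)$. (ii) For every $n\ge1$, problem (2) has at most one solution (up to almost sure equality of paths), and any solution belongs to $L^2(\mathcal D\times\Omega)$. If $f(x,\cdot)$ is continuous for every $x\in\mathcal D$, then (2) has a solution for every $n\ge 1$. (iii) The mild solution is the limit of the approximations: if $u^n$ is a solution of (2) for all sufficiently large $n$, then $u^n\to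 u$ in $L^2(\mathcal D\times\Omega)$ as $n\to\infty$. -/

import Mathlib

open MeasureTheory ProbabilityTheory Filter Topology Set
open scoped ENNReal unitInterval

noncomputable section

namespace FBmBVP

/-- Lebesgue measure on the domain `D = (0,1)`. -/
abbrev volD : Measure ℝ := volume.restrict (Ioo (0 : ℝ) 1)

/-- `W` is a fractional Brownian motion on `[0,1]` with Hurst index `H`: a centered Gaussian
process with covariance `(x^{2H} + y^{2H} - |x-y|^{2H}) / 2`. -/
structure IsFBm {Ω : Type*} [MeasurableSpace Ω] (P : Measure Ω) (H : ℝ) (W : I → Ω → ℝ) :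
    Prop where
  gaussian : IsGaussianProcess W P
  centered : ∀ x, ∫ ω, W x ω ∂P = 0
  covariance : ∀ x y : I, ∫ ω, W x ω * W y ω ∂P =
    ((x : ℝ) ^ (2 * H) + (y : ℝ) ^ (2 * H) - |(x : ℝ) - y| ^ (2 * H)) / 2

/-- A step function `∑_{j < N} c_j χ_{(a_j, a_{j+1}]}` over a partition
`0 = a_0 < a_1 < ⋯ < a_N = 1`. -/
structure StepFunction where
  N : ℕ
  pos : 0 < N
  a : ℕ → I
  c : ℕ → ℝ
  a_zero : a 0 = 0
  a_last : a N = 1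
  a_lt : ∀ j < N, a j < a (j + 1)

/-- The function on `[0,1]` represented by the step function. -/
def StepFunction.eval (s : StepFunction) (x : ℝ) : ℝ :=
  ∑ j ∈ Finset.range s.N, (Ioc (s.a j : ℝ) (s.a (j + 1))).indicator (fun _ => s.c j) x

/-- The integral `∑_{j < N} c_j (W(a_{j+1}) - W(a_j))` of a step function against `W`. -/
def StepFunction.integral {Ω : Type*} (s : StepFunction) (W : I → Ω → ℝ) (ω : Ω) : ℝ :=
  ∑ j ∈ Finset.range s.N, s.c j * (W (s.a (j + 1)) ω - W (s.a j) ω)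

/-- The squared norm of the Hilbert space `Φ^H` of integrands (for `0 < H ≤ 1/2`),
`H(1-2H)/2 ∬ |φ(x)-φ(y)|² / |x-y|^{2-2H} dx dy + H ∫ φ(x)² (x^{2H-1} + (1-x)^{2H-1}) dx`,
with values in `[0,∞]`. -/
def normSqPhi (H : ℝ) (φ : ℝ → ℝ) : ℝ≥0∞ :=
  ENNReal.ofReal (H * (1 - 2 * H) / 2) *
      ∫⁻ x, ∫⁻ y, ENNReal.ofReal ((φ x - φ y) ^ 2 / |x - y| ^ (2 - 2 * H)) ∂volD ∂volD +
    ENNReal.ofReal H *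
      ∫⁻ x, ENNReal.ofReal (φ x ^ 2 * (x ^ (2 * H - 1) + (1 - x) ^ (2 * H - 1))) ∂volD

/-- `Z` is (a version of) the stochastic integral `∫_D φ(y) dW(y)`: the `L²(P)`-limit of the
integrals of step functions that converge to `φ` in `Φ^H`. -/
def IsFBmIntegral {Ω : Type*} [MeasurableSpace Ω] (P : Measure Ω) (H : ℝ) (W : I → Ω → ℝ)
    (φ : ℝ → ℝ) (Z : Ω → ℝ) : Prop :=
  AEMeasurable φ volD ∧ MemLp Z 2 P ∧ ∃ s : ℕ → StepFunction,
    Tendsto (fun k => normSqPhi H (fun x => φ x - (s k).eval x)) atTop (𝓝 0) ∧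
    Tendsto (fun k => eLpNorm (fun ω => (s k).integral W ω - Z ω) 2 P) atTop (𝓝 0)

/-- The Green function of `-d²/dx²` on `(0,1)` with Dirichlet boundary conditions. -/
def green (x y : ℝ) : ℝ := min x y - x * y

/-- The random field `u`, on `D × Ω`, is jointly measurable with respect to the Borel
σ-algebra of `D` and the σ-algebra `𝓖` on `Ω`. -/
def IsMeasurableField {Ω : Type*} (𝓖 : MeasurableSpace Ω) (u : ℝ → Ω → ℝ) : Prop :=
  Measurable[(inferInstance : MeasurableSpace (Ioo (0 : ℝ) 1)).prod 𝓖]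
    (fun p : Ioo (0 : ℝ) 1 × Ω => u p.1 p.2)

/-- `u` is a mild solution of `-u'' + f(x,u) = g + Ẇ` in `D`, `u = 0` on `∂D`: a measurable,
`ℱ₁`-measurable process such that, for every `x ∈ D`, almost surely
`u(x) + ∫_D G(x,y) f(y,u(y)) dy = ∫_D G(x,y) g(y) dy + ∫_D G(x,y) dW(y)`
(the first integral being convergent).
The boundary value problem is anticipating: `u(x)` depends on `W` on all of `[0,1]`. -/
def IsMildSolution {Ω : Type*} [mΩ : MeasurableSpace Ω] (P : Measure Ω) (ℱ : Filtration I mΩ)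
    (H : ℝ) (W : I → Ω → ℝ) (f : ℝ → ℝ → ℝ) (g : ℝ → ℝ) (u : ℝ → Ω → ℝ) : Prop :=
  IsMeasurableField (ℱ 1) u ∧
  ∀ x ∈ Ioo (0 : ℝ) 1,
    (∀ᵐ ω ∂P, Integrable (fun y => green x y * f y (u y ω)) volD) ∧
    ∃ Z : Ω → ℝ, IsFBmIntegral P H W (green x) Z ∧
      ∀ᵐ ω ∂P, u x ω + ∫ y, green x y * f y (u y ω) ∂volD =
        ∫ y, green x y * g y ∂volD + Z ω

/-- `v ∈ H¹₀(0,1)`: `v` is absolutely continuous on `[0,1]`, its derivative (defined a.e.) is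
square integrable, and `v` vanishes at `0` and `1`. -/
def InH10 (v : ℝ → ℝ) : Prop :=
  AbsolutelyContinuousOnInterval v 0 1 ∧ MemLp (deriv v) 2 volD ∧ v 0 = 0 ∧ v 1 = 0

/-- `γ` is a (positive) constant in the Poincaré inequality `‖v'‖² ≥ γ ‖v‖²` on `H¹₀(0,1)`. -/
def IsPoincareConstant (γ : ℝ) : Prop :=
  0 < γ ∧ ∀ v : ℝ → ℝ, InH10 v → γ * ∫ x, v x ^ 2 ∂volD ≤ ∫ x, deriv v x ^ 2 ∂volD

/-- The grid point `x_i = i / n` of `[0,1]`. -/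
def gridPoint (n i : ℕ) : I := Set.projIcc 0 1 zero_le_one ((i : ℝ) / n)

/-- The piecewise constant approximation `Ẇⁿ` of the noise: on `(x_i, x_{i+1}]` it is
`(W(x_{i+1}) - W(x_i)) / h` with `h = 1/n`. -/
def noiseApprox {Ω : Type*} (W : I → Ω → ℝ) (n : ℕ) (x : ℝ) (ω : Ω) : ℝ :=
  ∑ i ∈ Finset.range n,
    (Ioc (gridPoint n i : ℝ) (gridPoint n (i + 1))).indicator
      (fun _ => (n : ℝ) * (W (gridPoint n (i + 1)) ω - W (gridPoint n i) ω)) x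

/-- `v` solves the approximate problem `-v'' + f(x,v) = g + Ẇⁿ` in `D`, `v = 0` on `∂D`:
a measurable, `ℱ₁`-measurable process with almost all paths in `H¹₀(D)` which satisfy the
variational formulation `(v',φ') + (f(v),φ) = (g + Ẇⁿ,φ)` for all `φ ∈ H¹₀(D)`. -/
def IsApproxSolution {Ω : Type*} [mΩ : MeasurableSpace Ω] (P : Measure Ω) (ℱ : Filtration I mΩ)
    (W : I → Ω → ℝ) (f : ℝ → ℝ → ℝ) (g : ℝ → ℝ) (n : ℕ) (v : ℝ → Ω → ℝ) : Prop :=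
  IsMeasurableField (ℱ 1) v ∧
  ∀ᵐ ω ∂P, InH10 (fun x => v x ω) ∧
    ∀ φ : ℝ → ℝ, InH10 φ →
      ∫ x, deriv (fun y => v y ω) x * deriv φ x ∂volD + ∫ x, f x (v x ω) * φ x ∂volD =
        ∫ x, (g x + noiseApprox W n x ω) * φ x ∂volD

end FBmBVP

end

open FBmBVP

noncomputable section

namespace FBmBVP

/-! Let K be the Green operator, the inverse of -d²/dx² with zero boundary values. Both boundary
value problems take the form u + K f(·,u) = z, where z is K g plus the Green convolution of the
noise or of its approximation. The Poincaré inequality becomes the coercivity γ‖Kq‖² ≤ ⟨Kq, q⟩,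
which dominates the one-sided bound -L of f because L < γ. Applied to the difference of two
solutions it bounds ‖u - v‖² by a multiple of ‖z - w‖² plus a multiple of the L¹ norm of z - w
(`IsNonlinearity.stability`); the L¹ term is the price of possible jumps of f. Uniqueness, square
integrability and convergence all follow from this estimate, the last because the approximate
convolutions converge in L² at rate n^(-H) (`norm_curveApprox_sub_le`).

Existence is harder, since f may jump in its second variable. Averages of f over [r, r + ε] are
Lipschitz and keep L and β; for them a shifted fixed point equation in L²(D × Ω) is a contraction
(`exists_add_apply_eq`). As ε tends to 0 the solutions are Cauchy, and the limit has the form u = z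
- K h with h square integrable. K h may be replaced by K f(·,u) if f(x,·) is almost everywhere
continuous at u (`IsNonlinearity.exists_limit_solution`). As f(x,r) + L r is monotone in r, there
are only countably many discontinuities for each x, so it suffices that the law of u(x) has no atoms
for almost every x.

The absence of atoms comes from a contrast of regularity (`coincidence_null`). K h has an integrable
second derivative, so its mixed second difference with steps η ≤ δ is of order ηδ on average. That
of the noise term is Gaussian with standard deviation of order ηδ^H, which is much larger because H
< 1. For two independent copies ω, ω', a set of positive measure of points x with u(x,ω) = u(x,ω')
would be almost invariant under small translations, and on it the rough mixed difference would have
to equal the smooth one.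

The stochastic integral is handled through an isometry: ‖χ_(s,t]‖ in Φ^H and ‖W(t) - W(s)‖ in L²(P)
both equal |t - s|^H, and distances determine the norms of linear combinations
(`IsFBm.eLpNorm_integral_sub`). Integration by parts identifies ∫ G(x,y) dW(y) with x ∫₀¹ W - ∫₀ˣ W
in L²(P). -/

/-! ### The Green operator of the Dirichlet problem -/

lemma integral_volD (f : ℝ → ℝ) : ∫ x, f x ∂volD = ∫ x in (0 : ℝ)..1, f x := by
  rw [intervalIntegral.integral_of_le zero_le_one, integral_Ioc_eq_integral_Ioo]

lemma integrable_volD_iff (f : ℝ → ℝ) :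
    Integrable f volD ↔ IntervalIntegrable f volume 0 1 := by
  rw [intervalIntegrable_iff_integrableOn_Ioo_of_le zero_le_one]
  rfl

instance : IsProbabilityMeasure volD :=
  ⟨by simp⟩

lemma ae_volD_of_forall {p : ℝ → Prop} (h : ∀ x ∈ Ioo (0 : ℝ) 1, p x) : ∀ᵐ x ∂volD, p x :=
  (ae_restrict_iff' measurableSet_Ioo).2 (Eventually.of_forall h)

lemma ae_mem_volD : ∀ᵐ x ∂volD, x ∈ Ioo (0 : ℝ) 1 := ae_volD_of_forall fun _ h => h

/-- The solution operator of `-v'' = m`, `v(0) = v(1) = 0`. -/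
def greenOp (m : ℝ → ℝ) (x : ℝ) : ℝ := ∫ y, green x y * m y ∂volD

lemma green_of_le {x y : ℝ} (h : y ≤ x) : green x y = y * (1 - x) := by
  rw [green, min_eq_right h]; ring

lemma green_of_ge {x y : ℝ} (h : x ≤ y) : green x y = x * (1 - y) := by
  rw [green, min_eq_left h]; ring

lemma green_nonneg {x y : ℝ} (hx : x ∈ Icc (0 : ℝ) 1) (hy : y ∈ Icc (0 : ℝ) 1) :
    0 ≤ green x y := by
  obtain ⟨hx0, hx1⟩ := hx
  obtain ⟨hy0, hy1⟩ := hy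
  rcases le_total y x with h | h
  · rw [green_of_le h]; exact mul_nonneg hy0 (by linarith)
  · rw [green_of_ge h]; exact mul_nonneg hx0 (by linarith)

lemma green_le {x y : ℝ} (hx : x ∈ Icc (0 : ℝ) 1) (hy : y ∈ Icc (0 : ℝ) 1) :
    green x y ≤ y * (1 - y) := by
  obtain ⟨hx0, hx1⟩ := hx
  obtain ⟨hy0, hy1⟩ := hy
  rcases le_total y x with h | h
  · rw [green_of_le h]; exact mul_le_mul_of_nonneg_left (by linarith) hy0
  · rw [green_of_ge h]; exact mul_le_mul_of_nonneg_right h (by linarith)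

lemma le_two_mul_green_half {y : ℝ} (hy : y ∈ Icc (0 : ℝ) 1) :
    y * (1 - y) ≤ 2 * green (1 / 2) y := by
  obtain ⟨hy0, hy1⟩ := hy
  rcases le_total y (1 / 2) with h | h
  · rw [green_of_le h]; nlinarith
  · rw [green_of_ge h]; nlinarith

lemma abs_green_le_one {x y : ℝ} (hx : x ∈ Icc (0 : ℝ) 1) (hy : y ∈ Icc (0 : ℝ) 1) :
    |green x y| ≤ 1 := by
  rw [abs_of_nonneg (green_nonneg hx hy)]
  have h := green_le hx hy
  obtain ⟨hy0, hy1⟩ := hy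
  nlinarith

lemma continuous_green : Continuous (fun p : ℝ × ℝ => green p.1 p.2) := by
  unfold green; fun_prop

lemma measurable_green : Measurable (fun p : ℝ × ℝ => green p.1 p.2) :=
  continuous_green.measurable

lemma continuous_green_right (x : ℝ) : Continuous (green x) :=
  continuous_green.comp (Continuous.prodMk_right x)

lemma integrable_green_mul {m : ℝ → ℝ} (hm : Integrable m volD) {x : ℝ}
    (hx : x ∈ Icc (0 : ℝ) 1) : Integrable (fun y => green x y * m y) volD := by
  refine hm.bdd_mul (c := 1) (continuous_green_right x).aestronglyMeasurable ?_
  exact ae_volD_of_forall fun y hy => abs_green_le_one hx ⟨hy.1.le, hy.2.le⟩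

lemma greenOp_congr {m m' : ℝ → ℝ} (h : m =ᵐ[volD] m') (x : ℝ) : greenOp m x = greenOp m' x :=
  integral_congr_ae (h.mono fun y hy => by simp only [hy])

lemma greenOp_add {m m' : ℝ → ℝ} (hm : Integrable m volD) (hm' : Integrable m' volD) {x : ℝ}
    (hx : x ∈ Icc (0 : ℝ) 1) :
    greenOp (fun y => m y + m' y) x = greenOp m x + greenOp m' x := by
  unfold greenOp
  rw [← integral_add (integrable_green_mul hm hx) (integrable_green_mul hm' hx)]
  simp only [mul_add]

lemma greenOp_sub {m m' : ℝ → ℝ} (hm : Integrable m volD) (hm' : Integrable m' volD) {x : ℝ}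
    (hx : x ∈ Icc (0 : ℝ) 1) :
    greenOp (fun y => m y - m' y) x = greenOp m x - greenOp m' x := by
  unfold greenOp
  rw [← integral_sub (integrable_green_mul hm hx) (integrable_green_mul hm' hx)]
  simp only [mul_sub]

lemma greenOp_const_mul (c : ℝ) (m : ℝ → ℝ) (x : ℝ) :
    greenOp (fun y => c * m y) x = c * greenOp m x := by
  unfold greenOp
  rw [← integral_const_mul]
  congr 1; ext y; ring

lemma abs_greenOp_le {m : ℝ → ℝ} (hm : Integrable m volD) {x : ℝ} (hx : x ∈ Icc (0 : ℝ) 1) :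
    |greenOp m x| ≤ ∫ y, |m y| ∂volD := by
  refine (abs_integral_le_integral_abs).trans (integral_mono_ae (integrable_green_mul hm hx).abs
    hm.abs (ae_volD_of_forall fun y hy => ?_))
  simp only [abs_mul]
  exact mul_le_of_le_one_left (abs_nonneg _) (abs_green_le_one hx ⟨hy.1.le, hy.2.le⟩)

/-- Splitting the kernel at y = x leaves only primitives of m and of y m(y), from which absolute
continuity and the derivative can be read off. -/
lemma greenOp_eq {m : ℝ → ℝ} (hm : Integrable m volD) {x : ℝ} (hx : x ∈ Icc (0 : ℝ) 1) :
    greenOp m x = (∫ y in (0 : ℝ)..x, y * m y) - x * (∫ y in (0 : ℝ)..x, m y) +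
      x * ∫ y in (0 : ℝ)..1, (1 - y) * m y := by
  have hi := (integrable_volD_iff _).1 hm
  have h0x : uIcc 0 x ⊆ uIcc (0 : ℝ) 1 := by
    rw [uIcc_of_le hx.1, uIcc_of_le zero_le_one]; exact Icc_subset_Icc_right hx.2
  have hx1 : uIcc x 1 ⊆ uIcc (0 : ℝ) 1 := by
    rw [uIcc_of_le hx.2, uIcc_of_le zero_le_one]; exact Icc_subset_Icc_left hx.1
  have hi0 := hi.mono_set h0x
  have hi1 := hi.mono_set hx1
  have hy : ∀ {a b : ℝ}, IntervalIntegrable m volume a b →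
      IntervalIntegrable (fun y => y * m y) volume a b := fun h =>
    h.continuousOn_mul continuousOn_id
  have hy' : ∀ {a b : ℝ}, IntervalIntegrable m volume a b →
      IntervalIntegrable (fun y => (1 - y) * m y) volume a b := fun h =>
    h.continuousOn_mul (by fun_prop)
  have hg : ∀ {a b : ℝ}, IntervalIntegrable m volume a b →
      IntervalIntegrable (fun y => green x y * m y) volume a b := fun h =>
    h.continuousOn_mul (continuous_green_right x).continuousOn
  rw [greenOp, integral_volD, ← intervalIntegral.integral_add_adjacent_intervals (hg hi0) (hg hi1),
    ← intervalIntegral.integral_add_adjacent_intervals (hy' hi0) (hy' hi1)]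
  have e1 : ∫ y in (0 : ℝ)..x, green x y * m y = (1 - x) * ∫ y in (0 : ℝ)..x, y * m y := by
    rw [← intervalIntegral.integral_const_mul]
    refine intervalIntegral.integral_congr fun y hy => ?_
    rw [uIcc_of_le hx.1] at hy
    simp only [green_of_le hy.2]; ring
  have e2 : ∫ y in x..1, green x y * m y = x * ∫ y in x..1, (1 - y) * m y := by
    rw [← intervalIntegral.integral_const_mul]
    refine intervalIntegral.integral_congr fun y hy => ?_
    rw [uIcc_of_le hx.2] at hy
    simp only [green_of_ge hy.1]; ring
  have e3 : ∫ y in (0 : ℝ)..x, (1 - y) * m y =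
      (∫ y in (0 : ℝ)..x, m y) - ∫ y in (0 : ℝ)..x, y * m y := by
    rw [← intervalIntegral.integral_sub hi0 (hy hi0)]
    congr 1; ext y; ring
  rw [e1, e2, e3]; ring

lemma absolutelyContinuous_congr_Icc {v w : ℝ → ℝ}
    (hv : AbsolutelyContinuousOnInterval v 0 1) (h : ∀ x ∈ Icc (0 : ℝ) 1, v x = w x) :
    AbsolutelyContinuousOnInterval w 0 1 := by
  rw [absolutelyContinuousOnInterval_iff] at hv ⊢
  intro ε hε
  obtain ⟨δ, hδ, H⟩ := hv ε hε
  refine ⟨δ, hδ, fun E hE hlt => ?_⟩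
  convert H E hE hlt using 1
  refine Finset.sum_congr rfl fun i hi => ?_
  have := hE.1 i hi
  rw [uIcc_of_le zero_le_one] at this
  rw [h _ this.1, h _ this.2]

lemma deriv_congr_Icc {v w : ℝ → ℝ} (h : ∀ x ∈ Icc (0 : ℝ) 1, v x = w x) {x : ℝ}
    (hx : x ∈ Ioo (0 : ℝ) 1) : deriv v x = deriv w x := by
  refine Filter.EventuallyEq.deriv_eq ?_
  filter_upwards [Icc_mem_nhds hx.1 hx.2] with y hy using h y hy

/-- The derivative of `greenOp m`. -/
def greenDeriv (m : ℝ → ℝ) (x : ℝ) : ℝ :=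
  (∫ y in (0 : ℝ)..1, (1 - y) * m y) - ∫ y in (0 : ℝ)..x, m y

lemma absolutelyContinuous_primitive {m : ℝ → ℝ} (hm : Integrable m volD) :
    AbsolutelyContinuousOnInterval (fun x => ∫ y in (0 : ℝ)..x, m y) 0 1 :=
  ((integrable_volD_iff _).1 hm).absolutelyContinuousOnInterval_intervalIntegral (by simp)

lemma ae_hasDerivAt_primitive {m : ℝ → ℝ} (hm : Integrable m volD) :
    ∀ᵐ x ∂volD, HasDerivAt (fun x => ∫ y in (0 : ℝ)..x, m y) (m x) x := by
  have h := ((integrable_volD_iff _).1 hm).ae_hasDerivAt_integral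
  filter_upwards [ae_restrict_of_ae h, ae_mem_volD] with x hx hx'
  refine hx ?_ 0 (by simp)
  rw [uIcc_of_le zero_le_one]
  exact ⟨hx'.1.le, hx'.2.le⟩

lemma integrable_id_mul {m : ℝ → ℝ} (hm : Integrable m volD) :
    Integrable (fun y => y * m y) volD :=
  (integrable_volD_iff _).2 (((integrable_volD_iff _).1 hm).continuousOn_mul continuousOn_id)

lemma absolutelyContinuous_id : AbsolutelyContinuousOnInterval (fun x : ℝ => x) 0 1 :=
  contDiff_id.contDiffOn.absolutelyContinuousOnInterval

lemma absolutelyContinuous_const (c : ℝ) : AbsolutelyContinuousOnInterval (fun _ : ℝ => c) 0 1 :=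
  contDiff_const.contDiffOn.absolutelyContinuousOnInterval

lemma absolutelyContinuous_greenOp {m : ℝ → ℝ} (hm : Integrable m volD) :
    AbsolutelyContinuousOnInterval (greenOp m) 0 1 := by
  have h1 := absolutelyContinuous_primitive (integrable_id_mul hm)
  have h2 := absolutelyContinuous_id.mul (absolutelyContinuous_primitive hm)
  have h3 := absolutelyContinuous_id.mul
    (absolutelyContinuous_const (∫ y in (0 : ℝ)..1, (1 - y) * m y))
  exact absolutelyContinuous_congr_Icc ((h1.sub h2).add h3)
    fun x hx => (greenOp_eq hm hx).symm

lemma ae_deriv_greenOp {m : ℝ → ℝ} (hm : Integrable m volD) :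
    deriv (greenOp m) =ᵐ[volD] greenDeriv m := by
  filter_upwards [ae_hasDerivAt_primitive hm, ae_hasDerivAt_primitive (integrable_id_mul hm),
    ae_mem_volD] with x h1 h2 hx
  rw [deriv_congr_Icc (fun x hx => greenOp_eq hm hx) hx]
  have h3 := (h2.sub ((hasDerivAt_id x).mul h1)).add ((hasDerivAt_id x).mul_const
    (∫ y in (0 : ℝ)..1, (1 - y) * m y))
  refine (HasDerivAt.deriv h3).trans ?_
  simp only [greenDeriv, id]
  ring

lemma absolutelyContinuous_greenDeriv {m : ℝ → ℝ} (hm : Integrable m volD) :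
    AbsolutelyContinuousOnInterval (greenDeriv m) 0 1 :=
  (absolutelyContinuous_const _).sub (absolutelyContinuous_primitive hm)

lemma memLp_of_absolutelyContinuous {v : ℝ → ℝ}
    (hv : AbsolutelyContinuousOnInterval v 0 1) (p : ℝ≥0∞) : MemLp v p volD := by
  obtain ⟨C, hC⟩ := hv.exists_bound
  rw [uIcc_of_le zero_le_one] at hC
  refine MemLp.of_bound ?_ C (ae_volD_of_forall fun x hx => hC x ⟨hx.1.le, hx.2.le⟩)
  have := hv.continuousOn
  rw [uIcc_of_le zero_le_one] at this
  exact (this.mono Ioo_subset_Icc_self).aestronglyMeasurable measurableSet_Ioo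

lemma greenOp_zero (m : ℝ → ℝ) : greenOp m 0 = 0 := by
  unfold greenOp
  rw [integral_congr_ae (g := fun _ => 0)]
  · simp
  · exact ae_volD_of_forall fun y hy => by simp [green_of_ge hy.1.le]

lemma greenOp_one (m : ℝ → ℝ) : greenOp m 1 = 0 := by
  unfold greenOp
  rw [integral_congr_ae (g := fun _ => 0)]
  · simp
  · exact ae_volD_of_forall fun y hy => by simp [green_of_le hy.2.le]

lemma inH10_greenOp {m : ℝ → ℝ} (hm : Integrable m volD) : InH10 (greenOp m) :=
  ⟨absolutelyContinuous_greenOp hm,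
    (memLp_of_absolutelyContinuous (absolutelyContinuous_greenDeriv hm) 2).ae_eq (ae_deriv_greenOp hm).symm,
    greenOp_zero m, greenOp_one m⟩

/-- `greenOp m` is the weak solution of `-v'' = m`. -/
lemma integral_deriv_greenOp_mul {m φ : ℝ → ℝ} (hm : Integrable m volD) (hφ : InH10 φ) :
    ∫ x, deriv (greenOp m) x * deriv φ x ∂volD = ∫ x, m x * φ x ∂volD := by
  have h1 : ∫ x, deriv (greenOp m) x * deriv φ x ∂volD =
      ∫ x, greenDeriv m x * deriv φ x ∂volD :=
    integral_congr_ae ((ae_deriv_greenOp hm).mono fun x hx => by simp only [hx])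
  rw [h1, integral_volD,
    (absolutelyContinuous_greenDeriv hm).integral_mul_deriv_eq_deriv_mul hφ.1, hφ.2.2.1, hφ.2.2.2,
    ← integral_volD]
  simp only [mul_zero, sub_zero, zero_sub]
  rw [← integral_neg]
  refine integral_congr_ae ?_
  filter_upwards [ae_hasDerivAt_primitive hm] with x hx
  have : deriv (greenDeriv m) x = -m x :=
    (hx.const_sub (∫ y in (0 : ℝ)..1, (1 - y) * m y)).deriv
  rw [this]; ring

lemma lipschitz_green (x : ℝ) (hx : x ∈ Icc (0 : ℝ) 1) (y y' : ℝ) :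
    |green x y - green x y'| ≤ |y - y'| := by
  obtain ⟨hx0, hx1⟩ := hx
  wlog h : y ≤ y' generalizing y y'
  · rw [abs_sub_comm, abs_sub_comm y]; exact this _ _ (le_of_not_ge h)
  rw [abs_sub_comm, abs_sub_comm y, abs_of_nonneg (sub_nonneg.2 h), abs_le]
  rcases le_total x y with h1 | h1
  · rw [green_of_ge h1, green_of_ge (h1.trans h)]; constructor <;> nlinarith
  · rcases le_total x y' with h2 | h2
    · rw [green_of_le h1, green_of_ge h2]; constructor <;> nlinarith
    · rw [green_of_le h1, green_of_le h2]; constructor <;> nlinarith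

lemma ae_deriv_green {x : ℝ} :
    ∀ᵐ y ∂volD, deriv (green x) y = (if y < x then 1 else 0) - x := by
  have : ∀ᵐ y ∂volD, y ≠ x := by
    refine ae_restrict_of_ae ?_
    simp [ae_iff, measure_singleton]
  filter_upwards [this] with y hy
  rcases lt_or_gt_of_ne hy with h | h
  · rw [if_pos h]
    have : green x =ᶠ[𝓝 y] fun y => y * (1 - x) := by
      filter_upwards [Iio_mem_nhds h] with z hz using green_of_le (le_of_lt hz)
    rw [this.deriv_eq]; simp
  · rw [if_neg h.not_gt]
    have : green x =ᶠ[𝓝 y] fun y => x * (1 - y) := by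
      filter_upwards [Ioi_mem_nhds h] with z hz using green_of_ge (le_of_lt hz)
    rw [this.deriv_eq]; simp

lemma inH10_green {x : ℝ} (hx : x ∈ Icc (0 : ℝ) 1) : InH10 (green x) := by
  refine ⟨?_, ?_, ?_, ?_⟩
  · have : LipschitzOnWith 1 (green x) (uIcc 0 1) := by
      refine LipschitzOnWith.of_dist_le_mul fun y _ y' _ => ?_
      simpa [Real.dist_eq] using lipschitz_green x hx y y'
    exact this.absolutelyContinuousOnInterval
  · refine MemLp.of_bound (measurable_deriv _).aestronglyMeasurable 2 ?_
    filter_upwards [ae_deriv_green (x := x)] with y hy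
    rw [hy, Real.norm_eq_abs, abs_le]
    obtain ⟨hx0, hx1⟩ := hx
    split_ifs <;> constructor <;> linarith
  · rw [green_of_le hx.1, zero_mul]
  · rw [green_of_ge hx.2, sub_self, mul_zero]

/-- G(x,·) represents evaluation at x for the Dirichlet form: its slope is 1 - x to the left of x
and -x to the right, and v vanishes at both ends, so the two pieces contribute (1 - x) v(x) and x
v(x). -/
lemma integral_deriv_mul_deriv_green {v : ℝ → ℝ} (hv : InH10 v) {x : ℝ}
    (hx : x ∈ Icc (0 : ℝ) 1) : ∫ y, deriv v y * deriv (green x) y ∂volD = v x := by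
  have h1 : ∫ y, deriv v y * deriv (green x) y ∂volD =
      ∫ y, deriv v y * ((if y < x then 1 else 0) - x) ∂volD :=
    integral_congr_ae ((ae_deriv_green (x := x)).mono fun y hy => by simp only [hy])
  have h0x : uIcc 0 x ⊆ uIcc (0 : ℝ) 1 := by
    rw [uIcc_of_le hx.1, uIcc_of_le zero_le_one]; exact Icc_subset_Icc_right hx.2
  have hx1 : uIcc x 1 ⊆ uIcc (0 : ℝ) 1 := by
    rw [uIcc_of_le hx.2, uIcc_of_le zero_le_one]; exact Icc_subset_Icc_left hx.1
  have a0 := hv.1.mono h0x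
  have a1 := hv.1.mono hx1
  have e0 : ∀ᵐ y, y ∈ uIoc 0 x → deriv v y * ((if y < x then 1 else 0) - x) =
      deriv v y * (1 - x) := by
    have : ∀ᵐ y, y ≠ x := by simp [ae_iff, measure_singleton]
    filter_upwards [this] with y hy hy'
    rw [uIoc_of_le hx.1] at hy'
    rw [if_pos (lt_of_le_of_ne hy'.2 hy)]
  have e1 : ∀ᵐ y, y ∈ uIoc x 1 → deriv v y * ((if y < x then 1 else 0) - x) =
      deriv v y * (-x) := by
    refine Eventually.of_forall fun y hy => ?_
    rw [uIoc_of_le hx.2] at hy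
    rw [if_neg hy.1.not_gt, zero_sub]
  have i0 : IntervalIntegrable (fun y => deriv v y * ((if y < x then 1 else 0) - x))
      volume 0 x :=
    (a0.intervalIntegrable_deriv.mul_const (1 - x)).congr_ae
      ((ae_restrict_iff' measurableSet_uIoc).2 (e0.mono fun y hy h => (hy h).symm))
  have i1 : IntervalIntegrable (fun y => deriv v y * ((if y < x then 1 else 0) - x))
      volume x 1 :=
    (a1.intervalIntegrable_deriv.mul_const (-x)).congr_ae
      ((ae_restrict_iff' measurableSet_uIoc).2 (e1.mono fun y hy h => (hy h).symm))
  rw [h1, integral_volD, ← intervalIntegral.integral_add_adjacent_intervals i0 i1,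
    intervalIntegral.integral_congr_ae e0, intervalIntegral.integral_congr_ae e1,
    intervalIntegral.integral_mul_const, intervalIntegral.integral_mul_const,
    a0.integral_deriv_eq_sub, a1.integral_deriv_eq_sub, hv.2.2.1, hv.2.2.2]
  ring

/-- Testing -v'' = m with v = K m itself turns ‖v'‖² into ⟨m, K m⟩. The Poincaré inequality enters
all later estimates in this form. -/
lemma poincare_greenOp {γ : ℝ} (hγ : IsPoincareConstant γ) {m : ℝ → ℝ} (hm : Integrable m volD) :
    γ * ∫ x, greenOp m x ^ 2 ∂volD ≤ ∫ x, m x * greenOp m x ∂volD := by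
  have h := hγ.2 _ (inH10_greenOp hm)
  rwa [show ∫ x, deriv (greenOp m) x ^ 2 ∂volD = ∫ x, m x * greenOp m x ∂volD by
    rw [← integral_deriv_greenOp_mul hm (inH10_greenOp hm)]
    congr 1; ext x; ring] at h

/-! ### Energy estimates and uniqueness for u + K f(u) = z -/

/-- The structural assumptions on the nonlinearity, with both variables ranging over `ℝ`. -/
structure IsNonlinearity (f : ℝ → ℝ → ℝ) (L β : ℝ) : Prop where
  measurable : Measurable (fun p : ℝ × ℝ => f p.1 p.2)
  zero : MemLp (fun x => f x 0) 2 volD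
  L_pos : 0 < L
  β_pos : 0 < β
  mono : ∀ x r s, (f x r - f x s) * (r - s) ≥ -L * (r - s) ^ 2
  growth : ∀ x r s, |f x r - f x s| ≤ β * (1 + |r - s|)

lemma IsNonlinearity.abs_le {f : ℝ → ℝ → ℝ} {L β : ℝ} (hf : IsNonlinearity f L β) (x r : ℝ) :
    |f x r| ≤ |f x 0| + β * (1 + |r|) := by
  have h := hf.growth x r 0
  rw [sub_zero] at h
  have := abs_sub_abs_le_abs_sub (f x r) (f x 0)
  linarith

/-- The base map π is arbitrary so that the same statement serves functions on D and random fields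
on D × Ω. -/
lemma IsNonlinearity.memLp_comp {f : ℝ → ℝ → ℝ} {L β : ℝ} (hf : IsNonlinearity f L β)
    {α : Type*} [MeasurableSpace α] {μ : Measure α} [IsFiniteMeasure μ] {π : α → ℝ}
    (hπ : Measurable π) (h0 : MemLp (fun a => f (π a) 0) 2 μ) {u : α → ℝ} (hu : MemLp u 2 μ) :
    MemLp (fun a => f (π a) (u a)) 2 μ := by
  have hm : AEStronglyMeasurable (fun a => f (π a) (u a)) μ :=
    (hf.measurable.comp_aemeasurable
      (hπ.aemeasurable.prodMk hu.aestronglyMeasurable.aemeasurable)).aestronglyMeasurable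
  have h1 : MemLp (fun a => 1 + |u a|) 2 μ := (memLp_const (1 : ℝ)).add hu.norm
  have h2 : MemLp (fun a => |f (π a) 0| + β * (1 + |u a|)) 2 μ := h0.norm.add (h1.const_mul β)
  refine h2.mono hm (Eventually.of_forall fun a => ?_)
  rw [Real.norm_eq_abs, Real.norm_eq_abs]
  exact (hf.abs_le _ _).trans (le_abs_self _)

/-- The energy estimate for the difference of two solutions. -/
lemma energy_estimate {γ L β : ℝ} (hγ : IsPoincareConstant γ) (hLγ : L < γ)
    {e ζ q : ℝ → ℝ} (he : MemLp e 2 volD) (hζ : MemLp ζ 2 volD) (hq : MemLp q 2 volD)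
    (heq : ∀ᵐ x ∂volD, e x = ζ x - greenOp q x)
    (hm : ∀ᵐ x ∂volD, q x * e x ≥ -L * e x ^ 2)
    (hg : ∀ᵐ x ∂volD, |q x| ≤ β * (1 + |e x|)) :
    ∫ x, e x ^ 2 ∂volD ≤ ((2 * γ + β) / (γ - L)) ^ 2 * ∫ x, ζ x ^ 2 ∂volD +
      2 * β / (γ - L) * ∫ x, |ζ x| ∂volD := by
  have hγ0 := hγ.1
  have hd : 0 < γ - L := sub_pos.2 hLγ
  have hqi : Integrable q volD := hq.integrable (by norm_num)
  have hp := poincare_greenOp hγ hqi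
  have hw : MemLp (fun x => ζ x - e x) 2 volD := hζ.sub he
  have h1 : ∫ x, greenOp q x ^ 2 ∂volD = ∫ x, (ζ x - e x) ^ 2 ∂volD :=
    integral_congr_ae (heq.mono fun x hx => by simp only [hx]; ring)
  have h2 : ∫ x, q x * greenOp q x ∂volD = ∫ x, q x * (ζ x - e x) ∂volD :=
    integral_congr_ae (heq.mono fun x hx => by simp only [hx]; ring)
  rw [h1, h2] at hp
  have i1 := hw.integrable_sq
  have i2 : Integrable (fun x => q x * (ζ x - e x)) volD := hq.integrable_mul hw
  have i3 := hζ.integrable_sq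
  have i4 : Integrable (fun x => |ζ x|) volD := (hζ.integrable (by norm_num)).abs
  -- Coercivity for K q = ζ - e controls (γ - L) e² by (2γ + β)|e||ζ| + β|ζ|; Young's inequality
  -- absorbs half of the left side. The linear term β|ζ| cannot be avoided, because the growth bound
  -- on q does not vanish where e = 0.
  have key : ∫ x, (γ - L) / 2 * e x ^ 2 ∂volD ≤ ∫ x, (γ * (ζ x - e x) ^ 2 - q x * (ζ x - e x) +
      ((2 * γ + β) ^ 2 / (2 * (γ - L)) * ζ x ^ 2 + β * |ζ x|)) ∂volD := by
    refine integral_mono_ae (he.integrable_sq.const_mul _)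
      (((i1.const_mul γ).sub i2).add ((i3.const_mul _).add (i4.const_mul β))) ?_
    filter_upwards [hm, hg] with x hmx hgx
    have a1 : q x * ζ x ≤ β * (1 + |e x|) * |ζ x| := by
      refine (le_abs_self _).trans ?_
      rw [abs_mul]
      exact mul_le_mul_of_nonneg_right hgx (abs_nonneg _)
    have a2 : e x * ζ x ≤ |e x| * |ζ x| := by rw [← abs_mul]; exact le_abs_self _
    have a3 : (2 * γ + β) * (|e x| * |ζ x|) ≤
        (γ - L) / 2 * e x ^ 2 + (2 * γ + β) ^ 2 / (2 * (γ - L)) * ζ x ^ 2 := by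
      have h := sq_nonneg ((γ - L) * |e x| - (2 * γ + β) * |ζ x|)
      rw [← sq_abs (e x), ← sq_abs (ζ x)]
      have : (γ - L) / 2 * |e x| ^ 2 + (2 * γ + β) ^ 2 / (2 * (γ - L)) * |ζ x| ^ 2 -
          (2 * γ + β) * (|e x| * |ζ x|) =
          ((γ - L) * |e x| - (2 * γ + β) * |ζ x|) ^ 2 / (2 * (γ - L)) := by
        field_simp; ring
      have : 0 ≤ ((γ - L) * |e x| - (2 * γ + β) * |ζ x|) ^ 2 / (2 * (γ - L)) := by positivity
      linarith
    have a4 : γ * (e x * ζ x) ≤ γ * (|e x| * |ζ x|) := mul_le_mul_of_nonneg_left a2 hγ0.le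
    have a5 : 0 ≤ γ * ζ x ^ 2 := by positivity
    nlinarith
  have i5 : Integrable (fun x => γ * (ζ x - e x) ^ 2 - q x * (ζ x - e x)) volD :=
    (i1.const_mul γ).sub i2
  have i6 : Integrable (fun x => (2 * γ + β) ^ 2 / (2 * (γ - L)) * ζ x ^ 2 + β * |ζ x|) volD :=
    (i3.const_mul _).add (i4.const_mul β)
  rw [integral_const_mul, integral_add i5 i6, integral_sub (i1.const_mul γ) i2,
    integral_add (i3.const_mul _) (i4.const_mul β), integral_const_mul, integral_const_mul,
    integral_const_mul] at key
  have key2 : (γ - L) / 2 * ∫ x, e x ^ 2 ∂volD ≤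
      (2 * γ + β) ^ 2 / (2 * (γ - L)) * ∫ x, ζ x ^ 2 ∂volD + β * ∫ x, |ζ x| ∂volD := by linarith
  have := mul_le_mul_of_nonneg_left key2 (show 0 ≤ 2 / (γ - L) by positivity)
  have hne := hd.ne'
  generalize ∫ x, e x ^ 2 ∂volD = a at this ⊢
  generalize ∫ x, ζ x ^ 2 ∂volD = b at this ⊢
  generalize ∫ x, |ζ x| ∂volD = c at this ⊢
  calc a = 2 / (γ - L) * ((γ - L) / 2 * a) := by field_simp
    _ ≤ _ := this
    _ = _ := by field_simp

/-- Stability of solutions of `u + greenOp (f(·,u)) = z` with respect to `z`. -/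
lemma IsNonlinearity.stability {f : ℝ → ℝ → ℝ} {γ L β : ℝ} (hf : IsNonlinearity f L β)
    (hγ : IsPoincareConstant γ) (hLγ : L < γ) {u v z w : ℝ → ℝ} (hu : MemLp u 2 volD)
    (hv : MemLp v 2 volD) (hz : MemLp z 2 volD) (hw : MemLp w 2 volD)
    (hu' : ∀ᵐ x ∂volD, u x + greenOp (fun y => f y (u y)) x = z x)
    (hv' : ∀ᵐ x ∂volD, v x + greenOp (fun y => f y (v y)) x = w x) :
    ∫ x, (u x - v x) ^ 2 ∂volD ≤
      ((2 * γ + β) / (γ - L)) ^ 2 * ∫ x, (z x - w x) ^ 2 ∂volD +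
      2 * β / (γ - L) * ∫ x, |z x - w x| ∂volD := by
  have hfu := hf.memLp_comp measurable_id hf.zero hu
  have hfv := hf.memLp_comp measurable_id hf.zero hv
  refine energy_estimate hγ hLγ (hu.sub hv) (hz.sub hw) (hfu.sub hfv) ?_ ?_ ?_
  · filter_upwards [hu', hv', ae_mem_volD] with x h1 h2 hx
    have := greenOp_sub (hfu.integrable (by norm_num)) (hfv.integrable (by norm_num))
      (Ioo_subset_Icc_self hx)
    simp only [id] at this ⊢
    rw [show ((fun a => f a (u a)) - fun a => f a (v a)) = fun y => f y (u y) - f y (v y) from rfl,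
      this]
    linarith
  · exact Eventually.of_forall fun x => hf.mono x _ _
  · exact Eventually.of_forall fun x => hf.growth x _ _

lemma memLp_two_of_integral_sq_le {u : ℝ → ℝ} (hu : MemLp u 2 volD)
    (h : ∫ x, u x ^ 2 ∂volD ≤ 0) : u =ᵐ[volD] 0 := by
  have h0 := (integral_eq_zero_iff_of_nonneg (fun x => sq_nonneg (u x)) hu.integrable_sq).1
    (le_antisymm h (integral_nonneg fun x => sq_nonneg (u x)))
  exact h0.mono fun x hx => by simpa using hx

lemma IsNonlinearity.unique {f : ℝ → ℝ → ℝ} {γ L β : ℝ} (hf : IsNonlinearity f L β)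
    (hγ : IsPoincareConstant γ) (hLγ : L < γ) {u v z : ℝ → ℝ} (hu : MemLp u 2 volD)
    (hv : MemLp v 2 volD) (hz : MemLp z 2 volD)
    (hu' : ∀ᵐ x ∂volD, u x + greenOp (fun y => f y (u y)) x = z x)
    (hv' : ∀ᵐ x ∂volD, v x + greenOp (fun y => f y (v y)) x = z x) : u =ᵐ[volD] v := by
  have h := hf.stability hγ hLγ hu hv hz hz hu' hv'
  simp only [sub_self, ne_eq, OfNat.ofNat_ne_zero, not_false_eq_true, zero_pow, abs_zero,
    integral_zero, mul_zero, add_zero] at h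
  have := memLp_two_of_integral_sq_le (hu.sub hv) h
  exact this.mono fun x hx => sub_eq_zero.1 hx

/-- Since G(x,y) ≤ y(1 - y) ≤ 2 G(1/2,y), integrability at the single point x = 1/2 controls K h
uniformly. A mild solution provides no more than such pointwise integrability. -/
lemma abs_greenOp_le_of_integrable_half {h : ℝ → ℝ}
    (hh : Integrable (fun y => green (1 / 2) y * h y) volD) {x : ℝ} (hx : x ∈ Icc (0 : ℝ) 1) :
    |greenOp h x| ≤ 2 * ∫ y, |green (1 / 2) y * h y| ∂volD := by
  rw [← integral_const_mul]
  refine norm_integral_le_of_norm_le (G := ℝ) (f := fun y => green x y * h y)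
    (hh.abs.const_mul 2) (ae_volD_of_forall fun y hy => ?_)
  have hy' := Ioo_subset_Icc_self hy
  rw [Real.norm_eq_abs, abs_mul, abs_mul, ← mul_assoc, abs_of_nonneg (green_nonneg hx hy'),
    abs_of_nonneg (green_nonneg (by norm_num) hy')]
  exact mul_le_mul_of_nonneg_right ((green_le hx hy').trans (le_two_mul_green_half hy'))
    (abs_nonneg _)

lemma memLp_greenOp {m : ℝ → ℝ} (hm : Integrable m volD) (p : ℝ≥0∞) : MemLp (greenOp m) p volD :=
  memLp_of_absolutelyContinuous (absolutelyContinuous_greenOp hm) p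

/-- A function with `v = z - greenOp h` is square integrable if `z` is. -/
lemma memLp_of_eq_sub_greenOp {v z h : ℝ → ℝ} (hvm : AEStronglyMeasurable v volD)
    (hz : MemLp z 2 volD) (hh : Integrable (fun y => green (1 / 2) y * h y) volD)
    (heq : ∀ᵐ x ∂volD, v x + greenOp h x = z x) : MemLp v 2 volD := by
  have hb : MemLp (fun x => z x - v x) 2 volD := by
    refine MemLp.of_bound (hz.aestronglyMeasurable.sub hvm)
      (2 * ∫ y, |green (1 / 2) y * h y| ∂volD) ?_
    filter_upwards [heq, ae_mem_volD] with x hx hx'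
    rw [← hx, add_sub_cancel_left]
    exact abs_greenOp_le_of_integrable_half hh (Ioo_subset_Icc_self hx')
  have := hz.sub hb
  refine this.ae_eq (Eventually.of_forall fun x => ?_)
  simp

/-- Weak solutions of `-v'' + h = m` are given by the Green function. -/
lemma eq_greenOp_of_weak {v h m : ℝ → ℝ} (hv : InH10 v)
    (hweak : ∀ φ : ℝ → ℝ, InH10 φ →
      ∫ x, deriv v x * deriv φ x ∂volD + ∫ x, h x * φ x ∂volD = ∫ x, m x * φ x ∂volD)
    {x : ℝ} (hx : x ∈ Icc (0 : ℝ) 1) : v x + greenOp h x = greenOp m x := by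
  have h1 := hweak _ (inH10_green hx)
  rw [integral_deriv_mul_deriv_green hv hx] at h1
  simpa only [greenOp, mul_comm] using h1

/-! ### An abstract existence theorem and L² preliminaries -/

open scoped InnerProductSpace in
/-- A perturbed Zarantonello theorem for `u + K (B u) = z`. -/
lemma exists_add_apply_eq {E : Type*} [NormedAddCommGroup E] [InnerProductSpace ℝ E]
    [CompleteSpace E] (K : E →L[ℝ] E) {γ : ℝ} (hγ : 0 < γ)
    (hK : ∀ q, γ * ‖K q‖ ^ 2 ≤ ⟪K q, q⟫_ℝ) (B : E → E) {l c : ℝ} (hl : 0 ≤ l) (hc0 : 0 ≤ c)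
    (hc : c < γ + l) (hB : ∀ u v, ‖(l • u - B u) - (l • v - B v)‖ ≤ c * ‖u - v‖) (z : E) :
    ∃ u, u + K (B u) = z := by
  have hgl : 0 < γ + l := by linarith
  -- The equation is equivalent to (1 + lK) u = z + K(l u - B u), and 1 + lK is invertible because K
  -- is positive.
  set A : E →L[ℝ] E := 1 + l • K with hA
  have hunit : IsUnit A := by
    refine ContinuousLinearMap.isUnit_of_forall_le_norm_inner_map A (c := 1) one_pos fun x => ?_
    have h1 : ⟪A x, x⟫_ℝ = ‖x‖ ^ 2 + l * ⟪K x, x⟫_ℝ := by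
      simp [hA, inner_add_left, inner_smul_left]
    have h2 : 0 ≤ ⟪K x, x⟫_ℝ := le_trans (by positivity) (hK x)
    have h3 : ‖x‖ ^ 2 ≤ ⟪A x, x⟫_ℝ := by rw [h1]; nlinarith
    simpa using h3.trans (le_abs_self _)
  obtain ⟨U, hU⟩ := hunit
  set R : E →L[ℝ] E := ((U⁻¹ : (E →L[ℝ] E)ˣ) : E →L[ℝ] E)
  have hAR : ∀ x, A (R x) = x := fun x => by
    rw [← hU, ← mul_apply_eq_comp, Units.mul_inv]; rfl
  have hAx : ∀ x, A x = x + l • K x := fun x => by simp [hA]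
  -- w = R K q satisfies w = K(q - l w), so coercivity gives γ‖w‖² ≤ ⟨w, q - l w⟩. The resulting
  -- factor 1/(γ + l) makes the fixed point map Φ a contraction.
  have hRK : ∀ q, ‖R (K q)‖ ≤ ‖q‖ / (γ + l) := by
    intro q
    set w := R (K q) with hw
    have h1 : w + l • K w = K q := by rw [← hAx, hw, hAR]
    have h2 : K (q - l • w) = w := by rw [map_sub, map_smul, ← h1]; abel
    have h3 := hK (q - l • w)
    rw [h2, inner_sub_right, inner_smul_right, real_inner_self_eq_norm_sq] at h3
    have h4 := real_inner_le_norm w q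
    rw [le_div_iff₀ hgl]
    rcases (norm_nonneg w).eq_or_lt with h | h
    · rw [← h, zero_mul]; exact norm_nonneg q
    · have : ‖w‖ * (‖w‖ * (γ + l)) ≤ ‖w‖ * ‖q‖ := by nlinarith
      exact le_of_mul_le_mul_left this h
  set Φ : E → E := fun u => R (z + K (l • u - B u)) with hΦ
  have hcon : ContractingWith (Real.toNNReal (c / (γ + l))) Φ := by
    refine ⟨?_, LipschitzWith.of_dist_le_mul fun u v => ?_⟩
    · rw [Real.toNNReal_lt_one]
      exact (div_lt_one hgl).2 hc
    · rw [dist_eq_norm, dist_eq_norm]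
      have : Φ u - Φ v = R (K ((l • u - B u) - (l • v - B v))) := by
        simp only [hΦ]; rw [← map_sub, add_sub_add_left_eq_sub, ← map_sub]
      rw [this]
      refine (hRK _).trans ?_
      rw [Real.coe_toNNReal _ (by positivity), div_mul_eq_mul_div]
      exact div_le_div_of_nonneg_right (hB u v) hgl.le
  refine ⟨hcon.fixedPoint Φ, ?_⟩
  set u := hcon.fixedPoint Φ
  have hfix : Φ u = u := hcon.fixedPoint_isFixedPt
  have h1 : A u = z + K (l • u - B u) := by
    conv_lhs => rw [← hfix]
    exact hAR _
  rw [hAx, map_sub, map_smul] at h1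
  have h2 : u + K (B u) + l • K u = z + l • K u := by rw [add_right_comm, h1]; abel
  exact add_right_cancel h2

/-- The integral of (|h| - c)² is nonnegative for c the mean of |h|. -/
lemma sq_integral_abs_le {α : Type*} [MeasurableSpace α] {μ : Measure α} [IsProbabilityMeasure μ]
    {h : α → ℝ} (hh : MemLp h 2 μ) : (∫ x, |h x| ∂μ) ^ 2 ≤ ∫ x, h x ^ 2 ∂μ := by
  set c := ∫ x, |h x| ∂μ with hc
  have i1 := hh.integrable_sq
  have i2 : Integrable (fun x => |h x|) μ := (hh.integrable (by norm_num)).abs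
  have h0 : 0 ≤ ∫ x, (h x ^ 2 - 2 * c * |h x| + c ^ 2) ∂μ := by
    refine integral_nonneg fun x => ?_
    have : h x ^ 2 - 2 * c * |h x| + c ^ 2 = (|h x| - c) ^ 2 := by rw [← sq_abs (h x)]; ring
    simp only [this]; positivity
  have i3 : Integrable (fun x => h x ^ 2 - 2 * c * |h x|) μ := i1.sub (i2.const_mul _)
  rw [integral_add i3 (integrable_const _), integral_sub i1 (i2.const_mul _), integral_const_mul, integral_const, ← hc] at h0
  simp at h0
  nlinarith

lemma sq_greenOp_le {m : ℝ → ℝ} (hm : MemLp m 2 volD) {x : ℝ} (hx : x ∈ Icc (0 : ℝ) 1) :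
    greenOp m x ^ 2 ≤ ∫ y, m y ^ 2 ∂volD := by
  refine le_trans ?_ (sq_integral_abs_le hm)
  rw [← sq_abs]
  exact pow_le_pow_left₀ (abs_nonneg _) (abs_greenOp_le (hm.integrable (by norm_num)) hx) 2

lemma norm_sq_eq_integral {α : Type*} [MeasurableSpace α] {μ : Measure α} (h : Lp ℝ 2 μ) :
    ‖h‖ ^ 2 = ∫ x, h x ^ 2 ∂μ := by
  rw [← real_inner_self_eq_norm_sq, L2.inner_def]
  refine integral_congr_ae (Eventually.of_forall fun x => ?_)
  simp [sq]

lemma norm_toLp_sq {α : Type*} [MeasurableSpace α] {μ : Measure α} {h : α → ℝ}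
    (hh : MemLp h 2 μ) : ‖hh.toLp h‖ ^ 2 = ∫ x, h x ^ 2 ∂μ := by
  rw [norm_sq_eq_integral]
  exact integral_congr_ae (hh.coeFn_toLp.mono fun x hx => by simp only [hx])

/-! ### The Green operator on L²(D × Ω) -/

section Field

variable {Ω : Type*} [MeasurableSpace Ω] {P : Measure Ω} [IsProbabilityMeasure P]

/-- The Green operator acting on the space variable of a random field. -/
def greenField (h : ℝ × Ω → ℝ) (p : ℝ × Ω) : ℝ := greenOp (fun y => h (y, p.2)) p.1

lemma measurable_greenField {h : ℝ × Ω → ℝ} (hh : Measurable h) : Measurable (greenField h) := by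
  unfold greenField greenOp
  refine (StronglyMeasurable.integral_prod_right
    (f := fun (p : ℝ × Ω) y => green p.1 y * h (y, p.2)) ?_).measurable
  refine Measurable.stronglyMeasurable ?_
  refine Measurable.mul (measurable_green.comp (f := fun q : (ℝ × Ω) × ℝ => (q.1.1, q.2)) ?_)
    (hh.comp (f := fun q : (ℝ × Ω) × ℝ => (q.2, q.1.2)) ?_) <;> fun_prop

lemma ae_memLp_section {h : ℝ × Ω → ℝ} (hh : MemLp h 2 (volD.prod P)) :
    ∀ᵐ ω ∂P, MemLp (fun y => h (y, ω)) 2 volD := by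
  have h1 := hh.integrable_sq.prod_left_ae
  have h2 : ∀ᵐ ω ∂P, AEStronglyMeasurable (fun y => h (y, ω)) volD :=
    (hh.integrable (by norm_num)).prod_left_ae.mono fun ω hω => hω.aestronglyMeasurable
  filter_upwards [h1, h2] with ω h1 h2
  exact (memLp_two_iff_integrable_sq h2).2 h1

omit [IsProbabilityMeasure P] in
lemma ae_prod_snd {p : Ω → Prop} (h : ∀ᵐ ω ∂P, p ω) : ∀ᵐ q ∂(volD.prod P), p q.2 :=
  Measure.quasiMeasurePreserving_snd.ae h

omit [IsProbabilityMeasure P] in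
lemma ae_prod_fst {p : ℝ → Prop} (h : ∀ᵐ x ∂volD, p x) : ∀ᵐ q ∂(volD.prod P), p q.1 :=
  Measure.quasiMeasurePreserving_fst.ae h

lemma ae_sq_greenField_le {h : ℝ × Ω → ℝ} (hh : MemLp h 2 (volD.prod P)) :
    ∀ᵐ p ∂(volD.prod P), greenField h p ^ 2 ≤ ∫ y, h (y, p.2) ^ 2 ∂volD := by
  filter_upwards [ae_prod_snd (ae_memLp_section hh), ae_prod_fst ae_mem_volD] with p h1 h2
  exact sq_greenOp_le h1 (Ioo_subset_Icc_self h2)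

lemma memLp_greenField {h : ℝ × Ω → ℝ} (hm : Measurable h) (hh : MemLp h 2 (volD.prod P)) :
    MemLp (greenField h) 2 (volD.prod P) := by
  refine (memLp_two_iff_integrable_sq (measurable_greenField hm).aestronglyMeasurable).2 ?_
  have h1 : Integrable (fun p : ℝ × Ω => ∫ y, h (y, p.2) ^ 2 ∂volD) (volD.prod P) :=
    (hh.integrable_sq.integral_prod_right).comp_snd volD
  refine h1.mono' ((measurable_greenField hm).pow_const 2).aestronglyMeasurable ?_
  filter_upwards [ae_sq_greenField_le hh] with p hp
  rwa [Real.norm_eq_abs, abs_of_nonneg (sq_nonneg _)]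

lemma integral_sq_greenField_le {h : ℝ × Ω → ℝ} (hm : Measurable h)
    (hh : MemLp h 2 (volD.prod P)) :
    ∫ p, greenField h p ^ 2 ∂(volD.prod P) ≤ ∫ p, h p ^ 2 ∂(volD.prod P) := by
  have h1 : Integrable (fun p : ℝ × Ω => ∫ y, h (y, p.2) ^ 2 ∂volD) (volD.prod P) :=
    (hh.integrable_sq.integral_prod_right).comp_snd volD
  refine (integral_mono_ae (memLp_greenField hm hh).integrable_sq h1
    (ae_sq_greenField_le hh)).trans (le_of_eq ?_)
  rw [integral_prod_symm _ hh.integrable_sq, integral_prod_symm _ h1]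
  simp

lemma poincare_greenField {γ : ℝ} (hγ : IsPoincareConstant γ) {h : ℝ × Ω → ℝ}
    (hm : Measurable h) (hh : MemLp h 2 (volD.prod P)) :
    γ * ∫ p, greenField h p ^ 2 ∂(volD.prod P) ≤ ∫ p, h p * greenField h p ∂(volD.prod P) := by
  have hK := memLp_greenField hm hh
  have i1 := hK.integrable_sq
  have i2 : Integrable (fun p => h p * greenField h p) (volD.prod P) := hh.integrable_mul hK
  rw [integral_prod_symm _ i1, integral_prod_symm _ i2, ← integral_const_mul]
  refine integral_mono_ae (i1.integral_prod_right.const_mul γ) i2.integral_prod_right ?_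
  filter_upwards [ae_memLp_section hh] with ω hω
  exact poincare_greenOp hγ (hω.integrable (by norm_num))

/-- If two fields agree almost everywhere, so do their images, at every point of `[0,1]`. -/
lemma ae_greenField_congr {h h' : ℝ × Ω → ℝ} (hh : h =ᵐ[volD.prod P] h') :
    ∀ᵐ ω ∂P, ∀ x, greenField h (x, ω) = greenField h' (x, ω) := by
  have h1 : ∀ᵐ ω ∂P, ∀ᵐ y ∂volD, h (y, ω) = h' (y, ω) := by
    have : ∀ᵐ q ∂(P.prod volD), h q.swap = h' q.swap :=
      Measure.measurePreserving_swap.quasiMeasurePreserving.ae hh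
    exact Measure.ae_ae_of_ae_prod this
  filter_upwards [h1] with ω hω x
  exact greenOp_congr hω x

lemma ae_greenField_congr' {h h' : ℝ × Ω → ℝ} (hh : h =ᵐ[volD.prod P] h') :
    greenField h =ᵐ[volD.prod P] greenField h' := by
  filter_upwards [ae_prod_snd (ae_greenField_congr hh)] with p hp using hp p.1

lemma ae_greenField_add {h h' : ℝ × Ω → ℝ} (hh : MemLp h 2 (volD.prod P))
    (hh' : MemLp h' 2 (volD.prod P)) :
    greenField (fun p => h p + h' p) =ᵐ[volD.prod P] fun p => greenField h p + greenField h' p := by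
  filter_upwards [ae_prod_snd (ae_memLp_section hh), ae_prod_snd (ae_memLp_section hh'),
    ae_prod_fst ae_mem_volD] with p h1 h2 h3
  exact greenOp_add (h1.integrable (by norm_num)) (h2.integrable (by norm_num))
    (Ioo_subset_Icc_self h3)

variable (P) in
/-- The Green operator on `L²(D × Ω)`. -/
def greenL2 : Lp ℝ 2 (volD.prod P) →L[ℝ] Lp ℝ 2 (volD.prod P) :=
  LinearMap.mkContinuous
    { toFun := fun h => (memLp_greenField (Lp.stronglyMeasurable h).measurable (Lp.memLp h)).toLp _
      map_add' := fun h h' => by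
        ext1
        refine (MemLp.coeFn_toLp _).trans (((ae_greenField_congr' (Lp.coeFn_add h h')).trans
          (ae_greenField_add (Lp.memLp h) (Lp.memLp h'))).trans ?_)
        refine EventuallyEq.trans ?_ (Lp.coeFn_add _ _).symm
        filter_upwards [MemLp.coeFn_toLp (memLp_greenField (Lp.stronglyMeasurable h).measurable
          (Lp.memLp h)), MemLp.coeFn_toLp (memLp_greenField (Lp.stronglyMeasurable h').measurable
          (Lp.memLp h'))] with p h1 h2
        rw [Pi.add_apply, h1, h2]
      map_smul' := fun c h => by
        ext1
        refine (MemLp.coeFn_toLp _).trans ((ae_greenField_congr' (Lp.coeFn_smul c h)).trans ?_)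
        refine EventuallyEq.trans ?_ (Lp.coeFn_smul _ _).symm
        filter_upwards [MemLp.coeFn_toLp (memLp_greenField (Lp.stronglyMeasurable h).measurable
          (Lp.memLp h))] with p h1
        rw [Pi.smul_apply, RingHom.id_apply, h1]
        exact greenOp_const_mul c _ _ }
    1 fun h => by
      rw [one_mul]
      refine le_of_sq_le_sq ?_ (norm_nonneg _)
      rw [norm_sq_eq_integral h]
      refine (norm_toLp_sq (memLp_greenField (Lp.stronglyMeasurable h).measurable
        (Lp.memLp h))).trans_le ?_
      exact integral_sq_greenField_le (Lp.stronglyMeasurable h).measurable (Lp.memLp h)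

lemma coeFn_greenL2 (h : Lp ℝ 2 (volD.prod P)) : greenL2 P h =ᵐ[volD.prod P] greenField h :=
  (memLp_greenField (Lp.stronglyMeasurable h).measurable (Lp.memLp h)).coeFn_toLp

open scoped InnerProductSpace in
lemma poincare_greenL2 {γ : ℝ} (hγ : IsPoincareConstant γ) (h : Lp ℝ 2 (volD.prod P)) :
    γ * ‖greenL2 P h‖ ^ 2 ≤ ⟪greenL2 P h, h⟫_ℝ := by
  have h1 := poincare_greenField hγ (Lp.stronglyMeasurable h).measurable (Lp.memLp h)
  rw [norm_sq_eq_integral, L2.inner_def]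
  have e1 : ∫ p, greenL2 P h p ^ 2 ∂(volD.prod P) = ∫ p, greenField h p ^ 2 ∂(volD.prod P) :=
    integral_congr_ae ((coeFn_greenL2 h).mono fun p hp => by simp only [hp])
  have e2 : ∫ p, ⟪greenL2 P h p, h p⟫_ℝ ∂(volD.prod P) =
      ∫ p, h p * greenField h p ∂(volD.prod P) :=
    integral_congr_ae ((coeFn_greenL2 h).mono fun p hp => by simp [hp])
  rw [e1, e2]
  exact h1

end Field

/-! ### Lipschitz regularization of the nonlinearity -/

/-- Averages of `f(x,·)` over intervals of length `ε`. -/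
def mollify (f : ℝ → ℝ → ℝ) (ε : ℝ) (x r : ℝ) : ℝ := ∫ t in (0 : ℝ)..1, f x (r + ε * t)

section Mollify

variable {f : ℝ → ℝ → ℝ} {L β : ℝ} (hf : IsNonlinearity f L β)
include hf

lemma IsNonlinearity.measurable_right (x : ℝ) : Measurable (f x) :=
  hf.measurable.comp measurable_prodMk_left

lemma IsNonlinearity.intervalIntegrable (x a b : ℝ) : IntervalIntegrable (f x) volume a b := by
  have h1 : IntervalIntegrable (fun r => |f x 0| + β * (1 + |r|)) volume a b :=
    Continuous.intervalIntegrable (by fun_prop) _ _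
  exact h1.mono_fun' (hf.measurable_right x).aestronglyMeasurable
    (Eventually.of_forall fun r => hf.abs_le x r)

lemma IsNonlinearity.intervalIntegrable_comp (x r ε : ℝ) :
    IntervalIntegrable (fun t => f x (r + ε * t)) volume 0 1 := by
  have h1 : IntervalIntegrable (fun t => |f x 0| + β * (1 + |r + ε * t|)) volume 0 1 :=
    Continuous.intervalIntegrable (by fun_prop) _ _
  exact h1.mono_fun' ((hf.measurable_right x).comp (by fun_prop)).aestronglyMeasurable
    (Eventually.of_forall fun t => hf.abs_le x _)

lemma IsNonlinearity.mollify_sub (x r s ε δ : ℝ) : mollify f ε x r - mollify f δ x s =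
    ∫ t in (0 : ℝ)..1, (f x (r + ε * t) - f x (s + δ * t)) :=
  (intervalIntegral.integral_sub (hf.intervalIntegrable_comp x r ε)
    (hf.intervalIntegrable_comp x s δ)).symm

lemma IsNonlinearity.mollify_growth (x r s ε : ℝ) :
    |mollify f ε x r - mollify f ε x s| ≤ β * (1 + |r - s|) := by
  rw [hf.mollify_sub]
  have := intervalIntegral.norm_integral_le_of_norm_le_const (a := 0) (b := 1)
    (f := fun t => f x (r + ε * t) - f x (s + ε * t)) (C := β * (1 + |r - s|)) fun t _ => by
      have := hf.growth x (r + ε * t) (s + ε * t)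
      rwa [add_sub_add_right_eq_sub] at this
  simpa using this

lemma IsNonlinearity.abs_mollify_sub_le (x r s : ℝ) {ε : ℝ} (hε : 0 ≤ ε) (hε1 : ε ≤ 1) :
    |mollify f ε x r - f x s| ≤ β * (2 + |r - s|) := by
  have h0 : f x s = mollify f 0 x s := by simp [mollify]
  rw [h0, hf.mollify_sub]
  have := intervalIntegral.norm_integral_le_of_norm_le_const (a := 0) (b := 1)
    (f := fun t => f x (r + ε * t) - f x (s + 0 * t)) (C := β * (2 + |r - s|)) fun t ht => by
      rw [uIoc_of_le zero_le_one] at ht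
      refine (hf.growth x _ _).trans (mul_le_mul_of_nonneg_left ?_ hf.β_pos.le)
      have h1 : |r + ε * t - (s + 0 * t)| ≤ |r - s| + |ε * t| := by
        rw [show r + ε * t - (s + 0 * t) = (r - s) + ε * t by ring]; exact abs_add_le _ _
      have h2 : |ε * t| ≤ 1 := by
        rw [abs_of_nonneg (mul_nonneg hε ht.1.le)]
        exact mul_le_one₀ hε1 ht.1.le ht.2
      linarith
  simpa using this

/-- One-sided estimate for two different averages. -/
lemma IsNonlinearity.mollify_mono (x r s : ℝ) {ε δ : ℝ} (hκ : |ε - δ| ≤ 1) :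
    -L * (r - s) ^ 2 - |ε - δ| * (2 * L + 2 * β) * (1 + |r - s|) ≤
      (mollify f ε x r - mollify f δ x s) * (r - s) := by
  rw [hf.mollify_sub, ← intervalIntegral.integral_mul_const]
  have h1 : ∫ t in (0 : ℝ)..1, (-L * (r - s) ^ 2 - |ε - δ| * (2 * L + 2 * β) * (1 + |r - s|)) ≤
      ∫ t in (0 : ℝ)..1, (f x (r + ε * t) - f x (s + δ * t)) * (r - s) := by
    refine intervalIntegral.integral_mono_on zero_le_one (by simp)
      (((hf.intervalIntegrable_comp x r ε).sub (hf.intervalIntegrable_comp x s δ)).mul_const _)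
      fun t ht => ?_
    have hL := hf.L_pos
    have hβ := hf.β_pos
    set a := r + ε * t
    set b := s + δ * t
    set κ := |ε - δ| with hκd
    have hκ0 : 0 ≤ κ := abs_nonneg _
    -- The one-sided bound applies to a - b rather than to r - s. The two differ by at most κ, and
    -- the growth condition bounds the cost of the exchange by a multiple of κ(1 + |r - s|).
    have hab : a - b = (r - s) + (ε - δ) * t := by simp only [a, b]; ring
    have ht1 : |(ε - δ) * t| ≤ κ := by
      rw [abs_mul, abs_of_nonneg ht.1]; exact mul_le_of_le_one_right hκ0 ht.2
    have h1 : |a - b| ≤ |r - s| + κ := by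
      rw [hab]; exact (abs_add_le _ _).trans (by linarith)
    have h2 := hf.mono x a b
    have h3 := hf.growth x a b
    have h4 : (f x a - f x b) * ((ε - δ) * t) ≤ β * (1 + |a - b|) * κ := by
      refine (le_abs_self _).trans ?_
      rw [abs_mul]
      exact mul_le_mul h3 ht1 (abs_nonneg _) (by positivity)
    have h5 : (f x a - f x b) * (r - s) = (f x a - f x b) * (a - b) -
        (f x a - f x b) * ((ε - δ) * t) := by rw [hab]; ring
    have h6 : (a - b) ^ 2 ≤ (|r - s| + κ) ^ 2 := by
      rw [← sq_abs (a - b)]; exact pow_le_pow_left₀ (abs_nonneg _) h1 2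
    have h7 : (|r - s| + κ) ^ 2 ≤ (r - s) ^ 2 + κ * (2 * (1 + |r - s|)) := by
      rw [← sq_abs (r - s)]; nlinarith [abs_nonneg (r - s)]
    have h8 : β * (1 + |a - b|) * κ ≤ β * (2 * (1 + |r - s|)) * κ := by
      refine mul_le_mul_of_nonneg_right (mul_le_mul_of_nonneg_left ?_ hβ.le) hκ0
      linarith [abs_nonneg (r - s)]
    have h9 : L * (a - b) ^ 2 ≤ L * ((r - s) ^ 2 + κ * (2 * (1 + |r - s|))) :=
      mul_le_mul_of_nonneg_left (h6.trans h7) hL.le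
    rw [h5]
    nlinarith
  simpa using h1

/-- L and β survive averaging unchanged, so every estimate for f holds for its averages uniformly in
ε. -/
lemma IsNonlinearity.mollify (ε : ℝ) (hε : 0 ≤ ε) (hε1 : ε ≤ 1) :
    IsNonlinearity (mollify f ε) L β where
  measurable := by
    have : Measurable (fun p : (ℝ × ℝ) × ℝ => f p.1.1 (p.1.2 + ε * p.2)) :=
      hf.measurable.comp (f := fun p : (ℝ × ℝ) × ℝ => (p.1.1, p.1.2 + ε * p.2)) (by fun_prop)
    have h2 := (this.stronglyMeasurable.integral_prod_right'
      (ν := volume.restrict (Ioc (0 : ℝ) 1))).measurable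
    simpa only [FBmBVP.mollify, intervalIntegral.integral_of_le zero_le_one] using h2
  zero := by
    have hm : Measurable (fun x => FBmBVP.mollify f ε x 0) := by
      have : Measurable (fun p : ℝ × ℝ => f p.1 (0 + ε * p.2)) :=
        hf.measurable.comp (f := fun p : ℝ × ℝ => (p.1, 0 + ε * p.2)) (by fun_prop)
      have h2 := (this.stronglyMeasurable.integral_prod_right'
        (ν := volume.restrict (Ioc (0 : ℝ) 1))).measurable
      simpa only [FBmBVP.mollify, intervalIntegral.integral_of_le zero_le_one] using h2
    have h1 : MemLp (fun x => |f x 0| + β * 2) 2 volD := hf.zero.norm.add (memLp_const _)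
    refine h1.mono hm.aestronglyMeasurable (Eventually.of_forall fun x => ?_)
    have h2 := hf.abs_mollify_sub_le x 0 0 hε hε1
    have h3 := abs_sub_abs_le_abs_sub (FBmBVP.mollify f ε x 0) (f x 0)
    simp only [sub_self, abs_zero, add_zero] at h2
    rw [Real.norm_eq_abs, Real.norm_eq_abs]
    exact le_trans (by linarith) (le_abs_self _)
  L_pos := hf.L_pos
  β_pos := hf.β_pos
  mono := fun x r s => by
    have := hf.mollify_mono x r s (ε := ε) (δ := ε) (by simp)
    simpa using this
  growth := fun x r s => hf.mollify_growth x r s ε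

/-- An increment of the average equals ε⁻¹ times the integral of f(x,t + ε) - f(x,t) over t between
s and r, and the growth condition bounds that integrand by β(1 + ε). Continuity of f plays no role.
-/
lemma IsNonlinearity.mollify_lipschitz (x r s : ℝ) {ε : ℝ} (hε : 0 < ε) :
    |FBmBVP.mollify f ε x r - FBmBVP.mollify f ε x s| ≤ β * (1 + ε) / ε * |r - s| := by
  have hi := hf.intervalIntegrable x
  have e : ∀ r, FBmBVP.mollify f ε x r = ε⁻¹ * ∫ t in r..(r + ε), f x t := fun r => by
    rw [FBmBVP.mollify, intervalIntegral.integral_comp_add_mul (fun t => f x t) hε.ne']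
    simp
  have h1 : ∫ t in s..r, f x (t + ε) = ∫ t in (s + ε)..(r + ε), f x t := by simp
  have h2 : (∫ t in r..(r + ε), f x t) - ∫ t in s..(s + ε), f x t =
      ∫ t in s..r, (f x (t + ε) - f x t) := by
    rw [intervalIntegral.integral_sub (by simpa using (hi (s + ε) (r + ε)).comp_add_right ε)
      (hi s r), h1]
    have h3 := intervalIntegral.integral_add_adjacent_intervals (hi s r) (hi r (r + ε))
    have h4 := intervalIntegral.integral_add_adjacent_intervals (hi s (s + ε)) (hi (s + ε) (r + ε))
    linarith
  have h3 := intervalIntegral.norm_integral_le_of_norm_le_const (a := s) (b := r)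
    (f := fun t => f x (t + ε) - f x t) (C := β * (1 + ε)) fun t _ => by
      have := hf.growth x (t + ε) t
      rwa [add_sub_cancel_left, abs_of_pos hε] at this
  rw [e, e, ← mul_sub, h2, abs_mul, abs_of_pos (inv_pos.2 hε)]
  calc ε⁻¹ * |∫ t in s..r, (f x (t + ε) - f x t)| ≤ ε⁻¹ * (β * (1 + ε) * |r - s|) :=
        mul_le_mul_of_nonneg_left h3 (inv_pos.2 hε).le
    _ = _ := by field_simp

omit hf in
lemma tendsto_mollify {x r : ℝ} (hc : ContinuousAt (f x) r) {ε : ℕ → ℝ} {u : ℕ → ℝ}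
    (hε0 : ∀ n, 0 ≤ ε n) (hε : Tendsto ε atTop (𝓝 0)) (hu : Tendsto u atTop (𝓝 r))
    (hi : ∀ r ε, IntervalIntegrable (fun t => f x (r + ε * t)) volume 0 1) :
    Tendsto (fun n => FBmBVP.mollify f (ε n) x (u n)) atTop (𝓝 (f x r)) := by
  rw [Metric.tendsto_atTop]
  intro η hη
  obtain ⟨δ, hδ, hδ'⟩ := Metric.continuousAt_iff.1 hc (η / 2) (half_pos hη)
  obtain ⟨N1, h1⟩ := Metric.tendsto_atTop.1 hε (δ / 2) (half_pos hδ)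
  obtain ⟨N2, h2⟩ := Metric.tendsto_atTop.1 hu (δ / 2) (half_pos hδ)
  refine ⟨max N1 N2, fun n hn => ?_⟩
  have a1 := h1 n (le_trans (le_max_left _ _) hn)
  have a2 := h2 n (le_trans (le_max_right _ _) hn)
  rw [Real.dist_eq, sub_zero, abs_of_nonneg (hε0 n)] at a1
  rw [Real.dist_eq] at a2
  have e : FBmBVP.mollify f (ε n) x (u n) - f x r =
      ∫ t in (0 : ℝ)..1, (f x (u n + ε n * t) - f x r) := by
    rw [intervalIntegral.integral_sub (hi _ _) (by simp)]
    simp [FBmBVP.mollify]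
  have := intervalIntegral.norm_integral_le_of_norm_le_const (a := 0) (b := 1)
    (f := fun t => f x (u n + ε n * t) - f x r) (C := η / 2) fun t ht => by
      rw [uIoc_of_le zero_le_one] at ht
      refine (hδ' ?_).le
      rw [Real.dist_eq, show u n + ε n * t - r = (u n - r) + ε n * t by ring]
      refine (abs_add_le _ _).trans_lt ?_
      have : |ε n * t| ≤ ε n := by
        rw [abs_of_nonneg (mul_nonneg (hε0 n) ht.1.le)]
        exact mul_le_of_le_one_right (hε0 n) ht.2
      linarith
  rw [Real.dist_eq, e]
  simp only [Real.norm_eq_abs, sub_zero, abs_one, mul_one] at this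
  linarith

end Mollify

/-! ### Existence up to the identification of the nonlinear term -/

open scoped InnerProductSpace in
/-- If `K h n` converges and `h` is bounded, then the limit is in the range of `K`. -/
lemma exists_apply_eq_of_tendsto {E : Type*} [NormedAddCommGroup E] [InnerProductSpace ℝ E]
    [CompleteSpace E] (K : E →L[ℝ] E) {h : ℕ → E} {R : ℝ} (hR : ∀ n, ‖h n‖ ≤ R) {r : E}
    (hr : Tendsto (fun n => K (h n)) atTop (𝓝 r)) : ∃ h₀, K h₀ = r := by
  -- Banach–Alaoglu in the dual of E, identified with E by Riesz. A weak cluster point of h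
  -- suffices: evaluated at the adjoint of K applied to w, it must agree with the limit of ⟨K (h n),
  -- w⟩.
  let φ : ℕ → WeakDual ℝ E := fun n =>
    StrongDual.toWeakDual (InnerProductSpace.toDual ℝ E (h n))
  have hcpt := WeakDual.isCompact_closedBall (𝕜 := ℝ) (0 : StrongDual ℝ E) R
  obtain ⟨a, -, ha⟩ := hcpt.exists_mapClusterPt_of_frequently (l := atTop) (f := φ)
    (Frequently.of_forall fun n => by
      simp only [φ, mem_preimage, mem_closedBall_zero_iff]
      exact ((InnerProductSpace.toDual ℝ E).norm_map (h n)).trans_le (hR n))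
  refine ⟨(InnerProductSpace.toDual ℝ E).symm (WeakDual.toStrongDual a), ?_⟩
  refine ext_inner_right ℝ fun w => ?_
  rw [← ContinuousLinearMap.adjoint_inner_right, InnerProductSpace.toDual_symm_apply]
  set w' := ContinuousLinearMap.adjoint K w
  have h1 : MapClusterPt (a w') atTop fun n => φ n w' :=
    ha.continuousAt_comp (WeakDual.eval_continuous w').continuousAt
  have h2 : Tendsto (fun n => φ n w') atTop (𝓝 ⟪r, w⟫_ℝ) := by
    have : (fun n => φ n w') = fun n => ⟪K (h n), w⟫_ℝ := by
      ext n
      rw [← ContinuousLinearMap.adjoint_inner_right]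
      rfl
    rw [this]
    exact hr.inner tendsto_const_nhds
  have h3 : (𝓝 (a w') ⊓ 𝓝 ⟪r, w⟫_ℝ).NeBot := h1.neBot.mono (inf_le_inf_left _ h2)
  exact eq_of_nhds_neBot h3

section Existence

variable {Ω : Type*} [MeasurableSpace Ω] {P : Measure Ω} [IsProbabilityMeasure P]
variable {f : ℝ → ℝ → ℝ} {L β γ : ℝ}

lemma IsNonlinearity.memLp_field (hf : IsNonlinearity f L β) {u : ℝ × Ω → ℝ}
    (hu : MemLp u 2 (volD.prod P)) : MemLp (fun p => f p.1 (u p)) 2 (volD.prod P) :=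
  hf.memLp_comp measurable_fst (hf.zero.comp_fst P) hu

/-- The superposition operator on `L²(D × Ω)`. -/
def IsNonlinearity.superpos (hf : IsNonlinearity f L β) (u : Lp ℝ 2 (volD.prod P)) :
    Lp ℝ 2 (volD.prod P) :=
  (hf.memLp_field (Lp.memLp u)).toLp _

lemma IsNonlinearity.coeFn_superpos (hf : IsNonlinearity f L β) (u : Lp ℝ 2 (volD.prod P)) :
    hf.superpos u =ᵐ[volD.prod P] fun p => f p.1 (u p) :=
  (hf.memLp_field (Lp.memLp u)).coeFn_toLp

/-- The difference quotients of f(x,·) lie in [-L, M]; subtracting them from the midpoint (M - L)/2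
leaves values bounded by half the length, (M + L)/2. -/
lemma IsNonlinearity.abs_mul_sub_le (hf : IsNonlinearity f L β) {M : ℝ}
    (hM : ∀ x r s, |f x r - f x s| ≤ M * |r - s|) (x r s : ℝ) :
    |((M - L) / 2 * r - f x r) - ((M - L) / 2 * s - f x s)| ≤ (M + L) / 2 * |r - s| := by
  have h1 := hf.mono x r s
  have h2 := _root_.abs_le.1 (hM x r s)
  rcases lt_trichotomy (r - s) 0 with h | h | h
  · rw [abs_of_neg h] at h2 ⊢
    have h3 : f x r - f x s ≤ -L * (r - s) := by
      by_contra! hc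
      nlinarith
    rw [_root_.abs_le]
    constructor <;> linarith
  · have : r = s := by linarith
    subst this
    simp
  · rw [abs_of_pos h] at h2 ⊢
    have h3 : -L * (r - s) ≤ f x r - f x s := by
      by_contra! hc
      nlinarith
    rw [_root_.abs_le]
    constructor <;> linarith

lemma IsNonlinearity.exists_solution_of_lipschitz (hf : IsNonlinearity f L β)
    (hγ : IsPoincareConstant γ) (hLγ : L < γ) {M : ℝ} (hLM : L ≤ M)
    (hM : ∀ x r s, |f x r - f x s| ≤ M * |r - s|) (z : Lp ℝ 2 (volD.prod P)) :
    ∃ u : Lp ℝ 2 (volD.prod P), u + greenL2 P (hf.superpos u) = z := by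
  have hL := hf.L_pos
  -- The contraction condition c < γ + l reduces to L < γ, whatever the Lipschitz constant M.
  refine exists_add_apply_eq (greenL2 P) hγ.1 (poincare_greenL2 hγ) hf.superpos
    (l := (M - L) / 2) (c := (M + L) / 2) (by linarith) (by linarith) (by linarith) ?_ z
  intro u v
  refine Lp.norm_le_mul_norm_of_ae_le_mul ?_
  filter_upwards [Lp.coeFn_sub ((((M - L) / 2) • u - hf.superpos u))
    ((((M - L) / 2) • v - hf.superpos v)), Lp.coeFn_sub (((M - L) / 2) • u) (hf.superpos u),
    Lp.coeFn_sub (((M - L) / 2) • v) (hf.superpos v), Lp.coeFn_smul ((M - L) / 2) u,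
    Lp.coeFn_smul ((M - L) / 2) v, hf.coeFn_superpos u, hf.coeFn_superpos v, Lp.coeFn_sub u v]
    with p h1 h2 h3 h4 h5 h6 h7 h8
  rw [h1, h8, Pi.sub_apply, Pi.sub_apply, h2, h3, Pi.sub_apply, Pi.sub_apply, h4, h5, h6, h7]
  exact hf.abs_mul_sub_le hM _ _ _

/-- Coercivity gives γ‖e‖² ≤ -⟨e, q⟩. The defect c(1 + |e|) is at most 3c/2 + c e²/2, whose
quadratic part is absorbed because c ≤ (γ - L)/2. The defect allows for q being the difference of
two distinct averages of f. -/
lemma norm_sq_le_of_superpos {c : ℝ} (hγ : IsPoincareConstant γ) (hLγ : L < γ)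
    (hc : 0 ≤ c) (hc' : c ≤ (γ - L) / 2)
    {e q : Lp ℝ 2 (volD.prod P)} (he : e + greenL2 P q = 0)
    (hq : ∀ᵐ p ∂(volD.prod P), -L * e p ^ 2 - c * (1 + |e p|) ≤ q p * e p) :
    ‖e‖ ^ 2 ≤ 4 * c / (γ - L) := by
  have hd : 0 < γ - L := sub_pos.2 hLγ
  have h1 := poincare_greenL2 hγ q
  have h2 : greenL2 P q = -e := eq_neg_of_add_eq_zero_right he
  rw [h2, norm_neg, inner_neg_left, L2.inner_def] at h1
  have i1 : Integrable (fun p => e p ^ 2) (volD.prod P) := (Lp.memLp e).integrable_sq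
  have i2 : Integrable (fun p => q p * e p) (volD.prod P) := (Lp.memLp q).integrable_mul (Lp.memLp e)
  have h3 : ∫ p, (-(L + c / 2) * e p ^ 2 - 3 * c / 2) ∂(volD.prod P) ≤
      ∫ p, q p * e p ∂(volD.prod P) := by
    refine integral_mono_ae ((i1.const_mul _).sub (integrable_const _)) i2 ?_
    filter_upwards [hq] with p hp
    have : |e p| ≤ 1 / 2 + e p ^ 2 / 2 := by
      rw [← sq_abs (e p)]; nlinarith [sq_nonneg (|e p| - 1)]
    nlinarith
  rw [integral_sub (i1.const_mul _) (integrable_const _), integral_const_mul,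
    ← norm_sq_eq_integral] at h3
  have h4 : ∫ p, inner ℝ (e p) (q p) ∂(volD.prod P) = ∫ p, q p * e p ∂(volD.prod P) := by
    simp
  rw [h4] at h1
  simp at h3
  rw [le_div_iff₀ hd]
  nlinarith [sq_nonneg ‖e‖]

/-- Dominated convergence in `L²` for superposition operators of linear growth. -/
lemma tendsto_integral_sq_of_abs_le {α : Type*} [MeasurableSpace α] {μ : Measure α}
    [IsFiniteMeasure μ] {d e : ℕ → α → ℝ} {b : ℝ} (hb : 0 ≤ b) (hd : ∀ n, MemLp (d n) 2 μ)
    (he : ∀ n, MemLp (e n) 2 μ) (hde : ∀ n, ∀ᵐ a ∂μ, |d n a| ≤ b * (2 + |e n a|))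
    (h0 : ∀ᵐ a ∂μ, Tendsto (fun n => d n a) atTop (𝓝 0))
    (he0 : Tendsto (fun n => ∫ a, e n a ^ 2 ∂μ) atTop (𝓝 0)) :
    Tendsto (fun n => ∫ a, d n a ^ 2 ∂μ) atTop (𝓝 0) := by
  -- |d| is split at the level 2b: the truncation is bounded and tends to 0 by dominated
  -- convergence, while the excess is at most b|e|, which tends to 0 in L². No common majorant of
  -- the e n is needed.
  have hm : ∀ n, AEStronglyMeasurable (fun a => (min |d n a| (2 * b)) ^ 2) μ := fun n =>
    (((hd n).aestronglyMeasurable.norm.aemeasurable.min aemeasurable_const).pow_const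
      2).aestronglyMeasurable
  have hbd : ∀ n, ∀ᵐ a ∂μ, ‖(min |d n a| (2 * b)) ^ 2‖ ≤ (2 * b) ^ 2 := fun n =>
    Eventually.of_forall fun a => by
      rw [Real.norm_eq_abs, abs_of_nonneg (sq_nonneg _)]
      exact pow_le_pow_left₀ (le_min (abs_nonneg _) (by linarith)) (min_le_right _ _) 2
  have h1 : Tendsto (fun n => ∫ a, (min |d n a| (2 * b)) ^ 2 ∂μ) atTop (𝓝 (∫ a, (0 : ℝ) ∂μ)) := by
    refine tendsto_integral_of_dominated_convergence (fun _ => (2 * b) ^ 2) hm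
      (integrable_const _) hbd ?_
    filter_upwards [h0] with a ha
    have := (ha.abs.min (tendsto_const_nhds (x := 2 * b))).pow 2
    simpa [hb] using this
  rw [integral_zero] at h1
  have h2 : Tendsto (fun n => 2 * ∫ a, (min |d n a| (2 * b)) ^ 2 ∂μ +
      2 * b ^ 2 * ∫ a, e n a ^ 2 ∂μ) atTop (𝓝 0) := by
    simpa using (h1.const_mul 2).add (he0.const_mul (2 * b ^ 2))
  refine squeeze_zero (fun n => integral_nonneg fun a => sq_nonneg _) (fun n => ?_) h2
  have i1 : Integrable (fun a => (min |d n a| (2 * b)) ^ 2) μ :=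
    Integrable.mono' (integrable_const _) (hm n) (hbd n)
  rw [← integral_const_mul, ← integral_const_mul, ← integral_add (i1.const_mul _)
    ((he n).integrable_sq.const_mul _)]
  refine integral_mono_ae (hd n).integrable_sq ((i1.const_mul _).add
    ((he n).integrable_sq.const_mul _)) ?_
  filter_upwards [hde n] with a ha
  have h3 : |d n a| ≤ min |d n a| (2 * b) + b * |e n a| := by
    rcases le_total |d n a| (2 * b) with h | h
    · rw [min_eq_left h]; nlinarith [abs_nonneg (e n a)]
    · rw [min_eq_right h]; linarith
  have h4 : d n a ^ 2 ≤ (min |d n a| (2 * b) + b * |e n a|) ^ 2 := by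
    rw [← sq_abs (d n a)]; exact pow_le_pow_left₀ (abs_nonneg _) h3 2
  have h5 : (b * |e n a|) ^ 2 = b ^ 2 * e n a ^ 2 := by rw [mul_pow, sq_abs]
  nlinarith [sq_nonneg (min |d n a| (2 * b) - b * |e n a|)]

/-- The limit of the solutions for averaged nonlinearities. -/
lemma IsNonlinearity.exists_limit_solution (hf : IsNonlinearity f L β)
    (hγ : IsPoincareConstant γ) (hLγ : L < γ) (z : Lp ℝ 2 (volD.prod P)) :
    ∃ u h : Lp ℝ 2 (volD.prod P), u + greenL2 P h = z ∧
      ((∀ᵐ p ∂(volD.prod P), ContinuousAt (f p.1) (u p)) →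
        u + greenL2 P (hf.superpos u) = z) := by
  have hL := hf.L_pos
  have hβ := hf.β_pos
  have hd : 0 < γ - L := sub_pos.2 hLγ
  set ε : ℕ → ℝ := fun n => 1 / ((n : ℝ) + 1) with hε
  have hε0 : ∀ n, 0 < ε n := fun n => by simp only [hε]; positivity
  have hε1 : ∀ n, ε n ≤ 1 := fun n => by
    simp only [hε]
    rw [div_le_one (by positivity)]
    linarith [(Nat.cast_nonneg n : (0 : ℝ) ≤ n)]
  have hεl : Tendsto ε atTop (𝓝 0) := tendsto_one_div_add_atTop_nhds_zero_nat
  have hF : ∀ n, IsNonlinearity (FBmBVP.mollify f (ε n)) L β := fun n =>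
    hf.mollify _ (hε0 n).le (hε1 n)
  have hex : ∀ n, ∃ u : Lp ℝ 2 (volD.prod P), u + greenL2 P ((hF n).superpos u) = z := fun n =>
    (hF n).exists_solution_of_lipschitz hγ hLγ (M := max L (β * (1 + ε n) / ε n))
      (le_max_left _ _) (fun x r s => (hf.mollify_lipschitz x r s (hε0 n)).trans
        (mul_le_mul_of_nonneg_right (le_max_right _ _) (abs_nonneg _))) z
  choose u hu using hex
  set h : ℕ → Lp ℝ 2 (volD.prod P) := fun n => (hF n).superpos (u n) with hh
  -- Two averages satisfy a joint one-sided estimate with defect |ε m - ε n|(2L + 2β)(1 + |u m - u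
  -- n|), by `IsNonlinearity.mollify_mono`; this is what `norm_sq_le_of_superpos` requires.
  have hcauchy : CauchySeq u := by
    have key : ∀ c > 0, c ≤ (γ - L) / 2 → ∃ N, ∀ m ≥ N, ∀ n ≥ N,
        ‖u m - u n‖ ^ 2 ≤ 4 * c / (γ - L) := by
      intro c hc hc'
      obtain ⟨N, hN⟩ := Metric.cauchySeq_iff.1 hεl.cauchySeq (min 1 (c / (2 * L + 2 * β)))
        (lt_min one_pos (by positivity))
      refine ⟨N, fun m hm n hn => ?_⟩
      have hmn := hN m hm n hn
      rw [Real.dist_eq, lt_min_iff, lt_div_iff₀ (by positivity)] at hmn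
      refine norm_sq_le_of_superpos hγ hLγ hc.le hc' (q := h m - h n) ?_ ?_
      · rw [map_sub, ← sub_eq_zero.2 ((hu m).trans (hu n).symm)]
        simp only [hh]; abel
      · filter_upwards [Lp.coeFn_sub (u m) (u n), Lp.coeFn_sub (h m) (h n),
          (hF m).coeFn_superpos (u m), (hF n).coeFn_superpos (u n)] with p h1 h2 h3 h4
        rw [h1, h2, Pi.sub_apply, Pi.sub_apply, h3, h4]
        have := hf.mollify_mono p.1 (u m p) (u n p) hmn.1.le
        have h5 : 0 ≤ 1 + |u m p - u n p| := by positivity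
        nlinarith [mul_le_mul_of_nonneg_right hmn.2.le h5]
    rw [Metric.cauchySeq_iff]
    intro η hη
    have hη2 : 0 < η ^ 2 / 2 := by positivity
    obtain ⟨N, hN⟩ := key (min ((γ - L) / 2) ((γ - L) * (η ^ 2 / 2) / 4))
      (lt_min (by positivity) (by positivity)) (min_le_left _ _)
    refine ⟨N, fun m hm n hn => ?_⟩
    have h1 := hN m hm n hn
    have h2 : 4 * min ((γ - L) / 2) ((γ - L) * (η ^ 2 / 2) / 4) / (γ - L) ≤ η ^ 2 / 2 := by
      rw [div_le_iff₀ hd]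
      have := min_le_right ((γ - L) / 2) ((γ - L) * (η ^ 2 / 2) / 4)
      linarith
    rw [dist_eq_norm]
    exact lt_of_pow_lt_pow_left₀ 2 hη.le (by linarith)
  obtain ⟨u₀, hu₀⟩ := cauchySeq_tendsto_of_complete hcauchy
  have hK : Tendsto (fun n => greenL2 P (h n)) atTop (𝓝 (z - u₀)) := by
    have : (fun n => greenL2 P (h n)) = fun n => z - u n := by
      ext1 n; exact eq_sub_of_add_eq' (hu n)
    rw [this]
    exact hu₀.const_sub z
  have hdiff : ∀ n, ∀ᵐ p ∂(volD.prod P), |h n p - f p.1 (u₀ p)| ≤ β * (2 + |u n p - u₀ p|) := by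
    intro n
    filter_upwards [(hF n).coeFn_superpos (u n)] with p h1
    simp only [hh]
    rw [h1]
    exact hf.abs_mollify_sub_le _ _ _ (hε0 n).le (hε1 n)
  have he0 : Tendsto (fun n => ∫ p, (u n p - u₀ p) ^ 2 ∂(volD.prod P)) atTop (𝓝 0) := by
    have h1 : Tendsto (fun n => ‖u n - u₀‖ ^ 2) atTop (𝓝 0) := by
      simpa using (tendsto_iff_norm_sub_tendsto_zero.1 hu₀).pow 2
    refine h1.congr fun n => ?_
    rw [norm_sq_eq_integral]
    exact integral_congr_ae ((Lp.coeFn_sub (u n) u₀).mono fun p hp => by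
      simp only [hp, Pi.sub_apply])
  -- The superpositions h n need not converge strongly, but they stay within β(2 + |u n - u₀|) of
  -- f(·,u₀) and are therefore bounded in L².
  have hbound : ∃ R, ∀ n, ‖h n‖ ≤ R := by
    obtain ⟨C, hC⟩ := he0.bddAbove_range
    have hC' : ∀ n, ∫ p, (u n p - u₀ p) ^ 2 ∂(volD.prod P) ≤ C := fun n => hC ⟨n, rfl⟩
    refine ⟨‖hf.superpos u₀‖ + Real.sqrt (8 * β ^ 2 + 2 * β ^ 2 * C), fun n => ?_⟩
    have h1 : ‖h n - hf.superpos u₀‖ ≤ Real.sqrt (8 * β ^ 2 + 2 * β ^ 2 * C) := by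
      refine Real.le_sqrt_of_sq_le ?_
      rw [norm_sq_eq_integral]
      have i1 : Integrable (fun p => (u n p - u₀ p) ^ 2) (volD.prod P) :=
        ((Lp.memLp (u n)).sub (Lp.memLp u₀)).integrable_sq
      calc ∫ p, (h n - hf.superpos u₀) p ^ 2 ∂(volD.prod P)
          ≤ ∫ p, (8 * β ^ 2 + 2 * β ^ 2 * (u n p - u₀ p) ^ 2) ∂(volD.prod P) := by
            refine integral_mono_ae (Lp.memLp _).integrable_sq
              ((integrable_const _).add (i1.const_mul _)) ?_
            filter_upwards [hdiff n, Lp.coeFn_sub (h n) (hf.superpos u₀), hf.coeFn_superpos u₀]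
              with p h1 h2 h3
            rw [h2, Pi.sub_apply, h3, ← sq_abs, ← sq_abs (u n p - u₀ p)]
            have := pow_le_pow_left₀ (abs_nonneg _) h1 2
            nlinarith [sq_nonneg (β * (2 - |u n p - u₀ p|))]
        _ = 8 * β ^ 2 + 2 * β ^ 2 * ∫ p, (u n p - u₀ p) ^ 2 ∂(volD.prod P) := by
            rw [integral_add (integrable_const _) (i1.const_mul _), integral_const,
              integral_const_mul]
            simp
        _ ≤ _ := by
            have := mul_le_mul_of_nonneg_left (hC' n) (show 0 ≤ 2 * β ^ 2 by positivity)
            linarith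
    have h2 := norm_add_le (h n - hf.superpos u₀) (hf.superpos u₀)
    rw [sub_add_cancel] at h2
    linarith
  obtain ⟨R, hR⟩ := hbound
  obtain ⟨h₀, hh₀⟩ := exists_apply_eq_of_tendsto (greenL2 P) hR hK
  refine ⟨u₀, h₀, by rw [hh₀]; abel, fun hcont => ?_⟩
  -- At continuity points of f(x,·) the averages converge along an almost everywhere convergent
  -- subsequence of u. The convergence then holds in L² and identifies the limit of K (h n).
  have hmeas := tendstoInMeasure_of_tendsto_Lp hu₀
  obtain ⟨ns, hns, hae⟩ := hmeas.exists_seq_tendsto_ae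
  have hstrong : Tendsto (fun k => ∫ p, (h (ns k) p - f p.1 (u₀ p)) ^ 2 ∂(volD.prod P))
      atTop (𝓝 0) := by
    refine tendsto_integral_sq_of_abs_le (e := fun k p => u (ns k) p - u₀ p) hβ.le
      (fun k => (Lp.memLp _).sub (hf.memLp_field (Lp.memLp u₀)))
      (fun k => (Lp.memLp _).sub (Lp.memLp u₀)) (fun k => hdiff (ns k)) ?_
      (he0.comp hns.tendsto_atTop)
    have hall : ∀ᵐ p ∂(volD.prod P), ∀ k, h (ns k) p =
        FBmBVP.mollify f (ε (ns k)) p.1 (u (ns k) p) :=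
      ae_all_iff.2 fun k => (hF (ns k)).coeFn_superpos (u (ns k))
    filter_upwards [hcont, hae, hall] with p h1 h2 h3
    have := tendsto_mollify (f := f) h1 (fun k => (hε0 (ns k)).le)
      (hεl.comp hns.tendsto_atTop) h2 (fun r ε => hf.intervalIntegrable_comp p.1 r ε)
    simpa [h3] using this.sub_const (f p.1 (u₀ p))
  have hstrong' : Tendsto (fun k => h (ns k)) atTop (𝓝 (hf.superpos u₀)) := by
    rw [tendsto_iff_norm_sub_tendsto_zero]
    have : Tendsto (fun k => ‖h (ns k) - hf.superpos u₀‖ ^ 2) atTop (𝓝 0) := by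
      refine hstrong.congr fun k => ?_
      rw [norm_sq_eq_integral]
      refine integral_congr_ae ?_
      filter_upwards [Lp.coeFn_sub (h (ns k)) (hf.superpos u₀), hf.coeFn_superpos u₀] with p h1 h2
      rw [h1, Pi.sub_apply, h2]
    have := this.sqrt
    simpa [Real.sqrt_sq] using this
  have h1 := ((greenL2 P).continuous.tendsto _).comp hstrong'
  have h2 := hK.comp hns.tendsto_atTop
  rw [tendsto_nhds_unique h1 h2]
  abel

end Existence

/-! ### Mixed second differences of Green potentials -/

/-- The mixed second difference with steps `η` and `δ`. -/
def mixedDiff {E : Type*} [AddCommGroup E] (δ η : ℝ) (v : ℝ → E) (x : ℝ) : E :=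
  v (x + η) - v x - (v (x + δ + η) - v (x + δ))

lemma green_comm (x y : ℝ) : green x y = green y x := by
  rw [green, green, min_comm, mul_comm]

/-- The four evaluation points lie on one affine piece of G(·,y), and mixed second differences
annihilate affine functions. -/
lemma mixedDiff_green_eq_zero {δ η x y : ℝ} (hδ : 0 ≤ δ) (hη : 0 ≤ η)
    (h : y ≤ x ∨ x + δ + η ≤ y) : mixedDiff δ η (fun x => green x y) x = 0 := by
  simp only [mixedDiff]
  rcases h with h | h
  · rw [green_of_le, green_of_le, green_of_le, green_of_le] <;> linarith
  · rw [green_of_ge, green_of_ge, green_of_ge, green_of_ge] <;> linarith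

lemma abs_mixedDiff_green_le {δ η x y : ℝ} (hη : 0 ≤ η) (hy : y ∈ Icc (0 : ℝ) 1) :
    |mixedDiff δ η (fun x => green x y) x| ≤ 2 * η := by
  have h1 : ∀ t, |green (t + η) y - green t y| ≤ η := fun t => by
    have := lipschitz_green y hy (t + η) t
    rwa [green_comm y, green_comm y, add_sub_cancel_left, abs_of_nonneg hη] at this
  unfold mixedDiff
  refine (abs_sub _ _).trans ?_
  linarith [h1 x, h1 (x + δ)]

lemma mixedDiff_greenOp {m : ℝ → ℝ} (hm : Integrable m volD) {δ η x : ℝ} (hδ : 0 ≤ δ)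
    (hη : 0 ≤ η) (hx : 0 ≤ x) (hx1 : x + δ + η ≤ 1) :
    mixedDiff δ η (greenOp m) x = ∫ y, mixedDiff δ η (fun x => green x y) x * m y ∂volD := by
  have i1 := integrable_green_mul hm (x := x) ⟨by linarith, by linarith⟩
  have i2 := integrable_green_mul hm (x := x + η) ⟨by linarith, by linarith⟩
  have i3 := integrable_green_mul hm (x := x + δ) ⟨by linarith, by linarith⟩
  have i4 := integrable_green_mul hm (x := x + δ + η) ⟨by linarith, by linarith⟩
  have i5 : Integrable (fun y => green (x + η) y * m y - green x y * m y) volD := i2.sub i1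
  have i6 : Integrable (fun y => green (x + δ + η) y * m y - green (x + δ) y * m y) volD :=
    i4.sub i3
  unfold mixedDiff greenOp
  rw [← integral_sub i2 i1, ← integral_sub i4 i3, ← integral_sub i5 i6]
  congr 1; ext y; ring

lemma enorm_mixedDiff_greenOp_le {m : ℝ → ℝ} (hm : Integrable m volD) {δ η x : ℝ} (hδ : 0 ≤ δ)
    (hη : 0 ≤ η) (hx : 0 ≤ x) (hx1 : x + δ + η ≤ 1) :
    ‖mixedDiff δ η (greenOp m) x‖ₑ ≤
      ∫⁻ y, (Ioo (y - δ - η) y).indicator (fun _ => ENNReal.ofReal (2 * η)) x * ‖m y‖ₑ ∂volD := by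
  rw [mixedDiff_greenOp hm hδ hη hx hx1]
  refine (enorm_integral_le_lintegral_enorm _).trans (lintegral_mono_ae
    (ae_volD_of_forall fun y hy => ?_))
  rw [enorm_mul]
  refine mul_le_mul_left ?_ _
  by_cases h : x ∈ Ioo (y - δ - η) y
  · rw [indicator_of_mem h, Real.enorm_eq_ofReal_abs]
    exact ENNReal.ofReal_le_ofReal (abs_mixedDiff_green_le hη (Ioo_subset_Icc_self hy))
  · rw [indicator_of_notMem h, mixedDiff_green_eq_zero hδ hη, enorm_zero]
    by_contra! hc
    exact h ⟨by linarith [hc.2], hc.1⟩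

/-- For fixed y the mixed difference of the kernel is at most 2η and lives on an x-interval of
length δ + η; Tonelli does the rest. This quantifies that K m has an integrable second derivative.
-/
lemma lintegral_mixedDiff_greenOp_le {m : ℝ → ℝ} (hm : Integrable m volD) {δ η : ℝ} (hδ : 0 ≤ δ)
    (hη : 0 ≤ η) : ∫⁻ x in Ioo 0 (1 - δ - η), ‖mixedDiff δ η (greenOp m) x‖ₑ ≤
      ENNReal.ofReal (2 * η * (δ + η)) * ∫⁻ y, ‖m y‖ₑ ∂volD := by
  have hmeas : Measurable fun p : ℝ × ℝ =>
      (Ioo (p.2 - δ - η) p.2).indicator (fun _ => ENNReal.ofReal (2 * η)) p.1 := by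
    have : MeasurableSet {p : ℝ × ℝ | p.1 ∈ Ioo (p.2 - δ - η) p.2} := by
      exact (measurableSet_lt (f := fun p : ℝ × ℝ => p.2 - δ - η) (g := Prod.fst) (by fun_prop)
        measurable_fst).inter (measurableSet_lt measurable_fst measurable_snd)
    exact (measurable_const (a := ENNReal.ofReal (2 * η))).indicator this
  calc ∫⁻ x in Ioo 0 (1 - δ - η), ‖mixedDiff δ η (greenOp m) x‖ₑ
      ≤ ∫⁻ x in Ioo 0 (1 - δ - η), ∫⁻ y, (Ioo (y - δ - η) y).indicator
          (fun _ => ENNReal.ofReal (2 * η)) x * ‖m y‖ₑ ∂volD :=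
        setLIntegral_mono' measurableSet_Ioo fun x hx =>
          enorm_mixedDiff_greenOp_le hm hδ hη hx.1.le (by linarith [hx.2])
    _ ≤ ∫⁻ x, ∫⁻ y, (Ioo (y - δ - η) y).indicator
          (fun _ => ENNReal.ofReal (2 * η)) x * ‖m y‖ₑ ∂volD := setLIntegral_le_lintegral _ _
    _ = ∫⁻ y, ∫⁻ x, (Ioo (y - δ - η) y).indicator
          (fun _ => ENNReal.ofReal (2 * η)) x * ‖m y‖ₑ ∂volume ∂volD := by
        refine lintegral_lintegral_swap ?_
        exact hmeas.aemeasurable.mul hm.aestronglyMeasurable.enorm.comp_snd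
    _ = ∫⁻ y, ENNReal.ofReal (2 * η * (δ + η)) * ‖m y‖ₑ ∂volD := by
        refine lintegral_congr fun y => ?_
        rw [lintegral_mul_const _ (measurable_const.indicator measurableSet_Ioo),
          lintegral_indicator_const measurableSet_Ioo, Real.volume_Ioo,
          ← ENNReal.ofReal_mul (by positivity)]
        congr 2; ring
    _ = _ := lintegral_const_mul'' _ hm.aestronglyMeasurable.enorm

/-- Continuity of translations in measure. It is applied to the sections of the coincidence set at
fixed pairs (ω, ω'). -/
lemma tendsto_volume_diff_translate {A : Set ℝ} (hA : MeasurableSet A) (hfin : volume A ≠ ∞)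
    {s : ℕ → ℝ} (hs : Tendsto s atTop (𝓝 0)) :
    Tendsto (fun n => volume (A \ (fun x => x + s n) ⁻¹' A)) atTop (𝓝 0) := by
  let F : ℝ → C(ℝ, ℝ) := ContinuousMap.curry ⟨fun p : ℝ × ℝ => p.2 + p.1, by fun_prop⟩
  have hF : Continuous F := (ContinuousMap.curry _).continuous
  have h1 : Tendsto (fun n => F (s n)) atTop (𝓝 (F 0)) := (hF.tendsto 0).comp hs
  have hmp : ∀ a, MeasurePreserving (F a) volume volume := fun a =>
    measurePreserving_add_right volume a
  have h2 := tendsto_measure_symmDiff_preimage_nhds_zero h1 (Eventually.of_forall fun n => hmp _)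
    (hmp 0) hA.nullMeasurableSet hfin
  refine tendsto_of_tendsto_of_tendsto_of_le_of_le tendsto_const_nhds h2 (fun _ => zero_le)
    fun n => measure_mono fun x hx => Or.inr ⟨?_, hx.2⟩
  simpa [F] using hx.1

/-! ### Absence of atoms -/

section NoAtoms

variable {Ω : Type*} [MeasurableSpace Ω] {P : Measure Ω} [IsProbabilityMeasure P]

/-- Small-ball estimates for the mixed second differences of a random field. -/
def HasSmallBalls (P : Measure Ω) (z : ℝ → Ω → ℝ) : Prop :=
  ∃ δ η ρ : ℕ → ℝ, (∀ n, 0 < η n ∧ η n ≤ δ n) ∧ Tendsto δ atTop (𝓝 0) ∧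
    Tendsto ρ atTop (𝓝 0) ∧ ∀ n, ∀ x ∈ Ioo 0 (1 - δ n - η n), ∀ M > 0, ∀ c : ℝ,
      P {ω | |mixedDiff (δ n) (η n) (fun x => z x ω) x - c| ≤ M * (η n * δ n)} ≤
        ENNReal.ofReal (M * ρ n)

/-- Up to a set whose measure vanishes with the steps, a coincidence point x has x + η, x + δ and x
+ δ + η as coincidence points too. There the mixed difference of z(ω) - z(ω') equals that of K h(ω)
- K h(ω'). The latter is below Mηδ outside a set of measure O(1/M), whereas the former is that small
only on a set of measure at most Mρ n. Letting n and then M tend to infinity leaves measure zero. -/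
lemma coincidence_null {z : ℝ → Ω → ℝ} (hz : Measurable fun p : ℝ × Ω => z p.1 p.2)
    (hsb : HasSmallBalls P z) {h : ℝ × Ω → ℝ} (hm : Measurable h)
    (hh : MemLp h 2 (volD.prod P)) {u : ℝ → Ω → ℝ}
    (hu : ∀ x ω, u x ω = z x ω - greenField h (x, ω)) :
    ((P.prod P).prod volume)
      {p : (Ω × Ω) × ℝ | p.2 ∈ Ioo (0 : ℝ) 1 ∧ u p.2 p.1.1 = u p.2 p.1.2} = 0 := by
  obtain ⟨δ, η, ρ, hpos, hδ, hρ, hsb⟩ := hsb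
  have hη0 : ∀ n, 0 < η n := fun n => (hpos n).1
  have hδ0 : ∀ n, 0 < δ n := fun n => (hpos n).1.trans_le (hpos n).2
  have hη : Tendsto η atTop (𝓝 0) :=
    squeeze_zero (fun n => (hη0 n).le) (fun n => (hpos n).2) hδ
  have hgm : Measurable fun p : ℝ × Ω => greenField h (p.1, p.2) := measurable_greenField hm
  have hum : Measurable fun p : ℝ × Ω => u p.1 p.2 := by
    simp only [hu]; exact hz.sub hgm
  set μ := (P.prod P).prod (volume : Measure ℝ) with hμ
  set T : Set ((Ω × Ω) × ℝ) :=
    {p : (Ω × Ω) × ℝ | p.2 ∈ Ioo (0 : ℝ) 1 ∧ u p.2 p.1.1 = u p.2 p.1.2} with hT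
  have hTm : MeasurableSet T := by
    refine (measurable_snd measurableSet_Ioo).inter (measurableSet_eq_fun ?_ ?_)
    · exact hum.comp (f := fun p : (Ω × Ω) × ℝ => (p.2, p.1.1)) (by fun_prop)
    · exact hum.comp (f := fun p : (Ω × Ω) × ℝ => (p.2, p.1.2)) (by fun_prop)
  -- translations
  have htrans : ∀ s : ℕ → ℝ, Tendsto s atTop (𝓝 0) →
      Tendsto (fun n => μ (T \ (fun p : (Ω × Ω) × ℝ => (p.1, p.2 + s n)) ⁻¹' T))
        atTop (𝓝 0) := by
    intro s hs
    have hms : ∀ n, MeasurableSet (T \ (fun p : (Ω × Ω) × ℝ => (p.1, p.2 + s n)) ⁻¹' T) :=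
      fun n => hTm.diff (hTm.preimage (by fun_prop))
    simp only [hμ, Measure.prod_apply (hms _)]
    have hle : ∀ q : Ω × Ω, volume (Prod.mk q ⁻¹' T) ≤ 1 := fun q => by
      refine (measure_mono (t := Ioo (0 : ℝ) 1) fun x hx => hx.1).trans ?_
      simp
    rw [← lintegral_zero (μ := P.prod P)]
    refine tendsto_lintegral_of_dominated_convergence (fun _ => 1)
      (fun n => measurable_measure_prodMk_left (hms n)) ?_ (by simp) ?_
    · exact fun n => Eventually.of_forall fun q =>
        (measure_mono (preimage_mono sdiff_subset)).trans (hle q)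
    · refine Eventually.of_forall fun q => ?_
      exact tendsto_volume_diff_translate (measurable_prodMk_left hTm)
        ((hle q).trans_lt ENNReal.one_lt_top).ne hs
  -- the mixed differences
  set h1 := ∫⁻ p, ‖h p‖ₑ ∂(volD.prod P) with hh1
  have hh1fin : h1 ≠ ∞ := (hh.integrable (by norm_num)).2.ne
  set k : ℕ → ℝ → Ω → ℝ := fun n x ω => mixedDiff (δ n) (η n) (fun x => greenField h (x, ω)) x
  set w : ℕ → ℝ → Ω → ℝ := fun n x ω => mixedDiff (δ n) (η n) (fun x => z x ω) x
  have hkm : ∀ n, Measurable fun p : ℝ × Ω => k n p.1 p.2 := fun n => by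
    simp only [k, mixedDiff]
    refine ((hgm.comp (f := fun p : ℝ × Ω => (p.1 + η n, p.2)) ?_).sub hgm).sub
      ((hgm.comp (f := fun p : ℝ × Ω => (p.1 + δ n + η n, p.2)) ?_).sub
      (hgm.comp (f := fun p : ℝ × Ω => (p.1 + δ n, p.2)) ?_)) <;> fun_prop
  have hwm : ∀ n, Measurable fun p : ℝ × Ω => w n p.1 p.2 := fun n => by
    simp only [w, mixedDiff]
    refine ((hz.comp (f := fun p : ℝ × Ω => (p.1 + η n, p.2)) ?_).sub hz).sub
      ((hz.comp (f := fun p : ℝ × Ω => (p.1 + δ n + η n, p.2)) ?_).sub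
      (hz.comp (f := fun p : ℝ × Ω => (p.1 + δ n, p.2)) ?_)) <;> fun_prop
  have hkint : ∀ n, ∫⁻ ω, (∫⁻ x in Ioo 0 (1 - δ n - η n), ‖k n x ω‖ₑ) ∂P ≤
      ENNReal.ofReal (4 * (η n * δ n)) * h1 := by
    intro n
    rw [hh1, lintegral_prod_symm _ hm.enorm.aemeasurable, ← lintegral_const_mul _
      (hm.enorm.lintegral_prod_left')]
    refine lintegral_mono_ae ?_
    filter_upwards [ae_memLp_section hh] with ω hω
    refine (lintegral_mixedDiff_greenOp_le (hω.integrable (by norm_num)) (hδ0 n).le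
      (hη0 n).le).trans (mul_le_mul_left (ENNReal.ofReal_le_ofReal ?_) _)
    nlinarith [(hpos n).2, hη0 n]
  -- the part where the smooth component varies a lot
  have hbig : ∀ n, ∀ M > 0, ∀ π : Ω × Ω → Ω, MeasurePreserving π (P.prod P) P →
      μ {p | p.2 ∈ Ioo 0 (1 - δ n - η n) ∧ M * (η n * δ n) ≤ 2 * |k n p.2 (π p.1)|} ≤
        ENNReal.ofReal (8 / M) * h1 := by
    intro n M hM π hπ
    have hnd : 0 < η n * δ n := mul_pos (hη0 n) (hδ0 n)
    have hms : Measurable fun p : (Ω × Ω) × ℝ => k n p.2 (π p.1) :=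
      (hkm n).comp (f := fun p : (Ω × Ω) × ℝ => (p.2, π p.1))
        (measurable_snd.prodMk (hπ.measurable.comp measurable_fst))
    have e1 : {p : (Ω × Ω) × ℝ | p.2 ∈ Ioo 0 (1 - δ n - η n) ∧
        M * (η n * δ n) ≤ 2 * |k n p.2 (π p.1)|} ⊆
        {p | ENNReal.ofReal (M * (η n * δ n) / 2) ≤
          (Ioo 0 (1 - δ n - η n)).indicator (fun x => ‖k n x (π p.1)‖ₑ) p.2} := by
      rintro p ⟨hp1, hp2⟩
      rw [mem_ofPred_eq, indicator_of_mem hp1, Real.enorm_eq_ofReal_abs]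
      exact ENNReal.ofReal_le_ofReal (by linarith)
    have hind : Measurable fun p : (Ω × Ω) × ℝ =>
        (Ioo 0 (1 - δ n - η n)).indicator (fun x => ‖k n x (π p.1)‖ₑ) p.2 :=
      Measurable.indicator (f := fun p : (Ω × Ω) × ℝ => ‖k n p.2 (π p.1)‖ₑ)
        (s := Prod.snd ⁻¹' Ioo 0 (1 - δ n - η n)) hms.enorm (measurable_snd measurableSet_Ioo)
    refine (measure_mono e1).trans ((meas_ge_le_lintegral_div hind.aemeasurable ?_ ?_).trans ?_)
    · simp only [ne_eq, ENNReal.ofReal_eq_zero, not_le]; positivity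
    · exact ENNReal.ofReal_ne_top
    · rw [hμ, lintegral_prod _ hind.aemeasurable]
      simp only [lintegral_indicator measurableSet_Ioo]
      have e2 : ∫⁻ q, (∫⁻ x in Ioo 0 (1 - δ n - η n), ‖k n x (π q)‖ₑ) ∂(P.prod P) =
          ∫⁻ ω, (∫⁻ x in Ioo 0 (1 - δ n - η n), ‖k n x ω‖ₑ) ∂P :=
        hπ.lintegral_comp (f := fun ω => ∫⁻ x in Ioo 0 (1 - δ n - η n), ‖k n x ω‖ₑ)
          ((hkm n).enorm.lintegral_prod_left')
      rw [e2]
      refine (ENNReal.div_le_div_right (hkint n) _).trans (le_of_eq ?_)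
      rw [ENNReal.mul_div_right_comm, ← ENNReal.ofReal_div_of_pos (by positivity)]
      congr 2
      have := (hη0 n).ne'
      have := (hδ0 n).ne'
      field_simp
      norm_num
  have hsmall : ∀ n, ∀ M > 0, μ {p | p.2 ∈ Ioo 0 (1 - δ n - η n) ∧
      |w n p.2 p.1.1 - w n p.2 p.1.2| ≤ M * (η n * δ n)} ≤ ENNReal.ofReal (M * ρ n) := by
    intro n M hM
    have hms : MeasurableSet {p : (Ω × Ω) × ℝ | p.2 ∈ Ioo 0 (1 - δ n - η n) ∧
      |w n p.2 p.1.1 - w n p.2 p.1.2| ≤ M * (η n * δ n)} := by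
      refine MeasurableSet.inter (s₁ := {p : (Ω × Ω) × ℝ | p.2 ∈ Ioo 0 (1 - δ n - η n)})
        (s₂ := {p | |w n p.2 p.1.1 - w n p.2 p.1.2| ≤ M * (η n * δ n)})
        (measurable_snd measurableSet_Ioo) (measurableSet_le ?_ measurable_const)
      exact (((hwm n).comp (f := fun p : (Ω × Ω) × ℝ => (p.2, p.1.1)) (by fun_prop)).sub
        ((hwm n).comp (f := fun p : (Ω × Ω) × ℝ => (p.2, p.1.2)) (by fun_prop))).abs
    rw [hμ, Measure.prod_apply_symm hms]
    have hx : ∀ x : ℝ, (P.prod P) ((fun q => (q, x)) ⁻¹' {p : (Ω × Ω) × ℝ |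
        p.2 ∈ Ioo 0 (1 - δ n - η n) ∧ |w n p.2 p.1.1 - w n p.2 p.1.2| ≤ M * (η n * δ n)}) ≤
        (Ioo 0 (1 - δ n - η n)).indicator (fun _ => ENNReal.ofReal (M * ρ n)) x := by
      intro x
      by_cases hx : x ∈ Ioo 0 (1 - δ n - η n)
      · rw [indicator_of_mem hx, Measure.prod_apply_symm (measurable_prodMk_right hms)]
        calc ∫⁻ ω', P ((fun ω => (ω, ω')) ⁻¹' ((fun q => (q, x)) ⁻¹' {p : (Ω × Ω) × ℝ |
              p.2 ∈ Ioo 0 (1 - δ n - η n) ∧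
                |w n p.2 p.1.1 - w n p.2 p.1.2| ≤ M * (η n * δ n)})) ∂P
            ≤ ∫⁻ ω', ENNReal.ofReal (M * ρ n) ∂P := by
              refine lintegral_mono fun ω' => ?_
              -- With ω' frozen, its mixed difference is merely the centre of the ball; hence the
              -- small-ball bound has to be uniform in the centre.
              refine (measure_mono ?_).trans (hsb n x hx M hM (w n x ω'))
              intro ω hω
              exact hω.2
          _ = _ := by simp
      · rw [indicator_of_notMem hx]
        refine le_of_eq ?_
        convert measure_empty (μ := P.prod P)
        ext q
        simp only [mem_preimage, mem_ofPred_eq, mem_empty_iff_false, iff_false]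
        exact fun hq => hx hq.1
    refine (lintegral_mono hx).trans ?_
    rw [lintegral_indicator_const measurableSet_Ioo, Real.volume_Ioo]
    refine mul_le_of_le_one_right zero_le ?_
    rw [ENNReal.ofReal_le_one]
    linarith [hδ0 n, hη0 n]
  -- conclusion
  have hmain : ∀ n, ∀ M > 0, μ T ≤
      (μ (T \ (fun p : (Ω × Ω) × ℝ => (p.1, p.2 + η n)) ⁻¹' T) +
        μ (T \ (fun p : (Ω × Ω) × ℝ => (p.1, p.2 + δ n)) ⁻¹' T) +
        μ (T \ (fun p : (Ω × Ω) × ℝ => (p.1, p.2 + (δ n + η n))) ⁻¹' T) +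
        ENNReal.ofReal (M * ρ n)) + (ENNReal.ofReal (8 / M) * h1 + ENNReal.ofReal (8 / M) * h1) := by
    intro n M hM
    refine le_trans ?_ (add_le_add (add_le_add le_rfl (hsmall n M hM)) (add_le_add
      (hbig n M hM Prod.fst measurePreserving_fst) (hbig n M hM Prod.snd measurePreserving_snd)))
    refine le_trans (measure_mono ?_) ((measure_union_le _ _).trans (add_le_add
      ((measure_union_le _ _).trans (add_le_add ((measure_union_le _ _).trans
        (add_le_add (measure_union_le _ _) le_rfl)) le_rfl)) (measure_union_le _ _)))
    intro p hp
    by_cases a1 : (p.1, p.2 + η n) ∈ T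
    swap
    · exact Or.inl (Or.inl (Or.inl (Or.inl ⟨hp, a1⟩)))
    by_cases a2 : (p.1, p.2 + δ n) ∈ T
    swap
    · exact Or.inl (Or.inl (Or.inl (Or.inr ⟨hp, a2⟩)))
    by_cases a3 : (p.1, p.2 + (δ n + η n)) ∈ T
    swap
    · exact Or.inl (Or.inl (Or.inr ⟨hp, a3⟩))
    have hgood : p.2 ∈ Ioo 0 (1 - δ n - η n) := by
      have b1 := hp.1
      have b2 := a3.1
      simp only [mem_Ioo] at b1 b2 ⊢
      exact ⟨b1.1, by linarith [b2.2]⟩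
    have heq : w n p.2 p.1.1 - w n p.2 p.1.2 = k n p.2 p.1.1 - k n p.2 p.1.2 := by
      have b0 := hp.2
      have b1 := a1.2
      have b2 := a2.2
      have b3 := a3.2
      simp only [← add_assoc] at b3
      simp only [hu] at b0 b1 b2 b3
      simp only [w, k, mixedDiff]
      linarith
    by_cases c1 : M * (η n * δ n) ≤ 2 * |k n p.2 p.1.1|
    · exact Or.inr (Or.inl ⟨hgood, c1⟩)
    by_cases c2 : M * (η n * δ n) ≤ 2 * |k n p.2 p.1.2|
    · exact Or.inr (Or.inr ⟨hgood, c2⟩)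
    refine Or.inl (Or.inr ⟨hgood, ?_⟩)
    rw [heq]
    refine (abs_sub _ _).trans ?_
    linarith
  have hlim : ∀ M > 0, μ T ≤ ENNReal.ofReal (8 / M) * h1 + ENNReal.ofReal (8 / M) * h1 := by
    intro M hM
    have hδη : Tendsto (fun n => δ n + η n) atTop (𝓝 0) := by simpa using hδ.add hη
    have hρM : Tendsto (fun n => ENNReal.ofReal (M * ρ n)) atTop (𝓝 0) := by
      simpa using ENNReal.tendsto_ofReal (hρ.const_mul M)
    have := (((htrans η hη).add (htrans δ hδ)).add (htrans _ hδη)).add hρM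
    have := this.add_const (ENNReal.ofReal (8 / M) * h1 + ENNReal.ofReal (8 / M) * h1)
    simp only [add_zero, zero_add] at this
    exact ge_of_tendsto this (Eventually.of_forall fun n => hmain n M hM)
  have hlim2 : Tendsto (fun N : ℕ => ENNReal.ofReal (8 / ((N : ℝ) + 1)) * h1 +
      ENNReal.ofReal (8 / ((N : ℝ) + 1)) * h1) atTop (𝓝 0) := by
    have h0 : Tendsto (fun N : ℕ => (8 : ℝ) / ((N : ℝ) + 1)) atTop (𝓝 0) := by
      have := tendsto_one_div_add_atTop_nhds_zero_nat (𝕜 := ℝ) |>.const_mul 8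
      simpa [div_eq_mul_inv] using this
    have h2 := ENNReal.Tendsto.mul_const (ENNReal.tendsto_ofReal h0) (Or.inr hh1fin)
    simpa using h2.add h2
  exact le_antisymm (ge_of_tendsto hlim2 (Eventually.of_forall fun N => hlim _ (by positivity)))
    zero_le

/-- For almost every `x`, the law of `u(x)` has no atoms. -/
lemma ae_no_atoms {z : ℝ → Ω → ℝ} (hz : Measurable fun p : ℝ × Ω => z p.1 p.2)
    (hsb : HasSmallBalls P z) {h : ℝ × Ω → ℝ} (hm : Measurable h)
    (hh : MemLp h 2 (volD.prod P)) {u : ℝ → Ω → ℝ}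
    (hu : ∀ x ω, u x ω = z x ω - greenField h (x, ω)) :
    ∀ᵐ x ∂volD, ∀ r, P {ω | u x ω = r} = 0 := by
  have h0 := coincidence_null hz hsb hm hh hu
  have h1 : ∀ᵐ p ∂((P.prod P).prod volume),
      ¬ (p.2 ∈ Ioo (0 : ℝ) 1 ∧ u p.2 p.1.1 = u p.2 p.1.2) := by
    rw [ae_iff]; simpa only [not_not] using h0
  have h2 : ∀ᵐ p ∂((volume : Measure ℝ).prod (P.prod P)),
      ¬ (p.1 ∈ Ioo (0 : ℝ) 1 ∧ u p.1 p.2.1 = u p.1 p.2.2) :=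
    Measure.measurePreserving_swap.quasiMeasurePreserving.ae h1
  have h3 := Measure.ae_ae_of_ae_prod h2
  filter_upwards [ae_restrict_of_ae h3, ae_mem_volD] with x hx hxD r
  have h4 : ∀ᵐ q ∂(P.prod P), ¬ (u x q.1 = u x q.2) := hx.mono fun q hq hc => hq ⟨hxD, hc⟩
  -- An atom at r would put the square of the event {u(x) = r} into the null coincidence set.
  have h5 : (P.prod P) ({ω | u x ω = r} ×ˢ {ω | u x ω = r}) = 0 := by
    refine measure_mono_null (fun q hq => ?_) (ae_iff.1 h4)
    simp only [mem_ofPred_eq, not_not]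
    exact hq.1.trans hq.2.symm
  rw [Measure.prod_prod, mul_self_eq_zero] at h5
  exact h5

end NoAtoms

/-! ### Continuity points of the nonlinearity and existence of solutions -/

section Solution

variable {f : ℝ → ℝ → ℝ} {L β γ : ℝ}

lemma IsNonlinearity.monotone_add (hf : IsNonlinearity f L β) (x : ℝ) :
    Monotone fun r => f x r + L * r := by
  intro r s hrs
  rcases hrs.eq_or_lt with rfl | h
  · exact le_rfl
  · have h1 := hf.mono x s r
    have h2 : 0 < s - r := sub_pos.2 h
    have h3 : -L * (s - r) ≤ f x s - f x r := by
      by_contra! hc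
      nlinarith
    simp only
    linarith

/-- A discontinuity of f(x,·) is one of the monotone function f(x,r) + L r. -/
lemma IsNonlinearity.countable_not_continuousAt (hf : IsNonlinearity f L β) (x : ℝ) :
    {r | ¬ ContinuousAt (f x) r}.Countable := by
  refine (hf.monotone_add x).countable_not_continuousAt.mono ?_
  simp only [ofPred_subset_ofPred]
  intro r hr hc
  refine hr ?_
  have : f x = fun r => (f x r + L * r) - L * r := by ext r; ring
  rw [this]
  exact hc.sub (by fun_prop)

/-- A monotone function oscillates over an interval by the gap between its end values. The countable
criterion makes the set of continuity points jointly measurable in (x, r). -/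
lemma monotone_continuousAt_iff {F : ℝ → ℝ} (hF : Monotone F) (r : ℝ) :
    ContinuousAt F r ↔
      ∀ k : ℕ, ∃ n : ℕ, F (r + 1 / ((n : ℝ) + 1)) - F (r - 1 / ((n : ℝ) + 1)) < 1 / ((k : ℝ) + 1) := by
  have hn : Tendsto (fun n : ℕ => 1 / ((n : ℝ) + 1)) atTop (𝓝 0) :=
    tendsto_one_div_add_atTop_nhds_zero_nat
  constructor
  · intro hc k
    have h1 : Tendsto (fun n : ℕ => F (r + 1 / ((n : ℝ) + 1))) atTop (𝓝 (F r)) :=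
      hc.tendsto.comp (by simpa using hn.const_add r)
    have h2 : Tendsto (fun n : ℕ => F (r - 1 / ((n : ℝ) + 1))) atTop (𝓝 (F r)) :=
      hc.tendsto.comp (by simpa using hn.const_sub r)
    have h3 := h1.sub h2
    rw [sub_self] at h3
    exact (h3.eventually_lt_const (show 0 < 1 / ((k : ℝ) + 1) by positivity)).exists
  · intro h
    rw [Metric.continuousAt_iff]
    intro ε hε
    obtain ⟨k, hk⟩ := exists_nat_one_div_lt hε
    obtain ⟨n, hn⟩ := h k
    refine ⟨1 / ((n : ℝ) + 1), by positivity, fun s hs => ?_⟩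
    rw [Real.dist_eq, abs_lt] at hs
    have h0 : (0 : ℝ) < 1 / ((n : ℝ) + 1) := by positivity
    have a1 := hF (show s ≤ r + 1 / ((n : ℝ) + 1) by linarith)
    have a2 := hF (show r - 1 / ((n : ℝ) + 1) ≤ s by linarith)
    have a3 := hF (show r ≤ r + 1 / ((n : ℝ) + 1) by linarith)
    have a4 := hF (show r - 1 / ((n : ℝ) + 1) ≤ r by linarith)
    rw [Real.dist_eq, abs_lt]
    constructor <;> linarith

lemma IsNonlinearity.measurableSet_continuousAt (hf : IsNonlinearity f L β) :
    MeasurableSet {p : ℝ × ℝ | ContinuousAt (f p.1) p.2} := by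
  have e : {p : ℝ × ℝ | ContinuousAt (f p.1) p.2} = ⋂ k : ℕ, ⋃ n : ℕ,
      {p : ℝ × ℝ | (f p.1 (p.2 + 1 / ((n : ℝ) + 1)) + L * (p.2 + 1 / ((n : ℝ) + 1))) -
        (f p.1 (p.2 - 1 / ((n : ℝ) + 1)) + L * (p.2 - 1 / ((n : ℝ) + 1))) <
          1 / ((k : ℝ) + 1)} := by
    ext ⟨x, r⟩
    simp only [mem_ofPred_eq, mem_iInter, mem_iUnion]
    rw [← monotone_continuousAt_iff (hf.monotone_add x) r]
    constructor
    · intro h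
      exact h.add (by fun_prop)
    · intro h
      have : f x = fun r => (f x r + L * r) - L * r := by ext r; ring
      rw [this]
      exact h.sub (by fun_prop)
  rw [e]
  refine MeasurableSet.iInter fun k => MeasurableSet.iUnion fun n =>
    measurableSet_lt ?_ measurable_const
  refine Measurable.sub (Measurable.add ?_ (by fun_prop)) (Measurable.add ?_ (by fun_prop))
  · exact hf.measurable.comp (f := fun p : ℝ × ℝ => (p.1, p.2 + 1 / ((n : ℝ) + 1)))
      (by fun_prop)
  · exact hf.measurable.comp (f := fun p : ℝ × ℝ => (p.1, p.2 - 1 / ((n : ℝ) + 1)))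
      (by fun_prop)

variable {Ω : Type*} [MeasurableSpace Ω] {P : Measure Ω} [IsProbabilityMeasure P]

/-- Existence of a measurable solution of `u + greenOp (f(·,u)) = z`: either `f` is continuous in
its second variable, or the laws of `z` are so spread out that the discontinuities of `f` are
not seen. -/
lemma IsNonlinearity.exists_solution (hf : IsNonlinearity f L β)
    (hγ : IsPoincareConstant γ) (hLγ : L < γ) {z : ℝ → Ω → ℝ}
    (hz : Measurable fun p : ℝ × Ω => z p.1 p.2)
    (hz2 : MemLp (fun p : ℝ × Ω => z p.1 p.2) 2 (volD.prod P))
    (h : HasSmallBalls P z ∨ ∀ x, Continuous (f x)) :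
    ∃ u : ℝ → Ω → ℝ, (Measurable fun p : ℝ × Ω => u p.1 p.2) ∧
      MemLp (fun p : ℝ × Ω => u p.1 p.2) 2 (volD.prod P) ∧
      ∀ᵐ ω ∂P, ∀ x, u x ω + greenOp (fun y => f y (u y ω)) x = z x ω := by
  obtain ⟨u₀, h₀, huh, hsol⟩ := hf.exists_limit_solution hγ hLγ (P := P) (hz2.toLp _)
  have hae : ∀ q : Lp ℝ 2 (volD.prod P), u₀ + greenL2 P q = hz2.toLp _ →
      ∀ᵐ p ∂(volD.prod P), u₀ p = z p.1 p.2 - greenField q p := by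
    intro q hq
    filter_upwards [Lp.coeFn_add u₀ (greenL2 P q), coeFn_greenL2 q, hz2.coeFn_toLp] with p h1 h2 h3
    rw [hq, h3, Pi.add_apply, h2] at h1
    linarith
  have hcont : ∀ᵐ p ∂(volD.prod P), ContinuousAt (f p.1) (u₀ p) := by
    rcases h with hsb | hc
    · have hh₀m := (Lp.stronglyMeasurable h₀).measurable
      -- This version of u₀ is defined everywhere, so that its law at each x makes sense. Having no
      -- atoms, it misses the countably many discontinuities of f(x,·).
      set u₁ : ℝ → Ω → ℝ := fun x ω => z x ω - greenField h₀ (x, ω) with hu₁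
      have hu₁m : Measurable fun p : ℝ × Ω => u₁ p.1 p.2 :=
        hz.sub (measurable_greenField hh₀m)
      have hna := ae_no_atoms hz hsb hh₀m (Lp.memLp h₀) (u := u₁) fun _ _ => rfl
      have h1 : ∀ᵐ p ∂(volD.prod P), ContinuousAt (f p.1) (u₁ p.1 p.2) := by
        have hms : MeasurableSet {p : ℝ × Ω | ContinuousAt (f p.1) (u₁ p.1 p.2)} :=
          hf.measurableSet_continuousAt.preimage (f := fun p : ℝ × Ω => (p.1, u₁ p.1 p.2))
            (measurable_fst.prodMk hu₁m)
        rw [Measure.ae_prod_iff_ae_ae hms]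
        filter_upwards [hna] with x hx
        have h2 : P (⋃ r ∈ {r | ¬ ContinuousAt (f x) r}, {ω | u₁ x ω = r}) = 0 :=
          (measure_biUnion_null_iff (hf.countable_not_continuousAt x)).2 fun r _ => hx r
        rw [ae_iff]
        refine measure_mono_null (fun ω hω => ?_) h2
        simp only [mem_iUnion]
        exact ⟨u₁ x ω, hω, rfl⟩
      filter_upwards [h1, hae h₀ huh] with p h1 h2
      rw [h2]
      exact h1
    · exact Eventually.of_forall fun p => (hc p.1).continuousAt
  have hsol := hsol hcont
  have hfm : Measurable fun p : ℝ × Ω => f p.1 (u₀ p) :=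
    hf.measurable.comp (measurable_fst.prodMk (Lp.stronglyMeasurable u₀).measurable)
  -- Defining u by its own equation makes the identity hold at every x for almost every ω, since K
  -- does not see null sets.
  set u : ℝ → Ω → ℝ := fun x ω => z x ω - greenField (fun p => f p.1 (u₀ p)) (x, ω) with hu
  have huu : ∀ᵐ p ∂(volD.prod P), u₀ p = u p.1 p.2 := by
    filter_upwards [hae _ hsol, ae_greenField_congr' (hf.coeFn_superpos u₀)] with p h1 h2
    rw [h1, h2]
  refine ⟨u, hz.sub (measurable_greenField hfm), (Lp.memLp u₀).ae_eq huu, ?_⟩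
  have h3 : (fun p : ℝ × Ω => f p.1 (u₀ p)) =ᵐ[volD.prod P] fun p => f p.1 (u p.1 p.2) :=
    huu.mono fun p hp => by simp only [hp]
  filter_upwards [ae_greenField_congr h3] with ω hω x
  have := hω x
  simp only [hu, this]
  simp only [greenField]
  ring

end Solution

/-! ### Green convolution of the derivative of a Hölder curve -/

/-- Integration by parts leaves only the primitive of m. With W in the place of that primitive, the
right-hand side gives meaning to the convolution of G with the derivative of W. -/
lemma greenOp_eq_primitive {m : ℝ → ℝ} (hm : Integrable m volD) {x : ℝ}
    (hx : x ∈ Icc (0 : ℝ) 1) : greenOp m x =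
      x * (∫ t in (0 : ℝ)..1, ∫ y in (0 : ℝ)..t, m y) - ∫ t in (0 : ℝ)..x, ∫ y in (0 : ℝ)..t, m y := by
  have hM := absolutelyContinuous_primitive hm
  have hi := (integrable_volD_iff _).1 hm
  have key : ∀ x ∈ Icc (0 : ℝ) 1, ∫ y in (0 : ℝ)..x, y * m y =
      x * (∫ y in (0 : ℝ)..x, m y) - ∫ t in (0 : ℝ)..x, ∫ y in (0 : ℝ)..t, m y := by
    intro x hx
    have h0x : uIcc 0 x ⊆ uIcc (0 : ℝ) 1 := by
      rw [uIcc_of_le hx.1, uIcc_of_le zero_le_one]; exact Icc_subset_Icc_right hx.2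
    have h1 := (absolutelyContinuous_id.mono h0x).integral_mul_deriv_eq_deriv_mul (hM.mono h0x)
    simp only [deriv_id'', one_mul, intervalIntegral.integral_same, mul_zero, sub_zero] at h1
    rw [← h1]
    refine intervalIntegral.integral_congr_ae ?_
    filter_upwards [hi.ae_hasDerivAt_integral] with y hy hy'
    rw [(hy (h0x (uIoc_subset_uIcc hy')) 0 (by simp)).deriv]
  have e : ∫ y in (0 : ℝ)..1, (1 - y) * m y = ∫ t in (0 : ℝ)..1, ∫ y in (0 : ℝ)..t, m y := by
    have h1 := key 1 (by simp)
    have h2 : ∫ y in (0 : ℝ)..1, (1 - y) * m y =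
        (∫ y in (0 : ℝ)..1, m y) - ∫ y in (0 : ℝ)..1, y * m y := by
      rw [← intervalIntegral.integral_sub hi
        ((integrable_volD_iff _).1 (integrable_id_mul hm))]
      congr 1; ext y; ring
    rw [h2, h1]; ring
  rw [greenOp_eq hm hx, key x hx, e]
  ring

/-- The normalized indicator function of the `i`-th cell of the grid. -/
def cellFun (n i : ℕ) : ℝ → ℝ :=
  (Ioc ((i : ℝ) / n) (((i + 1 : ℕ) : ℝ) / n)).indicator fun _ => (n : ℝ)

lemma integrable_cellFun (n i : ℕ) : Integrable (cellFun n i) volD :=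
  (integrable_const _).indicator measurableSet_Ioc

lemma integral_indicator_Ioc {a b t c : ℝ} (ha : 0 ≤ a) (hab : a ≤ b) (ht : 0 ≤ t) :
    ∫ y in (0 : ℝ)..t, (Ioc a b).indicator (fun _ => c) y = (min t b - min t a) * c := by
  rw [intervalIntegral.integral_of_le ht, setIntegral_indicator measurableSet_Ioc,
    Ioc_inter_Ioc, setIntegral_const, smul_eq_mul, max_eq_right ha, measureReal_def,
    Real.volume_Ioc]
  congr 1
  rcases le_total a t with h | h
  · rw [min_eq_right h, ENNReal.toReal_ofReal (sub_nonneg.2 (le_min h hab))]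
  · rw [min_eq_left h, min_eq_left (h.trans hab), ENNReal.ofReal_of_nonpos (sub_nonpos.2 h)]
    simp

section Curve

variable {X : Type*} [NormedAddCommGroup X] [NormedSpace ℝ X]

/-- The Green convolution of the piecewise linear interpolation of a curve. -/
def curveApprox (w : ℝ → X) (n : ℕ) (x : ℝ) : X :=
  ∑ i ∈ Finset.range n, greenOp (cellFun n i) x • (w (((i + 1 : ℕ) : ℝ) / n) - w ((i : ℝ) / n))

/-- The Green convolution of the derivative of a curve. -/
def curveLim (w : ℝ → X) (x : ℝ) : X :=
  x • (∫ t in (0 : ℝ)..1, w t) - ∫ t in (0 : ℝ)..x, w t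

variable {w : ℝ → X} {H : ℝ}

/-- The sum is the piecewise linear interpolant of w, minus w 0: cells to the left of t contribute
whole increments, the cell containing t a fraction, the others nothing. Two Hölder increments over
at most one mesh width remain. The condition t < 1 keeps the cell index ⌊nt⌋ below n. -/
lemma norm_sum_cell_sub_le
    (hw : ∀ s ∈ Icc (0 : ℝ) 1, ∀ t ∈ Icc (0 : ℝ) 1, ‖w s - w t‖ ≤ |s - t| ^ H) (hH : 0 < H)
    {n : ℕ} (hn : 0 < n) {t : ℝ} (ht : t ∈ Ico (0 : ℝ) 1) :
    ‖(∑ i ∈ Finset.range n, (∫ y in (0 : ℝ)..t, cellFun n i y) •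
      (w (((i + 1 : ℕ) : ℝ) / n) - w ((i : ℝ) / n))) - (w t - w 0)‖ ≤ 2 * (1 / (n : ℝ)) ^ H := by
  have hn0 : (0 : ℝ) < n := Nat.cast_pos.2 hn
  set j := ⌊(n : ℝ) * t⌋₊ with hj
  have hnt : 0 ≤ (n : ℝ) * t := mul_nonneg hn0.le ht.1
  have hj1 : (j : ℝ) ≤ n * t := Nat.floor_le hnt
  have hj2 : (n : ℝ) * t < j + 1 := Nat.lt_floor_add_one _
  have hjn : j < n := by
    have : (j : ℝ) < n := hj1.trans_lt (by nlinarith [ht.2])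
    exact_mod_cast this
  have hjn' : ((j + 1 : ℕ) : ℝ) ≤ n := by exact_mod_cast hjn
  have hprim : ∀ i : ℕ, ∫ y in (0 : ℝ)..t, cellFun n i y =
      (min t (((i + 1 : ℕ) : ℝ) / n) - min t ((i : ℝ) / n)) * n := fun i =>
    integral_indicator_Ioc (by positivity)
      (div_le_div_of_nonneg_right (by push_cast; linarith) hn0.le) ht.1
  have hlt : ∀ i < j, ∫ y in (0 : ℝ)..t, cellFun n i y = 1 := by
    intro i hi
    have h1 : ((i + 1 : ℕ) : ℝ) ≤ j := by exact_mod_cast hi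
    rw [hprim, min_eq_right, min_eq_right]
    · push_cast; field_simp; ring
    · rw [div_le_iff₀ hn0]; push_cast at h1; linarith
    · rw [div_le_iff₀ hn0]; linarith
  have hgt : ∀ i, j < i → ∫ y in (0 : ℝ)..t, cellFun n i y = 0 := by
    intro i hi
    have h1 : ((j + 1 : ℕ) : ℝ) ≤ i := by exact_mod_cast hi
    push_cast at h1
    rw [hprim, min_eq_left, min_eq_left]
    · simp
    · rw [le_div_iff₀ hn0]; linarith
    · rw [le_div_iff₀ hn0]; push_cast; linarith
  have hjj : |∫ y in (0 : ℝ)..t, cellFun n j y| ≤ 1 := by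
    rw [hprim, min_eq_left, min_eq_right]
    · rw [abs_le]
      have : (t - (j : ℝ) / n) * n = n * t - j := by field_simp
      rw [this]; constructor <;> linarith
    · rw [div_le_iff₀ hn0]; linarith
    · rw [le_div_iff₀ hn0]; push_cast; linarith
  have hsplit : ∑ i ∈ Finset.range n, (∫ y in (0 : ℝ)..t, cellFun n i y) •
      (w (((i + 1 : ℕ) : ℝ) / n) - w ((i : ℝ) / n)) = (w ((j : ℝ) / n) - w 0) +
      (∫ y in (0 : ℝ)..t, cellFun n j y) • (w (((j + 1 : ℕ) : ℝ) / n) - w ((j : ℝ) / n)) := by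
    rw [← Finset.sum_range_add_sum_Ico _ (Nat.succ_le_of_lt hjn), Finset.sum_range_succ,
      Finset.sum_eq_zero (s := Finset.Ico (j + 1) n), add_zero]
    · congr 1
      rw [Finset.sum_congr rfl (g := fun i => w (((i + 1 : ℕ) : ℝ) / n) - w ((i : ℝ) / n)),
        Finset.sum_range_sub fun i : ℕ => w ((i : ℝ) / n)]
      · simp
      · intro i hi
        rw [hlt i (Finset.mem_range.1 hi), one_smul]
    · intro i hi
      rw [hgt i (Finset.mem_Ico.1 hi).1, zero_smul]
  have hm1 : (j : ℝ) / n ∈ Icc (0 : ℝ) 1 :=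
    ⟨by positivity, by rw [div_le_one hn0]; push_cast at hjn'; linarith⟩
  have hm2 : ((j + 1 : ℕ) : ℝ) / n ∈ Icc (0 : ℝ) 1 :=
    ⟨by positivity, by rw [div_le_one hn0]; exact hjn'⟩
  have b1 : ‖w ((j : ℝ) / n) - w t‖ ≤ (1 / (n : ℝ)) ^ H := by
    refine (hw _ hm1 t ⟨ht.1, ht.2.le⟩).trans (Real.rpow_le_rpow (abs_nonneg _) ?_ hH.le)
    rw [abs_le]
    constructor
    · rw [neg_le_sub_iff_le_add, ← add_div, le_div_iff₀ hn0]; linarith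
    · have : (j : ℝ) / n ≤ t := by rw [div_le_iff₀ hn0]; linarith
      have : (0 : ℝ) < 1 / n := by positivity
      linarith
  have b2 : ‖w (((j + 1 : ℕ) : ℝ) / n) - w ((j : ℝ) / n)‖ ≤ (1 / (n : ℝ)) ^ H := by
    refine (hw _ hm2 _ hm1).trans (le_of_eq ?_)
    congr 1
    rw [← sub_div]; push_cast; rw [add_sub_cancel_left, abs_of_pos (by positivity)]
  rw [hsplit]
  have e : (w ((j : ℝ) / n) - w 0) + (∫ y in (0 : ℝ)..t, cellFun n j y) •
      (w (((j + 1 : ℕ) : ℝ) / n) - w ((j : ℝ) / n)) - (w t - w 0) =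
      (w ((j : ℝ) / n) - w t) + (∫ y in (0 : ℝ)..t, cellFun n j y) •
      (w (((j + 1 : ℕ) : ℝ) / n) - w ((j : ℝ) / n)) := by abel
  rw [e]
  refine (norm_add_le _ _).trans ?_
  rw [norm_smul, Real.norm_eq_abs, two_mul]
  refine add_le_add b1 (le_trans (mul_le_of_le_one_left (norm_nonneg _) hjj) b2)

variable [CompleteSpace X]

/-- Both sides come from one functional, v ↦ x ∫₀¹ v - ∫₀ˣ v, applied to the interpolant and to w;
it annihilates the constant w 0. Its two terms double the interpolation error. -/
lemma norm_curveApprox_sub_le (hwc : Continuous w)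
    (hw : ∀ s ∈ Icc (0 : ℝ) 1, ∀ t ∈ Icc (0 : ℝ) 1, ‖w s - w t‖ ≤ |s - t| ^ H) (hH : 0 < H)
    {n : ℕ} (hn : 0 < n) {x : ℝ} (hx : x ∈ Icc (0 : ℝ) 1) :
    ‖curveApprox w n x - curveLim w x‖ ≤ 4 * (1 / (n : ℝ)) ^ H := by
  set V : ℝ → X := fun t => ∑ i ∈ Finset.range n, (∫ y in (0 : ℝ)..t, cellFun n i y) •
      (w (((i + 1 : ℕ) : ℝ) / n) - w ((i : ℝ) / n)) with hV
  set C := 2 * (1 / (n : ℝ)) ^ H with hC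
  have hC0 : 0 ≤ C := by positivity
  have hprimc : ∀ i, Continuous fun t => ∫ y in (0 : ℝ)..t, cellFun n i y := fun i =>
    intervalIntegral.continuous_primitive (fun a b => by
      rw [intervalIntegrable_iff]
      exact (integrableOn_const (by simp)).indicator measurableSet_Ioc) 0
  have hVc : Continuous V := by
    refine continuous_finsetSum _ fun i _ => (hprimc i).smul continuous_const
  have hVi : ∀ x, ∫ t in (0 : ℝ)..x, V t = ∑ i ∈ Finset.range n,
      (∫ t in (0 : ℝ)..x, ∫ y in (0 : ℝ)..t, cellFun n i y) •
      (w (((i + 1 : ℕ) : ℝ) / n) - w ((i : ℝ) / n)) := by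
    intro x
    simp only [hV]
    rw [intervalIntegral.integral_finsetSum]
    · exact Finset.sum_congr rfl fun i _ => intervalIntegral.integral_smul_const _ _
    · exact fun i _ => ((hprimc i).smul continuous_const).intervalIntegrable _ _
  have e1 : curveApprox w n x = x • (∫ t in (0 : ℝ)..1, V t) - ∫ t in (0 : ℝ)..x, V t := by
    rw [hVi, hVi, curveApprox, Finset.smul_sum, ← Finset.sum_sub_distrib]
    refine Finset.sum_congr rfl fun i _ => ?_
    rw [greenOp_eq_primitive (integrable_cellFun n i) hx, sub_smul, mul_smul]
  set e : ℝ → X := fun t => V t - (w t - w 0) with he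
  have hei : ∀ x, ∫ t in (0 : ℝ)..x, e t =
      (∫ t in (0 : ℝ)..x, V t) - ((∫ t in (0 : ℝ)..x, w t) - x • w 0) := by
    intro x
    simp only [he]
    have h0 : IntervalIntegrable (fun t => w t - w 0) volume 0 x :=
      (hwc.sub continuous_const).intervalIntegrable _ _
    rw [intervalIntegral.integral_sub (hVc.intervalIntegrable _ _) h0,
      intervalIntegral.integral_sub (hwc.intervalIntegrable _ _) (by simp),
      intervalIntegral.integral_const, sub_zero]
  have e2 : curveApprox w n x - curveLim w x =
      x • (∫ t in (0 : ℝ)..1, e t) - ∫ t in (0 : ℝ)..x, e t := by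
    rw [hei, hei, e1, curveLim]
    module
  have hb : ∀ x ∈ Icc (0 : ℝ) 1, ‖∫ t in (0 : ℝ)..x, e t‖ ≤ C := by
    intro x hx
    have h1 : ‖∫ t in (0 : ℝ)..x, e t‖ ≤ C * |x - 0| := by
      refine intervalIntegral.norm_integral_le_of_norm_le_const_ae ?_
      have : ∀ᵐ t : ℝ, t ≠ 1 := by simp [ae_iff, measure_singleton]
      filter_upwards [this] with t ht ht'
      rw [uIoc_of_le hx.1] at ht'
      exact norm_sum_cell_sub_le hw hH hn ⟨ht'.1.le, lt_of_le_of_ne (ht'.2.trans hx.2) ht⟩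
    rw [sub_zero, abs_of_nonneg hx.1] at h1
    exact h1.trans (mul_le_of_le_one_right hC0 hx.2)
  rw [e2]
  refine (norm_sub_le _ _).trans ?_
  rw [norm_smul, Real.norm_eq_abs, abs_of_nonneg hx.1]
  have h1 := mul_le_mul hx.2 (hb 1 (by simp)) (norm_nonneg _) zero_le_one
  have h2 := hb x hx
  calc _ ≤ 1 * C + C := add_le_add h1 h2
    _ = _ := by rw [hC]; ring

omit [CompleteSpace X] in
lemma mixedDiff_curveLim (hwc : Continuous w) (δ η x : ℝ) : mixedDiff δ η (curveLim w) x =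
    ∫ t in x..(x + η), (w (t + δ) - w t) := by
  have hi : ∀ a b, IntervalIntegrable w volume a b := fun a b => hwc.intervalIntegrable a b
  have hδi : IntervalIntegrable (fun t => w (t + δ)) volume x (x + η) :=
    Continuous.intervalIntegrable (by fun_prop) _ _
  have h1 : ∫ t in x..(x + η), w (t + δ) = ∫ t in (x + δ)..(x + δ + η), w t := by
    rw [intervalIntegral.integral_comp_add_right (fun t => w t)]
    congr 1; ring
  rw [intervalIntegral.integral_sub hδi (hi _ _), h1,
    ← intervalIntegral.integral_interval_sub_left (hi 0 _) (hi 0 (x + δ)),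
    ← intervalIntegral.integral_interval_sub_left (hi 0 _) (hi 0 x)]
  simp only [mixedDiff, curveLim]
  module

/-- The mixed difference is the integral of w(t + δ) - w(t) over [x, x + η]. Its main part η(w(x +
δ) - w(x)) has norm exactly ηδ^H, and freezing t at x costs at most 2η · η^H, half the main part by
the choice of η. -/
lemma le_norm_mixedDiff_curveLim (hwc : Continuous w)
    (hw : ∀ s ∈ Icc (0 : ℝ) 1, ∀ t ∈ Icc (0 : ℝ) 1, ‖w s - w t‖ = |s - t| ^ H) (hH : 0 < H)
    {δ η x : ℝ} (hδ : 0 ≤ δ) (hη : 0 ≤ η) (hx : 0 ≤ x) (hx1 : x + δ + η ≤ 1)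
    (hδη : 4 * η ^ H ≤ δ ^ H) : η * (δ ^ H / 2) ≤ ‖mixedDiff δ η (curveLim w) x‖ := by
  rw [mixedDiff_curveLim hwc]
  have h1 : ∫ t in x..(x + η), (w (t + δ) - w t) = η • (w (x + δ) - w x) +
      ∫ t in x..(x + η), ((w (t + δ) - w (x + δ)) - (w t - w x)) := by
    have : (fun t => (w (t + δ) - w (x + δ)) - (w t - w x)) =
        fun t => (w (t + δ) - w t) - (w (x + δ) - w x) := by ext t; abel
    have h0 : IntervalIntegrable (fun t => w (t + δ) - w t) volume x (x + η) :=
      Continuous.intervalIntegrable (by fun_prop) _ _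
    rw [this, intervalIntegral.integral_sub h0 intervalIntegrable_const,
      intervalIntegral.integral_const, add_sub_cancel_left]
    abel
  have h2 : ‖∫ t in x..(x + η), ((w (t + δ) - w (x + δ)) - (w t - w x))‖ ≤
      (2 * η ^ H) * |x + η - x| := by
    refine intervalIntegral.norm_integral_le_of_norm_le_const fun t ht => ?_
    rw [uIoc_of_le (by linarith)] at ht
    refine (norm_sub_le _ _).trans ?_
    rw [hw (t + δ) ⟨by linarith [ht.1], by linarith [ht.2]⟩ (x + δ) ⟨by linarith, by linarith⟩,
      hw t ⟨by linarith [ht.1], by linarith [ht.2]⟩ x ⟨by linarith, by linarith⟩,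
      add_sub_add_right_eq_sub, ← two_mul]
    refine mul_le_mul_of_nonneg_left (Real.rpow_le_rpow (abs_nonneg _) ?_ hH.le) (by norm_num)
    rw [abs_of_pos (sub_pos.2 ht.1)]
    linarith [ht.2]
  have h3 : ‖η • (w (x + δ) - w x)‖ = η * δ ^ H := by
    rw [norm_smul, Real.norm_eq_abs, abs_of_nonneg hη,
      hw (x + δ) ⟨by linarith, by linarith⟩ x ⟨by linarith, by linarith⟩, add_sub_cancel_left,
      abs_of_nonneg hδ]
  have h4 := norm_sub_le_norm_add (η • (w (x + δ) - w x))
    (∫ t in x..(x + η), ((w (t + δ) - w (x + δ)) - (w t - w x)))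
  rw [← h1, h3] at h4
  rw [add_sub_cancel_left, abs_of_nonneg hη] at h2
  nlinarith

end Curve

/-! ### Small-ball estimates for Gaussian variables -/

section GaussianSmallBall

/-- The density is at most 1/√(2πv) ≤ 1/(2√v), and the interval has length 2a. -/
lemma gaussianReal_ball_le {v : NNReal} (hv : v ≠ 0) (c a : ℝ) :
    gaussianReal 0 v {y | |y - c| ≤ a} ≤ ENNReal.ofReal (a / Real.sqrt v) := by
  have hv0 : (0 : ℝ) < v := NNReal.coe_pos.2 (pos_iff_ne_zero.2 hv)
  have hball : {y : ℝ | |y - c| ≤ a} = Icc (c - a) (c + a) := by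
    ext y
    rw [mem_ofPred_eq, abs_le, mem_Icc]
    constructor <;> rintro ⟨h1, h2⟩ <;> constructor <;> linarith
  have hs : 2 * Real.sqrt v ≤ Real.sqrt (2 * Real.pi * v) := by
    refine Real.le_sqrt_of_sq_le ?_
    rw [mul_pow, Real.sq_sqrt hv0.le]
    nlinarith [Real.pi_gt_three]
  have hs0 : 0 < Real.sqrt v := Real.sqrt_pos.2 hv0
  have hpdf : ∀ y, gaussianPDF 0 v y ≤ ENNReal.ofReal (1 / (2 * Real.sqrt v)) := by
    intro y
    refine ENNReal.ofReal_le_ofReal ?_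
    rw [gaussianPDFReal, one_div]
    refine le_trans (mul_le_of_le_one_right (by positivity) ?_)
      (inv_anti₀ (by positivity) hs)
    rw [Real.exp_le_one_iff]
    exact div_nonpos_of_nonpos_of_nonneg (neg_nonpos.2 (sq_nonneg _)) (by positivity)
  rw [gaussianReal_apply 0 hv, hball]
  calc ∫⁻ y in Icc (c - a) (c + a), gaussianPDF 0 v y
      ≤ ∫⁻ y in Icc (c - a) (c + a), ENNReal.ofReal (1 / (2 * Real.sqrt v)) :=
        lintegral_mono fun y => hpdf y
    _ = ENNReal.ofReal (a / Real.sqrt v) := by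
        rw [setLIntegral_const, Real.volume_Icc, ← ENNReal.ofReal_mul (by positivity)]
        congr 1
        field_simp
        ring

variable {Ω : Type*} [MeasurableSpace Ω] {P : Measure Ω}

lemma hasGaussianLaw_ball_le {X : Ω → ℝ} (hX : HasGaussianLaw X P) (h0 : ∫ ω, X ω ∂P = 0)
    (hpos : 0 < ‖hX.memLp_two.toLp X‖) (c a : ℝ) :
    P {ω | |X ω - c| ≤ a} ≤ ENNReal.ofReal (a / ‖hX.memLp_two.toLp X‖) := by
  have hvar : Var[X; P] = ‖hX.memLp_two.toLp X‖ ^ 2 := by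
    rw [variance_of_integral_eq_zero hX.aemeasurable h0, norm_toLp_sq]
  have hlaw := hX.map_eq_gaussianReal
  rw [h0, hvar] at hlaw
  have hms : MeasurableSet {y : ℝ | |y - c| ≤ a} :=
    measurableSet_le (by fun_prop) measurable_const
  have h1 : P {ω | |X ω - c| ≤ a} = (P.map X) {y | |y - c| ≤ a} := by
    rw [Measure.map_apply_of_aemeasurable hX.aemeasurable hms]; rfl
  rw [h1, hlaw]
  have hv : (‖hX.memLp_two.toLp X‖ ^ 2).toNNReal ≠ 0 := by
    rw [ne_eq, Real.toNNReal_eq_zero, not_le]; positivity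
  refine (gaussianReal_ball_le hv c a).trans (le_of_eq ?_)
  rw [Real.coe_toNNReal _ (sq_nonneg _), Real.sqrt_sq hpos.le]

/-- Small-ball bounds pass to limits in measure at the cost of doubling the radius, so the limit
itself need not be shown to be Gaussian. -/
lemma ball_le_of_tendstoInMeasure {Y : ℕ → Ω → ℝ} {X : Ω → ℝ} {t : ℕ → ℝ} {s : ℝ} (hs : 0 < s)
    (ht : Tendsto t atTop (𝓝 s))
    (hY : ∀ n, 0 < t n → ∀ c a, P {ω | |Y n ω - c| ≤ a} ≤ ENNReal.ofReal (a / t n))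
    (hYX : TendstoInMeasure P Y atTop X) (c : ℝ) {a : ℝ} (ha : 0 < a) :
    P {ω | |X ω - c| ≤ a} ≤ ENNReal.ofReal (2 * a / s) := by
  have h1 : Tendsto (fun n => ENNReal.ofReal (2 * a / t n) + P {ω | a ≤ ‖Y n ω - X ω‖}) atTop
      (𝓝 (ENNReal.ofReal (2 * a / s) + 0)) :=
    (ENNReal.tendsto_ofReal (tendsto_const_nhds.div ht hs.ne')).add
      ((tendstoInMeasure_iff_norm.1 hYX) a ha)
  rw [add_zero] at h1
  refine ge_of_tendsto h1 ?_
  filter_upwards [ht.eventually_const_lt hs] with n hn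
  refine le_trans (measure_mono ?_) ((measure_union_le _ _).trans
    (add_le_add (hY n hn c (2 * a)) le_rfl))
  intro ω hω
  rw [mem_ofPred_eq] at hω
  by_cases h : a ≤ ‖Y n ω - X ω‖
  · exact Or.inr h
  · left
    rw [Real.norm_eq_abs, not_le] at h
    rw [mem_ofPred_eq, show Y n ω - c = (Y n ω - X ω) + (X ω - c) by ring]
    exact (abs_add_le _ _).trans (by linarith)

lemma eLpNorm_eq_ofReal_norm_toLp {α : Type*} [MeasurableSpace α] {μ : Measure α} {f : α → ℝ}
    (hf : MemLp f 2 μ) : eLpNorm f 2 μ = ENNReal.ofReal ‖hf.toLp f‖ := by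
  rw [← Lp.enorm_toLp hf, ofReal_norm]

lemma toLp_sum_mul_sub {α ι : Type*} [MeasurableSpace α] {μ : Measure α} {s : Finset ι} {d : ι → ℝ}
    {F G : ι → α → ℝ} (hF : ∀ i, MemLp (F i) 2 μ) (hG : ∀ i, MemLp (G i) 2 μ)
    (h : MemLp (fun x => ∑ i ∈ s, d i * (F i x - G i x)) 2 μ) :
    h.toLp _ = ∑ i ∈ s, d i • ((hF i).toLp _ - (hG i).toLp _) := by
  ext1
  refine (MemLp.coeFn_toLp _).trans (EventuallyEq.trans ?_ (Lp.coeFn_finsetSum _ _).symm)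
  have h1 : ∀ᵐ x ∂μ, ∀ i ∈ s,
      (d i • ((hF i).toLp _ - (hG i).toLp _) : Lp ℝ 2 μ) x = d i * (F i x - G i x) := by
    refine (Finset.eventually_all _).2 fun i _ => ?_
    filter_upwards [Lp.coeFn_smul (d i) ((hF i).toLp _ - (hG i).toLp _),
      Lp.coeFn_sub ((hF i).toLp _) ((hG i).toLp _), (hF i).coeFn_toLp, (hG i).coeFn_toLp]
      with x h1 h2 h3 h4
    rw [h1, Pi.smul_apply, h2, Pi.sub_apply, smul_eq_mul, h3, h4]
  filter_upwards [h1] with x h1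
  rw [Finset.sum_apply]
  exact (Finset.sum_congr rfl h1).symm

end GaussianSmallBall

/-! ### Fractional Brownian motion as a curve in L²(P), and the convolved noise -/

section FBm

variable {Ω : Type*} [MeasurableSpace Ω] {P : Measure Ω}
variable {H : ℝ} {W : I → Ω → ℝ}

lemma IsFBm.memLp (hW : IsFBm P H W) (t : I) : MemLp (W t) 2 P :=
  (hW.gaussian.hasGaussianLaw_eval t).memLp_two

lemma IsFBm.integral_mul (hW : IsFBm P H W) (s t : I) : Integrable (fun ω => W s ω * W t ω) P :=
  (hW.memLp s).integrable_mul (hW.memLp t)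

/-- A fractional Brownian motion as a curve in `L²(P)`, extended by constants to `ℝ`. -/
def IsFBm.curve (hW : IsFBm P H W) (t : ℝ) : Lp ℝ 2 P :=
  (hW.memLp (projIcc 0 1 zero_le_one t)).toLp _

lemma IsFBm.norm_toLp_sub (hW : IsFBm P H W) (hH : 0 < H) (s t : I) :
    ‖(hW.memLp s).toLp _ - (hW.memLp t).toLp _‖ = |(s : ℝ) - t| ^ H := by
  have h1 : ‖(hW.memLp s).toLp _ - (hW.memLp t).toLp _‖ ^ 2 = (|(s : ℝ) - t| ^ H) ^ 2 := by
    rw [← MemLp.toLp_sub, norm_toLp_sq]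
    have e : ∀ ω, (W s - W t) ω ^ 2 = W s ω * W s ω - 2 * (W s ω * W t ω) + W t ω * W t ω :=
      fun ω => by simp only [Pi.sub_apply]; ring
    simp only [e]
    have i1 : Integrable (fun ω => W s ω * W s ω - 2 * (W s ω * W t ω)) P :=
      (hW.integral_mul s s).sub ((hW.integral_mul s t).const_mul 2)
    rw [integral_add i1 (hW.integral_mul t t), integral_sub (hW.integral_mul s s)
      ((hW.integral_mul s t).const_mul 2), integral_const_mul, hW.covariance, hW.covariance,
      hW.covariance]
    simp only [sub_self, abs_zero]
    rw [Real.zero_rpow (by linarith), ← Real.rpow_mul_natCast (abs_nonneg _)]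
    push_cast
    rw [mul_comm H 2]
    ring
  exact (pow_left_inj₀ (norm_nonneg _) (by positivity) two_ne_zero).1 h1

lemma IsFBm.norm_curve_sub (hW : IsFBm P H W) (hH : 0 < H) :
    ∀ s ∈ Icc (0 : ℝ) 1, ∀ t ∈ Icc (0 : ℝ) 1, ‖hW.curve s - hW.curve t‖ = |s - t| ^ H := by
  intro s hs t ht
  rw [IsFBm.curve, IsFBm.curve, hW.norm_toLp_sub hH, projIcc_of_mem _ hs, projIcc_of_mem _ ht]

lemma IsFBm.continuous_curve (hW : IsFBm P H W) (hH : 0 < H) : Continuous hW.curve := by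
  rw [continuous_iff_continuousAt]
  intro s
  rw [ContinuousAt, tendsto_iff_norm_sub_tendsto_zero]
  simp only [IsFBm.curve, hW.norm_toLp_sub hH]
  have h1 : Continuous fun t : ℝ => |((projIcc 0 1 zero_le_one t : I) : ℝ) -
      (projIcc 0 1 zero_le_one s : I)| ^ H := by
    refine Continuous.rpow_const ?_ fun _ => Or.inr hH.le
    exact ((continuous_subtype_val.comp continuous_projIcc).sub continuous_const).abs
  have h2 := h1.tendsto s
  simpa [Real.zero_rpow hH.ne'] using h2

lemma coe_gridPoint {n i : ℕ} (hi : i ≤ n) (hn : 0 < n) : (gridPoint n i : ℝ) = (i : ℝ) / n := by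
  rw [gridPoint, projIcc_of_mem]
  refine ⟨by positivity, ?_⟩
  rw [div_le_one (Nat.cast_pos.2 hn)]
  exact_mod_cast hi

omit [MeasurableSpace Ω] in
lemma noiseApprox_eq {n : ℕ} (hn : 0 < n) (x : ℝ) (ω : Ω) : noiseApprox W n x ω =
    ∑ i ∈ Finset.range n,
      cellFun n i x * (W (gridPoint n (i + 1)) ω - W (gridPoint n i) ω) := by
  refine Finset.sum_congr rfl fun i hi => ?_
  have hi' := Finset.mem_range.1 hi
  rw [coe_gridPoint hi'.le hn, coe_gridPoint hi' hn, cellFun]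
  by_cases h : x ∈ Ioc ((i : ℝ) / n) (((i + 1 : ℕ) : ℝ) / n)
  · rw [indicator_of_mem h, indicator_of_mem h]
  · rw [indicator_of_notMem h, indicator_of_notMem h, zero_mul]

/-- The Green convolution of the approximate noise. -/
def noiseConv (W : I → Ω → ℝ) (n : ℕ) (x : ℝ) (ω : Ω) : ℝ :=
  greenOp (fun y => noiseApprox W n y ω) x

omit [MeasurableSpace Ω] in
lemma noiseConv_eq {n : ℕ} (hn : 0 < n) {x : ℝ} (hx : x ∈ Icc (0 : ℝ) 1) (ω : Ω) :
    noiseConv W n x ω = ∑ i ∈ Finset.range n, greenOp (cellFun n i) x *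
      (W (gridPoint n (i + 1)) ω - W (gridPoint n i) ω) := by
  simp only [noiseConv, greenOp, noiseApprox_eq hn, Finset.mul_sum]
  rw [integral_finsetSum]
  · refine Finset.sum_congr rfl fun i _ => ?_
    rw [← integral_mul_const]
    congr 1; ext y; ring
  · intro i _
    simp only [← mul_assoc]
    exact (integrable_green_mul (integrable_cellFun n i) hx).mul_const _

/-- Linear combinations of the increments over the grid. -/
def gridSum (W : I → Ω → ℝ) (n : ℕ) (d : ℕ → ℝ) (ω : Ω) : ℝ :=
  ∑ i ∈ Finset.range n, d i * (W (gridPoint n (i + 1)) ω - W (gridPoint n i) ω)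

lemma IsFBm.hasGaussianLaw_gridSum (hW : IsFBm P H W) (n : ℕ) (d : ℕ → ℝ) :
    HasGaussianLaw (gridSum W n d) P := by
  have h1 := hW.gaussian.hasGaussianLaw_increments (n := n)
    (t := fun i : Fin (n + 1) => gridPoint n i)
  let L : (Fin n → ℝ) →L[ℝ] ℝ := ∑ i : Fin n, d i • ContinuousLinearMap.proj i
  have e : gridSum W n d = L ∘ fun ω (i : Fin n) =>
      W (gridPoint n (i.succ : Fin (n + 1))) ω - W (gridPoint n (i.castSucc : Fin (n + 1))) ω := by
    ext ω
    simp [gridSum, L, Finset.sum_range]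
  rw [e]
  exact h1.map L

lemma IsFBm.integral_gridSum (hW : IsFBm P H W) (n : ℕ) (d : ℕ → ℝ) :
    ∫ ω, gridSum W n d ω ∂P = 0 := by
  have := hW.gaussian.isProbabilityMeasure
  have hi : ∀ t, Integrable (W t) P := fun t => (hW.memLp t).integrable (by norm_num)
  have hd : ∀ i ∈ Finset.range n, Integrable
      (fun ω => d i * (W (gridPoint n (i + 1)) ω - W (gridPoint n i) ω)) P :=
    fun i _ => ((hi _).sub (hi _)).const_mul _
  unfold gridSum
  rw [integral_finsetSum _ hd]
  refine Finset.sum_eq_zero fun i _ => ?_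
  rw [integral_const_mul, integral_sub (hi _) (hi _), hW.centered, hW.centered]
  simp

lemma IsFBm.toLp_gridSum (hW : IsFBm P H W) {n : ℕ} (d : ℕ → ℝ) :
    (hW.hasGaussianLaw_gridSum n d).memLp_two.toLp _ =
      ∑ i ∈ Finset.range n, d i • (hW.curve (((i + 1 : ℕ) : ℝ) / n) - hW.curve ((i : ℝ) / n)) :=
  toLp_sum_mul_sub (fun i => hW.memLp (gridPoint n (i + 1)))
    (fun i => hW.memLp (gridPoint n i)) _

omit [MeasurableSpace Ω] in
lemma noiseConv_eq_gridSum {n : ℕ} (hn : 0 < n) {x : ℝ} (hx : x ∈ Icc (0 : ℝ) 1) :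
    noiseConv W n x = gridSum W n fun i => greenOp (cellFun n i) x := by
  ext ω; exact noiseConv_eq hn hx ω

lemma IsFBm.memLp_noiseConv (hW : IsFBm P H W) {n : ℕ} (hn : 0 < n) {x : ℝ}
    (hx : x ∈ Icc (0 : ℝ) 1) : MemLp (noiseConv W n x) 2 P := by
  rw [noiseConv_eq_gridSum hn hx]; exact (hW.hasGaussianLaw_gridSum n _).memLp_two

lemma IsFBm.toLp_noiseConv (hW : IsFBm P H W) {n : ℕ} (hn : 0 < n) {x : ℝ}
    (hx : x ∈ Icc (0 : ℝ) 1) : (hW.memLp_noiseConv hn hx).toLp _ = curveApprox hW.curve n x := by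
  rw [curveApprox, ← hW.toLp_gridSum]
  congr 1
  exact noiseConv_eq_gridSum hn hx

/-- Along these indices the L² errors are summable, with one choice valid for all x; hence the
almost sure convergence behind `noiseField`. -/
lemma exists_fastIndex (hH : 0 < H) :
    ∃ n : ℕ → ℕ, ∀ k, 0 < n k ∧ 4 * (1 / (n k : ℝ)) ^ H ≤ (1 / 2) ^ (k + 2) := by
  have h1 : Tendsto (fun n : ℕ => 4 * (1 / (n : ℝ)) ^ H) atTop (𝓝 0) := by
    have := (tendsto_one_div_atTop_nhds_zero_nat (𝕜 := ℝ)).rpow_const (p := H) (Or.inr hH.le)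
    rw [Real.zero_rpow hH.ne'] at this
    simpa using this.const_mul 4
  have h2 : ∀ k : ℕ, ∃ n : ℕ, 0 < n ∧ 4 * (1 / (n : ℝ)) ^ H ≤ (1 / 2) ^ (k + 2) := fun k =>
    ((eventually_gt_atTop 0).and (h1.eventually_le_const
      (show (0 : ℝ) < (1 / 2) ^ (k + 2) by positivity))).exists
  choose n hn using h2
  exact ⟨n, hn⟩

/-- A jointly measurable version of `∫ G(x,y) dW(y)`. -/
def noiseField (W : I → Ω → ℝ) (n : ℕ → ℕ) (x : ℝ) (ω : Ω) : ℝ :=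
  limUnder atTop fun k => noiseConv W (n k) x ω

lemma measurable_noiseApprox (hW : ∀ t, Measurable (W t)) (n : ℕ) :
    Measurable fun p : ℝ × Ω => noiseApprox W n p.1 p.2 := by
  unfold noiseApprox
  refine Finset.measurable_sum _ fun i _ => ?_
  exact Measurable.indicator (f := fun p : ℝ × Ω =>
    (n : ℝ) * (W (gridPoint n (i + 1)) p.2 - W (gridPoint n i) p.2))
    (s := Prod.fst ⁻¹' Ioc _ _)
    (measurable_const.mul (((hW _).comp measurable_snd).sub ((hW _).comp measurable_snd)))
    (measurable_fst measurableSet_Ioc)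

lemma measurable_noiseConv (hW : ∀ t, Measurable (W t)) (n : ℕ) :
    Measurable fun p : ℝ × Ω => noiseConv W n p.1 p.2 :=
  measurable_greenField (h := fun p => noiseApprox W n p.1 p.2) (measurable_noiseApprox hW n)

lemma measurable_noiseField (hW : ∀ t, Measurable (W t)) (n : ℕ → ℕ) :
    Measurable fun p : ℝ × Ω => noiseField W n p.1 p.2 :=
  (StronglyMeasurable.limUnder fun k =>
    (measurable_noiseConv hW (n k)).stronglyMeasurable).measurable

variable {n : ℕ → ℕ}

lemma IsFBm.norm_curveApprox_sub_le (hW : IsFBm P H W) (hH : 0 < H) {m : ℕ} (hm : 0 < m) {x : ℝ}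
    (hx : x ∈ Icc (0 : ℝ) 1) :
    ‖curveApprox hW.curve m x - curveLim hW.curve x‖ ≤ 4 * (1 / (m : ℝ)) ^ H :=
  FBmBVP.norm_curveApprox_sub_le (hW.continuous_curve hH)
    (fun s hs t ht => (hW.norm_curve_sub hH s hs t ht).le) hH hm hx

lemma IsFBm.ae_tendsto_noiseField (hW : IsFBm P H W) (hH : 0 < H)
    (hn : ∀ k, 0 < n k ∧ 4 * (1 / (n k : ℝ)) ^ H ≤ (1 / 2) ^ (k + 2)) {x : ℝ}
    (hx : x ∈ Icc (0 : ℝ) 1) :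
    ∀ᵐ ω ∂P, Tendsto (fun k => noiseConv W (n k) x ω) atTop (𝓝 (noiseField W n x ω)) := by
  have hm := fun k => hW.memLp_noiseConv (hn k).1 hx
  have h1 : ∀ᵐ ω ∂P, ∃ l, Tendsto (fun k => noiseConv W (n k) x ω) atTop (𝓝 l) := by
    -- Two errors of size 2^(-(N+2)) add up to 2^(-(N+1)), strictly below the summable bound 2^(-N).
    refine Lp.ae_tendsto_of_cauchy_eLpNorm (p := 2) (B := fun N => (1 / 2) ^ N)
      (fun k => (hm k).aestronglyMeasurable) (by norm_num) ?_ ?_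
    · rw [ENNReal.tsum_geometric]
      simp
    · intro N k l hk hl
      rw [eLpNorm_eq_ofReal_norm_toLp ((hm k).sub (hm l)), MemLp.toLp_sub (hm k) (hm l),
        hW.toLp_noiseConv (hn k).1 hx, hW.toLp_noiseConv (hn l).1 hx]
      have hle : ∀ k ≥ N, ‖curveApprox hW.curve (n k) x - curveLim hW.curve x‖ ≤
          (1 / 2) ^ (N + 2) := fun k hk =>
        (hW.norm_curveApprox_sub_le hH (hn k).1 hx).trans ((hn k).2.trans
          (pow_le_pow_of_le_one (by norm_num) (by norm_num) (by omega)))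
      have h2 : ‖curveApprox hW.curve (n k) x - curveApprox hW.curve (n l) x‖ ≤
          (1 / 2) ^ (N + 1) := by
        have := norm_sub_le_norm_sub_add_norm_sub (curveApprox hW.curve (n k) x)
          (curveLim hW.curve x) (curveApprox hW.curve (n l) x)
        rw [norm_sub_rev (curveLim _ _)] at this
        have e : (1 / 2 : ℝ) ^ (N + 1) = (1 / 2) ^ (N + 2) + (1 / 2) ^ (N + 2) := by ring
        linarith [hle k hk, hle l hl]
      have h3 : (1 / 2 : ℝ≥0∞) ^ N = ENNReal.ofReal ((1 / 2) ^ N) := by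
        rw [ENNReal.ofReal_pow (by norm_num)]
        congr 1
        rw [ENNReal.ofReal_div_of_pos (by norm_num)]
        simp
      rw [h3, ENNReal.ofReal_lt_ofReal_iff (by positivity)]
      refine h2.trans_lt ?_
      exact pow_lt_pow_right_of_lt_one₀ (by norm_num) (by norm_num) (by omega)
  filter_upwards [h1] with ω hω
  obtain ⟨l, hl⟩ := hω
  rwa [noiseField, hl.limUnder_eq]

lemma IsFBm.noiseField_ae_eq (hW : IsFBm P H W) (hH : 0 < H)
    (hn : ∀ k, 0 < n k ∧ 4 * (1 / (n k : ℝ)) ^ H ≤ (1 / 2) ^ (k + 2)) {x : ℝ}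
    (hx : x ∈ Icc (0 : ℝ) 1) : noiseField W n x =ᵐ[P] ⇑(curveLim hW.curve x) := by
  have hm := fun k => hW.memLp_noiseConv (hn k).1 hx
  have h1 : Tendsto (fun k => (hm k).toLp _) atTop (𝓝 (curveLim hW.curve x)) := by
    rw [tendsto_iff_norm_sub_tendsto_zero]
    refine squeeze_zero (fun _ => norm_nonneg _) (fun k => ?_)
      ((tendsto_pow_atTop_nhds_zero_of_lt_one (r := (1 / 2 : ℝ)) (by norm_num)
        (by norm_num)).comp (tendsto_add_atTop_nat 2))
    rw [hW.toLp_noiseConv (hn k).1 hx]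
    exact (hW.norm_curveApprox_sub_le hH (hn k).1 hx).trans (hn k).2
  obtain ⟨ns, hns, hae⟩ := (tendstoInMeasure_of_tendsto_Lp h1).exists_seq_tendsto_ae
  filter_upwards [hae, hW.ae_tendsto_noiseField hH hn hx, ae_all_iff.2 fun k => (hm k).coeFn_toLp]
    with ω a1 a2 a3
  simp only [a3] at a1
  exact tendsto_nhds_unique (a2.comp hns.tendsto_atTop) a1

lemma IsFBm.memLp_noiseField (hW : IsFBm P H W) (hH : 0 < H)
    (hn : ∀ k, 0 < n k ∧ 4 * (1 / (n k : ℝ)) ^ H ≤ (1 / 2) ^ (k + 2)) {x : ℝ}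
    (hx : x ∈ Icc (0 : ℝ) 1) : MemLp (noiseField W n x) 2 P :=
  (Lp.memLp (curveLim hW.curve x)).ae_eq (hW.noiseField_ae_eq hH hn hx).symm

lemma IsFBm.toLp_noiseField (hW : IsFBm P H W) (hH : 0 < H)
    (hn : ∀ k, 0 < n k ∧ 4 * (1 / (n k : ℝ)) ^ H ≤ (1 / 2) ^ (k + 2)) {x : ℝ}
    (hx : x ∈ Icc (0 : ℝ) 1) :
    (hW.memLp_noiseField hH hn hx).toLp _ = curveLim hW.curve x := by
  ext1
  exact (MemLp.coeFn_toLp _).trans (hW.noiseField_ae_eq hH hn hx)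

lemma IsFBm.eLpNorm_noiseConv_sub_le (hW : IsFBm P H W) (hH : 0 < H)
    (hn : ∀ k, 0 < n k ∧ 4 * (1 / (n k : ℝ)) ^ H ≤ (1 / 2) ^ (k + 2)) {m : ℕ} (hm : 0 < m) {x : ℝ}
    (hx : x ∈ Icc (0 : ℝ) 1) :
    eLpNorm (fun ω => noiseConv W m x ω - noiseField W n x ω) 2 P ≤
      ENNReal.ofReal (4 * (1 / (m : ℝ)) ^ H) := by
  have h1 := hW.memLp_noiseConv hm hx
  have h2 := hW.memLp_noiseField hH hn hx
  have h3 := eLpNorm_eq_ofReal_norm_toLp (h1.sub h2)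
  rw [MemLp.toLp_sub h1 h2, hW.toLp_noiseConv hm hx, hW.toLp_noiseField hH hn hx] at h3
  exact h3.trans_le (ENNReal.ofReal_le_ofReal (hW.norm_curveApprox_sub_le hH hm hx))

end FBm

/-! ### Small balls for the convolved noise -/

section SmallBalls

variable {Ω : Type*} [MeasurableSpace Ω] {P : Measure Ω} {H : ℝ} {W : I → Ω → ℝ} {n : ℕ → ℕ}

omit [MeasurableSpace Ω] in
lemma mixedDiff_noiseConv {m : ℕ} (hm : 0 < m) {δ η x : ℝ} (hδ : 0 ≤ δ) (hη : 0 ≤ η) (hx : 0 ≤ x)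
    (hx1 : x + δ + η ≤ 1) (ω : Ω) : mixedDiff δ η (fun x => noiseConv W m x ω) x =
      gridSum W m (fun i => mixedDiff δ η (greenOp (cellFun m i)) x) ω := by
  unfold mixedDiff gridSum
  beta_reduce
  rw [noiseConv_eq hm ⟨by linarith, by linarith⟩, noiseConv_eq hm ⟨by linarith, by linarith⟩,
    noiseConv_eq hm ⟨by linarith, by linarith⟩, noiseConv_eq hm ⟨by linarith, by linarith⟩,
    ← Finset.sum_sub_distrib, ← Finset.sum_sub_distrib, ← Finset.sum_sub_distrib]
  exact Finset.sum_congr rfl fun i _ => by ring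

lemma mixedDiff_curveApprox {X : Type*} [NormedAddCommGroup X] [NormedSpace ℝ X] (w : ℝ → X)
    (m : ℕ) (δ η x : ℝ) : mixedDiff δ η (curveApprox w m) x =
      ∑ i ∈ Finset.range m, mixedDiff δ η (greenOp (cellFun m i)) x •
        (w (((i + 1 : ℕ) : ℝ) / m) - w ((i : ℝ) / m)) := by
  simp only [mixedDiff, curveApprox, sub_smul, Finset.sum_sub_distrib]

/-- The Gaussian bound is applied to grid sums approximating the mixed difference. Their standard
deviations converge to the norm of the mixed difference of `curveLim`, which is bounded below by
`le_norm_mixedDiff_curveLim`. -/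
lemma IsFBm.ball_mixedDiff_le (hW : IsFBm P H W) (hH : 0 < H)
    (hn : ∀ k, 0 < n k ∧ 4 * (1 / (n k : ℝ)) ^ H ≤ (1 / 2) ^ (k + 2))
    {δ η x : ℝ} (hδ : 0 < δ) (hη : 0 < η) (hx : 0 ≤ x)
    (hx1 : x + δ + η ≤ 1) (hδη : 4 * η ^ H ≤ δ ^ H) (c : ℝ) {a : ℝ} (ha : 0 < a) :
    P {ω | |mixedDiff δ η (fun x => noiseField W n x ω) x - c| ≤ a} ≤
      ENNReal.ofReal (2 * a / (η * (δ ^ H / 2))) := by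
  have := hW.gaussian.isProbabilityMeasure
  have m1 : x ∈ Icc (0 : ℝ) 1 := ⟨by linarith, by linarith⟩
  have m2 : x + η ∈ Icc (0 : ℝ) 1 := ⟨by linarith, by linarith⟩
  have m3 : x + δ ∈ Icc (0 : ℝ) 1 := ⟨by linarith, by linarith⟩
  have m4 : x + δ + η ∈ Icc (0 : ℝ) 1 := ⟨by linarith, by linarith⟩
  have hge := le_norm_mixedDiff_curveLim (hW.continuous_curve hH) (hW.norm_curve_sub hH) hH
    hδ.le hη.le hx hx1 hδη
  have h0 : 0 < η * (δ ^ H / 2) := by positivity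
  let d : ℕ → ℕ → ℝ := fun k i => mixedDiff δ η (greenOp (cellFun (n k) i)) x
  have hlim : ∀ y ∈ Icc (0 : ℝ) 1, Tendsto (fun k => curveApprox hW.curve (n k) y) atTop
      (𝓝 (curveLim hW.curve y)) := fun y hy => by
    rw [tendsto_iff_norm_sub_tendsto_zero]
    refine squeeze_zero (fun _ => norm_nonneg _) (fun k =>
      (hW.norm_curveApprox_sub_le hH (hn k).1 hy).trans (hn k).2)
      ((tendsto_pow_atTop_nhds_zero_of_lt_one (r := (1 / 2 : ℝ)) (by norm_num)
        (by norm_num)).comp (tendsto_add_atTop_nat 2))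
  have ht : Tendsto (fun k => ‖(hW.hasGaussianLaw_gridSum (n k) (d k)).memLp_two.toLp _‖) atTop
      (𝓝 ‖mixedDiff δ η (curveLim hW.curve) x‖) := by
    refine Tendsto.norm ?_
    simp only [hW.toLp_gridSum, d, ← mixedDiff_curveApprox]
    exact ((hlim _ m2).sub (hlim _ m1)).sub ((hlim _ m4).sub (hlim _ m3))
  have hYX : TendstoInMeasure P (fun k => gridSum W (n k) (d k)) atTop
      (fun ω => mixedDiff δ η (fun x => noiseField W n x ω) x) := by
    refine tendstoInMeasure_of_tendsto_ae
      (fun k => (hW.hasGaussianLaw_gridSum (n k) (d k)).memLp_two.aestronglyMeasurable) ?_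
    filter_upwards [hW.ae_tendsto_noiseField hH hn m1, hW.ae_tendsto_noiseField hH hn m2,
      hW.ae_tendsto_noiseField hH hn m3, hW.ae_tendsto_noiseField hH hn m4] with ω a1 a2 a3 a4
    simp only [d, ← mixedDiff_noiseConv (hn _).1 hδ.le hη.le hx hx1]
    exact (a2.sub a1).sub (a4.sub a3)
  refine (ball_le_of_tendstoInMeasure (h0.trans_le hge) ht (fun k hk c a =>
    hasGaussianLaw_ball_le (hW.hasGaussianLaw_gridSum (n k) (d k)) (hW.integral_gridSum _ _) hk c a)
    hYX c ha).trans (ENNReal.ofReal_le_ofReal ?_)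
  gcongr

/-- The ratio η/δ = 4^(-1/H) is chosen so that 4η^H = δ^H. A ball of radius Mηδ then has probability
at most 4Mδ^(1-H), which vanishes because H < 1. The deterministic part b only moves the centre. -/
lemma IsFBm.hasSmallBalls (hW : IsFBm P H W) (hH : 0 < H) (hH1 : H < 1)
    (hn : ∀ k, 0 < n k ∧ 4 * (1 / (n k : ℝ)) ^ H ≤ (1 / 2) ^ (k + 2)) (b : ℝ → ℝ) :
    HasSmallBalls P fun x ω => b x + noiseField W n x ω := by
  have hκ : 0 < (1 / 4 : ℝ) ^ (1 / H) := by positivity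
  have hκ1 : (1 / 4 : ℝ) ^ (1 / H) ≤ 1 :=
    Real.rpow_le_one (by norm_num) (by norm_num) (by positivity)
  have hδ0 : ∀ k : ℕ, (0 : ℝ) < 1 / ((k : ℝ) + 1) := fun k => by positivity
  have hδ : Tendsto (fun k : ℕ => 1 / ((k : ℝ) + 1)) atTop (𝓝 0) :=
    tendsto_one_div_add_atTop_nhds_zero_nat
  refine ⟨fun k => 1 / ((k : ℝ) + 1), fun k => (1 / 4 : ℝ) ^ (1 / H) * (1 / ((k : ℝ) + 1)),
    fun k => 4 * (1 / ((k : ℝ) + 1)) ^ (1 - H), fun k => ⟨mul_pos hκ (hδ0 k),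
      mul_le_of_le_one_left (hδ0 k).le hκ1⟩, hδ, ?_, ?_⟩
  · have := (hδ.rpow_const (p := 1 - H) (Or.inr (by linarith))).const_mul 4
    rwa [Real.zero_rpow (by linarith), mul_zero] at this
  · intro k x hx M hM c
    dsimp only at hx ⊢
    set δ : ℝ := 1 / ((k : ℝ) + 1) with hδdef
    set η : ℝ := (1 / 4 : ℝ) ^ (1 / H) * δ with hηdef
    have hδk : 0 < δ := hδ0 k
    have hηk : 0 < η := mul_pos hκ hδk
    have hδη : 4 * η ^ H ≤ δ ^ H := by
      rw [hηdef, Real.mul_rpow hκ.le hδk.le, ← Real.rpow_mul (by norm_num), one_div_mul_cancel hH.ne',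
        Real.rpow_one]
      linarith
    have h1 := hW.ball_mixedDiff_le hH hn hδk hηk hx.1.le (by linarith [hx.2]) hδη
      (c - mixedDiff δ η b x) (show 0 < M * (η * δ) by positivity)
    have e : ∀ ω, mixedDiff δ η (fun x => b x + noiseField W n x ω) x - c =
        mixedDiff δ η (fun x => noiseField W n x ω) x - (c - mixedDiff δ η b x) := fun ω => by
      simp only [mixedDiff]; ring
    simp only [e]
    refine h1.trans (le_of_eq ?_)
    congr 1
    have hδH : δ ^ (1 - H) * δ ^ H = δ := by
      rw [← Real.rpow_add hδk, sub_add_cancel, Real.rpow_one]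
    have hp : 0 < δ ^ H := by positivity
    field_simp
    linear_combination (-4) * hδH

lemma HasSmallBalls.of_comp {Ω' : Type*} [MeasurableSpace Ω'] {P' : Measure Ω'} {T : Ω → Ω'}
    (hT : MeasurePreserving T P P') {z : ℝ → Ω' → ℝ} (hz : ∀ x, Measurable (z x))
    (h : HasSmallBalls P fun x ω => z x (T ω)) : HasSmallBalls P' z := by
  obtain ⟨δ, η, ρ, h1, h2, h3, h4⟩ := h
  refine ⟨δ, η, ρ, h1, h2, h3, fun n x hx M hM c => ?_⟩
  rw [← hT.measure_preimage]
  · exact h4 n x hx M hM c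
  · have : Measurable fun ω => mixedDiff (δ n) (η n) (fun x => z x ω) x - c :=
      (((hz _).sub (hz _)).sub ((hz _).sub (hz _))).sub measurable_const
    exact (measurableSet_le this.norm measurable_const).nullMeasurableSet

end SmallBalls

/-! ### The Φ^H norm of the indicator of an interval -/

section IntervalNorm

lemma lintegral_Ioc_ofReal {F : ℝ → ℝ} {c d : ℝ} (hcd : c ≤ d)
    (hF : IntervalIntegrable F volume c d) (h0 : ∀ y ∈ Ioc c d, 0 ≤ F y) :
    ∫⁻ y in Ioc c d, ENNReal.ofReal (F y) = ENNReal.ofReal (∫ y in c..d, F y) := by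
  rw [intervalIntegral.integral_of_le hcd, ofReal_integral_eq_lintegral_ofReal
    ((intervalIntegrable_iff_integrableOn_Ioc_of_le hcd).1 hF)]
  exact (ae_restrict_iff' measurableSet_Ioc).2 (Eventually.of_forall h0)

lemma lintegral_volD_eq_add {a b : ℝ} (ha : 0 ≤ a) (hab : a ≤ b) (hb : b ≤ 1) (G : ℝ → ℝ≥0∞) :
    ∫⁻ y, G y ∂volD =
      (∫⁻ y in Ioc 0 a, G y) + (∫⁻ y in Ioc a b, G y) + ∫⁻ y in Ioc b 1, G y := by
  rw [setLIntegral_congr Ioo_ae_eq_Ioc, ← Ioc_union_Ioc_eq_Ioc (ha.trans hab) hb,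
    lintegral_union measurableSet_Ioc (Ioc_disjoint_Ioc_of_le le_rfl),
    ← Ioc_union_Ioc_eq_Ioc ha hab, lintegral_union measurableSet_Ioc (Ioc_disjoint_Ioc_of_le le_rfl)]

lemma lintegral_abs_rpow_left {p x c d : ℝ} (hp : p < 1) (hcd : c ≤ d) (hd : d < x) :
    ∫⁻ y in Ioc c d, ENNReal.ofReal (1 / |x - y| ^ (2 - p)) =
      ENNReal.ofReal (((x - d) ^ (p - 1) - (x - c) ^ (p - 1)) / (1 - p)) := by
  have hnot : (0 : ℝ) ∉ uIcc (x - d) (x - c) := by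
    rw [uIcc_of_le (by linarith), mem_Icc]; rintro ⟨h, -⟩; linarith
  have e : ∀ y ∈ Ioc c d, ENNReal.ofReal (1 / |x - y| ^ (2 - p)) =
      ENNReal.ofReal ((x - y) ^ (p - 2)) := fun y hy => by
    have h : 0 < x - y := by linarith [hy.2]
    rw [abs_of_pos h, one_div, ← Real.rpow_neg h.le, neg_sub]
  have hi : IntervalIntegrable (fun y => (x - y) ^ (p - 2)) volume c d := by
    have := (intervalIntegral.intervalIntegrable_rpow (μ := volume) (r := p - 2)
      (Or.inr hnot)).comp_sub_left x
    simpa using this.symm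
  rw [setLIntegral_congr_fun measurableSet_Ioc e, lintegral_Ioc_ofReal hcd hi fun y hy =>
    Real.rpow_nonneg (by linarith [hy.2]) _,
    intervalIntegral.integral_comp_sub_left (fun z => z ^ (p - 2)) x,
    integral_rpow (Or.inr ⟨by linarith, hnot⟩)]
  congr 1
  rw [show p - 2 + 1 = p - 1 by ring, show p - 1 = -(1 - p) by ring, div_neg, ← neg_div, neg_sub]

lemma lintegral_abs_rpow_right {p x c d : ℝ} (hp : p < 1) (hcd : c ≤ d) (hc : x < c) :
    ∫⁻ y in Ioc c d, ENNReal.ofReal (1 / |x - y| ^ (2 - p)) =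
      ENNReal.ofReal (((c - x) ^ (p - 1) - (d - x) ^ (p - 1)) / (1 - p)) := by
  have hnot : (0 : ℝ) ∉ uIcc (c - x) (d - x) := by
    rw [uIcc_of_le (by linarith), mem_Icc]; rintro ⟨h, -⟩; linarith
  have e : ∀ y ∈ Ioc c d, ENNReal.ofReal (1 / |x - y| ^ (2 - p)) =
      ENNReal.ofReal ((y - x) ^ (p - 2)) := fun y hy => by
    have h : 0 < y - x := by linarith [hy.1]
    rw [abs_sub_comm, abs_of_pos h, one_div, ← Real.rpow_neg h.le, neg_sub]
  have hi : IntervalIntegrable (fun y => (y - x) ^ (p - 2)) volume c d := by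
    have := (intervalIntegral.intervalIntegrable_rpow (μ := volume) (r := p - 2)
      (Or.inr hnot)).comp_sub_right x
    simpa using this
  rw [setLIntegral_congr_fun measurableSet_Ioc e, lintegral_Ioc_ofReal hcd hi fun y hy =>
    Real.rpow_nonneg (by linarith [hy.1]) _,
    intervalIntegral.integral_comp_sub_right (fun z => z ^ (p - 2)) x,
    integral_rpow (Or.inr ⟨by linarith, hnot⟩)]
  congr 1
  rw [show p - 2 + 1 = p - 1 by ring, show p - 1 = -(1 - p) by ring, div_neg, ← neg_div, neg_sub]

lemma measurable_rpow_kernel (p : ℝ) :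
    Measurable fun q : ℝ × ℝ => ENNReal.ofReal (1 / |q.1 - q.2| ^ (2 - p)) := by
  fun_prop

/-- Only pairs with exactly one point in (a, b] contribute, and the kernel is symmetric. -/
lemma lintegral_indicator_sub_sq {a b p : ℝ} (ha : 0 ≤ a) (hab : a ≤ b) (hb : b ≤ 1) :
    ∫⁻ x, ∫⁻ y, ENNReal.ofReal (((Ioc a b).indicator (fun _ => (1 : ℝ)) x -
        (Ioc a b).indicator (fun _ => (1 : ℝ)) y) ^ 2 / |x - y| ^ (2 - p)) ∂volD ∂volD =
      2 * ∫⁻ x in Ioc a b, ((∫⁻ y in Ioc 0 a, ENNReal.ofReal (1 / |x - y| ^ (2 - p))) +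
        ∫⁻ y in Ioc b 1, ENNReal.ofReal (1 / |x - y| ^ (2 - p))) := by
  set k : ℝ → ℝ → ℝ≥0∞ := fun x y => ENNReal.ofReal (1 / |x - y| ^ (2 - p)) with hk
  have hkm : Measurable (Function.uncurry k) := measurable_rpow_kernel p
  have hks : ∀ x y, k x y = k y x := fun x y => by simp only [hk, abs_sub_comm x y]
  have houter : ∀ x, x ∉ Ioc a b → ∫⁻ y, ENNReal.ofReal (((Ioc a b).indicator (fun _ => (1 : ℝ)) x -
      (Ioc a b).indicator (fun _ => (1 : ℝ)) y) ^ 2 / |x - y| ^ (2 - p)) ∂volD =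
      ∫⁻ y in Ioc a b, k x y := by
    intro x hx
    rw [lintegral_volD_eq_add ha hab hb]
    rw [setLIntegral_congr_fun (g := fun _ => 0) (s := Ioc 0 a) measurableSet_Ioc,
      setLIntegral_congr_fun (g := fun _ => 0) (s := Ioc b 1) measurableSet_Ioc,
      setLIntegral_congr_fun (g := fun y => k x y) (s := Ioc a b) measurableSet_Ioc]
    · simp
    · intro y hy
      simp [indicator_of_notMem hx, indicator_of_mem hy, hk]
    · intro y hy
      have : y ∉ Ioc a b := fun h => not_lt.2 h.2 hy.1
      simp [indicator_of_notMem hx, indicator_of_notMem this]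
    · intro y hy
      have : y ∉ Ioc a b := fun h => not_lt.2 hy.2 h.1
      simp [indicator_of_notMem hx, indicator_of_notMem this]
  have hinner : ∀ x ∈ Ioc a b, ∫⁻ y, ENNReal.ofReal (((Ioc a b).indicator (fun _ => (1 : ℝ)) x -
      (Ioc a b).indicator (fun _ => (1 : ℝ)) y) ^ 2 / |x - y| ^ (2 - p)) ∂volD =
      (∫⁻ y in Ioc 0 a, k x y) + ∫⁻ y in Ioc b 1, k x y := by
    intro x hx
    rw [lintegral_volD_eq_add ha hab hb]
    rw [setLIntegral_congr_fun (g := fun y => k x y) (s := Ioc 0 a) measurableSet_Ioc,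
      setLIntegral_congr_fun (g := fun y => k x y) (s := Ioc b 1) measurableSet_Ioc,
      setLIntegral_congr_fun (g := fun _ => 0) (s := Ioc a b) measurableSet_Ioc]
    · simp
    · intro y hy
      simp [indicator_of_mem hx, indicator_of_mem hy]
    · intro y hy
      have : y ∉ Ioc a b := fun h => not_lt.2 h.2 hy.1
      simp [indicator_of_mem hx, indicator_of_notMem this, hk]
    · intro y hy
      have : y ∉ Ioc a b := fun h => not_lt.2 hy.2 h.1
      simp [indicator_of_mem hx, indicator_of_notMem this, hk]
  have hswap : ∀ S : Set ℝ, ∫⁻ x in S, ∫⁻ y in Ioc a b, k x y =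
      ∫⁻ x in Ioc a b, ∫⁻ y in S, k x y := fun S => by
    rw [lintegral_lintegral_swap hkm.aemeasurable]
    simp only [hks]
  rw [lintegral_volD_eq_add ha hab hb, setLIntegral_congr_fun (s := Ioc a b) measurableSet_Ioc hinner,
    setLIntegral_congr_fun (g := fun x => ∫⁻ y in Ioc a b, k x y) (s := Ioc 0 a) measurableSet_Ioc,
    setLIntegral_congr_fun (g := fun x => ∫⁻ y in Ioc a b, k x y) (s := Ioc b 1) measurableSet_Ioc,
    hswap, hswap, lintegral_add_left]
  · ring
  · exact hkm.lintegral_prod_right'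
  · intro x hx
    exact houter x fun h => not_lt.2 h.2 hx.1
  · intro x hx
    exact houter x fun h => not_lt.2 hx.2 h.1

/-- Integrating the kernel over the complement of (a, b] yields powers of the distances to a and b
minus powers of the distances to 0 and 1; the latter cancel against the weighted L² term. The value
obtained is the variance of W(b) - W(a). -/
lemma normSqPhi_indicator {H a b : ℝ} (hH0 : 0 < H) (hH : H ≤ 1 / 2) (ha : 0 ≤ a) (hab : a ≤ b)
    (hb : b ≤ 1) : normSqPhi H ((Ioc a b).indicator fun _ => (1 : ℝ)) =
      ENNReal.ofReal ((b - a) ^ (2 * H)) := by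
  set r : ℝ → ℝ := fun x => H * (((x - a) ^ (2 * H - 1) - x ^ (2 * H - 1)) +
    ((b - x) ^ (2 * H - 1) - (1 - x) ^ (2 * H - 1))) with hr
  have hne : ∀ᵐ x ∂(volume.restrict (Ioc a b)), x ∈ Ioo a b := by
    rw [← restrict_Ioo_eq_restrict_Ioc]
    exact ae_restrict_mem measurableSet_Ioo
  have hdec : ∀ s t : ℝ, 0 < s → s ≤ t → t ^ (2 * H - 1) ≤ s ^ (2 * H - 1) := fun s t hs hst =>
    Real.rpow_le_rpow_of_nonpos hs hst (by linarith)
  have hr0 : ∀ x ∈ Ioo a b, 0 ≤ r x := fun x hx => by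
    have h1 := hdec (x - a) x (by linarith [hx.1]) (by linarith)
    have h2 := hdec (b - x) (1 - x) (by linarith [hx.2]) (by linarith)
    simp only [hr]
    exact mul_nonneg hH0.le (by linarith)
  have hfirst : ENNReal.ofReal (H * (1 - 2 * H) / 2) *
      ∫⁻ x, ∫⁻ y, ENNReal.ofReal (((Ioc a b).indicator (fun _ => (1 : ℝ)) x -
        (Ioc a b).indicator (fun _ => (1 : ℝ)) y) ^ 2 / |x - y| ^ (2 - 2 * H)) ∂volD ∂volD =
      ∫⁻ x in Ioc a b, ENNReal.ofReal (r x) := by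
    -- At H = 1/2 the kernel 1/|x - y| has no power antiderivative, but its coefficient 1 - 2H
    -- vanishes, and so does r.
    rcases hH.lt_or_eq with hlt | heq
    · rw [lintegral_indicator_sub_sq ha hab hb, ← mul_assoc,
        ← lintegral_const_mul']
      · refine lintegral_congr_ae ?_
        filter_upwards [hne] with x hx
        rw [lintegral_abs_rpow_left (by linarith) ha hx.1,
          lintegral_abs_rpow_right (by linarith) hb hx.2, sub_zero]
        have h1 := hdec (x - a) x (by linarith [hx.1]) (by linarith)
        have h2 := hdec (b - x) (1 - x) (by linarith [hx.2]) (by linarith)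
        have hp : 0 < 1 - 2 * H := by linarith
        have hp' : 1 - H * 2 ≠ 0 := by linarith
        rw [← ENNReal.ofReal_add (div_nonneg (by linarith) hp.le)
          (div_nonneg (by linarith) hp.le),
          show (2 : ℝ≥0∞) = ENNReal.ofReal 2 by simp, ← ENNReal.ofReal_mul (by positivity),
          ← ENNReal.ofReal_mul (by positivity)]
        congr 1
        simp only [hr]
        field_simp
      · exact ENNReal.mul_ne_top ENNReal.ofReal_ne_top (by simp)
    · have e : ∀ x ∈ Ioc a b, ENNReal.ofReal (r x) = 0 := fun x _ => by
        simp [hr, heq]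
      rw [setLIntegral_congr_fun measurableSet_Ioc e, heq]
      simp
  have hsecond : ENNReal.ofReal H * ∫⁻ x, ENNReal.ofReal
      ((Ioc a b).indicator (fun _ => (1 : ℝ)) x ^ 2 * (x ^ (2 * H - 1) + (1 - x) ^ (2 * H - 1))) ∂volD =
      ∫⁻ x in Ioc a b, ENNReal.ofReal (H * (x ^ (2 * H - 1) + (1 - x) ^ (2 * H - 1))) := by
    rw [lintegral_volD_eq_add ha hab hb,
      setLIntegral_congr_fun (g := fun _ => 0) (s := Ioc 0 a) measurableSet_Ioc,
      setLIntegral_congr_fun (g := fun _ => 0) (s := Ioc b 1) measurableSet_Ioc, lintegral_zero,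
      zero_add, lintegral_zero, add_zero, ← lintegral_const_mul' _ _ ENNReal.ofReal_ne_top]
    · refine setLIntegral_congr_fun measurableSet_Ioc fun x hx => ?_
      simp only [indicator_of_mem hx, one_pow, one_mul]
      rw [← ENNReal.ofReal_mul hH0.le]
    · intro y hy
      have : y ∉ Ioc a b := fun h => not_lt.2 h.2 hy.1
      simp [indicator_of_notMem this]
    · intro y hy
      have : y ∉ Ioc a b := fun h => not_lt.2 hy.2 h.1
      simp [indicator_of_notMem this]
  have i1 : IntervalIntegrable (fun x => (x - a) ^ (2 * H - 1)) volume a b := by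
    have := (intervalIntegral.intervalIntegrable_rpow' (a := 0) (b := b - a) (r := 2 * H - 1)
      (by linarith)).comp_sub_right a
    simpa using this
  have i2 : IntervalIntegrable (fun x => (b - x) ^ (2 * H - 1)) volume a b := by
    have := (intervalIntegral.intervalIntegrable_rpow' (a := 0) (b := b - a) (r := 2 * H - 1)
      (by linarith)).comp_sub_left b
    simpa using this.symm
  rw [normSqPhi, hfirst, hsecond, ← lintegral_add_left (by fun_prop)]
  calc ∫⁻ x in Ioc a b, (ENNReal.ofReal (r x) +
        ENNReal.ofReal (H * (x ^ (2 * H - 1) + (1 - x) ^ (2 * H - 1))))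
      = ∫⁻ x in Ioc a b, ENNReal.ofReal (H * ((x - a) ^ (2 * H - 1) + (b - x) ^ (2 * H - 1))) := by
        refine lintegral_congr_ae ?_
        filter_upwards [hne] with x hx
        have hx0 : 0 ≤ x := by linarith [hx.1]
        have hx1 : 0 ≤ 1 - x := by linarith [hx.2]
        rw [← ENNReal.ofReal_add (hr0 x hx) (by positivity)]
        congr 1
        simp only [hr]
        ring
    _ = ENNReal.ofReal ((b - a) ^ (2 * H)) := by
        rw [lintegral_Ioc_ofReal hab ((i1.add i2).const_mul H), intervalIntegral.integral_const_mul,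
          intervalIntegral.integral_add i1 i2,
          intervalIntegral.integral_comp_sub_right (fun z => z ^ (2 * H - 1)) a,
          intervalIntegral.integral_comp_sub_left (fun z => z ^ (2 * H - 1)) b, sub_self, sub_self,
          integral_rpow (Or.inl (by linarith)), sub_add_cancel, Real.zero_rpow (by positivity)]
        · congr 1
          field_simp
          ring
        · intro x hx
          have h1 : 0 ≤ x - a := by linarith [hx.1]
          have h2 : 0 ≤ b - x := by linarith [hx.2]
          positivity

end IntervalNorm

/-! ### The isometry between Φ^H and L²(P) -/

section Isometry

/-- If two systems of vectors have the same mutual distances and share a zero vector, then their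
linear combinations have the same norms. -/
lemma norm_linearCombination_eq {ι E F : Type*} [NormedAddCommGroup E] [InnerProductSpace ℝ E]
    [NormedAddCommGroup F] [InnerProductSpace ℝ F] {v : ι → E} {w : ι → F} {i₀ : ι} (hv : v i₀ = 0)
    (hw : w i₀ = 0) (h : ∀ i j, ‖v i - v j‖ = ‖w i - w j‖) (c : ι →₀ ℝ) :
    ‖Finsupp.linearCombination ℝ v c‖ = ‖Finsupp.linearCombination ℝ w c‖ := by
  have hn : ∀ i, ‖v i‖ = ‖w i‖ := fun i => by simpa [hv, hw] using h i i₀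
  have hi : ∀ i j, inner ℝ (v i) (v j) = inner ℝ (w i) (w j) := fun i j => by
    rw [real_inner_eq_norm_mul_self_add_norm_mul_self_sub_norm_sub_mul_self_div_two,
      real_inner_eq_norm_mul_self_add_norm_mul_self_sub_norm_sub_mul_self_div_two, hn, hn, h]
  have h2 : ‖Finsupp.linearCombination ℝ v c‖ ^ 2 = ‖Finsupp.linearCombination ℝ w c‖ ^ 2 := by
    rw [← real_inner_self_eq_norm_sq, ← real_inner_self_eq_norm_sq,
      Finsupp.linearCombination_apply, Finsupp.linearCombination_apply, Finsupp.sum, Finsupp.sum]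
    simp only [sum_inner, inner_sum, real_inner_smul_left, real_inner_smul_right, hi]
  exact (pow_left_inj₀ (norm_nonneg _) (norm_nonneg _) two_ne_zero).1 h2

lemma eLpNorm_two_sq {α : Type*} [MeasurableSpace α] {μ : Measure α} (h : α → ℝ) :
    eLpNorm h 2 μ ^ 2 = ∫⁻ x, ENNReal.ofReal (h x ^ 2) ∂μ := by
  have := eLpNorm_nnreal_pow_eq_lintegral (f := h) (μ := μ) (p := 2) two_ne_zero
  simp only [NNReal.coe_ofNat, ENNReal.rpow_ofNat, ENNReal.coe_ofNat] at this
  rw [this]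
  refine lintegral_congr fun x => ?_
  rw [Real.enorm_eq_ofReal_abs, ← ENNReal.ofReal_pow (abs_nonneg _), sq_abs]

/-- The space `Φ^H` is embedded in an `L²` space over `D × D ⊕ D`, with this measure. -/
def phiMeasure (H : ℝ) : Measure ((ℝ × ℝ) ⊕ ℝ) :=
  (ENNReal.ofReal (H * (1 - 2 * H) / 2) • (volD.prod volD).withDensity
    fun q => ENNReal.ofReal (1 / |q.1 - q.2| ^ (2 - 2 * H))).map Sum.inl +
  (ENNReal.ofReal H • volD.withDensity
    fun x => ENNReal.ofReal (x ^ (2 * H - 1) + (1 - x) ^ (2 * H - 1))).map Sum.inr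

/-- The embedding of `Φ^H` in an `L²` space. -/
def phiLift (φ : ℝ → ℝ) : (ℝ × ℝ) ⊕ ℝ → ℝ := Sum.elim (fun q => φ q.1 - φ q.2) φ

lemma measurable_phiLift {φ : ℝ → ℝ} (hφ : Measurable φ) : Measurable (phiLift φ) :=
  measurable_fun_sum ((hφ.comp measurable_fst).sub (hφ.comp measurable_snd)) hφ

lemma phiLift_sub (φ ψ : ℝ → ℝ) : phiLift (fun x => φ x - ψ x) = phiLift φ - phiLift ψ := by
  ext q
  rcases q with q | x
  · simp only [phiLift, Sum.elim_inl, Pi.sub_apply]; ring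
  · rfl

/-- Realizing Φ^H inside an L² space provides the triangle inequality, inner products and Fatou's
lemma. -/
lemma eLpNorm_phiLift_sq {H : ℝ} {φ : ℝ → ℝ} (hφ : Measurable φ) :
    eLpNorm (phiLift φ) 2 (phiMeasure H) ^ 2 = normSqPhi H φ := by
  have hm : Measurable fun q => ENNReal.ofReal (phiLift φ q ^ 2) :=
    ((measurable_phiLift hφ).pow_const 2).ennreal_ofReal
  have k1 : Measurable fun q : ℝ × ℝ => ENNReal.ofReal (1 / |q.1 - q.2| ^ (2 - 2 * H)) :=
    measurable_rpow_kernel _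
  have k2 : Measurable fun x : ℝ => ENNReal.ofReal (x ^ (2 * H - 1) + (1 - x) ^ (2 * H - 1)) := by
    fun_prop
  have k3 : Measurable fun q : ℝ × ℝ => ENNReal.ofReal ((φ q.1 - φ q.2) ^ 2) := by fun_prop
  have k4 : Measurable fun x : ℝ => ENNReal.ofReal (φ x ^ 2) := by fun_prop
  rw [eLpNorm_two_sq, phiMeasure, lintegral_add_measure, lintegral_map hm measurable_inl,
    lintegral_map hm measurable_inr, lintegral_smul_measure, lintegral_smul_measure, normSqPhi]
  simp only [phiLift, Sum.elim_inl, Sum.elim_inr]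
  rw [lintegral_withDensity_eq_lintegral_mul _ k1 k3, lintegral_withDensity_eq_lintegral_mul _ k2 k4,
    lintegral_prod _ (k1.mul k3).aemeasurable]
  simp only [Pi.mul_apply, smul_eq_mul]
  congr 2
  · refine lintegral_congr fun x => lintegral_congr fun y => ?_
    rw [← ENNReal.ofReal_mul (by positivity)]
    congr 1
    ring
  · refine lintegral_congr_ae (ae_volD_of_forall fun x hx => ?_)
    have h1 := hx.1.le
    have h2 : 0 ≤ 1 - x := by linarith [hx.2]
    beta_reduce
    rw [← ENNReal.ofReal_mul (by positivity), mul_comm]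

/-- The indicator function of `(0, t]`, which is the integrand of `W t`. -/
def initInd (t : I) : ℝ → ℝ := (Ioc (0 : ℝ) t).indicator fun _ => 1

lemma measurable_initInd (t : I) : Measurable (initInd t) :=
  measurable_const.indicator measurableSet_Ioc

lemma initInd_sub {s t : I} (h : s ≤ t) (x : ℝ) :
    initInd t x - initInd s x = (Ioc (s : ℝ) t).indicator (fun _ => 1) x := by
  have h' : (s : ℝ) ≤ t := h
  have h0 := s.2.1
  unfold initInd
  by_cases h1 : x ∈ Ioc (0 : ℝ) s
  · rw [indicator_of_mem h1, indicator_of_mem (s := Ioc (0 : ℝ) t) ⟨h1.1, h1.2.trans h'⟩,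
      indicator_of_notMem (fun h2 => not_lt.2 h1.2 h2.1), sub_self]
  · rw [indicator_of_notMem h1, sub_zero]
    by_cases h2 : x ∈ Ioc (s : ℝ) t
    · rw [indicator_of_mem h2, indicator_of_mem (s := Ioc (0 : ℝ) t) ⟨h0.trans_lt h2.1, h2.2⟩]
    · rw [indicator_of_notMem h2, indicator_of_notMem]
      intro h3
      exact h2 ⟨not_le.1 fun h4 => h1 ⟨h3.1, h4⟩, h3.2⟩

lemma StepFunction.eval_eq (s : StepFunction) (x : ℝ) : s.eval x =
    ∑ j ∈ Finset.range s.N, s.c j * (initInd (s.a (j + 1)) x - initInd (s.a j) x) := by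
  refine Finset.sum_congr rfl fun j hj => ?_
  rw [initInd_sub (s.a_lt j (Finset.mem_range.1 hj)).le]
  by_cases h : x ∈ Ioc (s.a j : ℝ) (s.a (j + 1))
  · rw [indicator_of_mem h, indicator_of_mem h, mul_one]
  · rw [indicator_of_notMem h, indicator_of_notMem h, mul_zero]

lemma StepFunction.measurable_eval (s : StepFunction) : Measurable s.eval := by
  unfold StepFunction.eval
  exact Finset.measurable_sum _ fun j _ => measurable_const.indicator measurableSet_Ioc

lemma StepFunction.phiLift_eval (s : StepFunction) : phiLift s.eval = fun q =>
    ∑ j ∈ Finset.range s.N,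
      s.c j * (phiLift (initInd (s.a (j + 1))) q - phiLift (initInd (s.a j)) q) := by
  ext q
  rcases q with q | x
  · simp only [phiLift, Sum.elim_inl, StepFunction.eval_eq, ← Finset.sum_sub_distrib]
    exact Finset.sum_congr rfl fun j _ => by ring
  · simp only [phiLift, Sum.elim_inr, StepFunction.eval_eq]

variable {H : ℝ}

lemma eLpNorm_phiLift_initInd_sub (hH0 : 0 < H) (hH : H ≤ 1 / 2) (s t : I) :
    eLpNorm (phiLift (initInd t) - phiLift (initInd s)) 2 (phiMeasure H) =
      ENNReal.ofReal (|(t : ℝ) - s| ^ H) := by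
  wlog h : s ≤ t generalizing s t
  · rw [eLpNorm_sub_comm, this t s (le_of_not_ge h), abs_sub_comm]
  have h' : (s : ℝ) ≤ t := h
  have h1 : eLpNorm (phiLift (initInd t) - phiLift (initInd s)) 2 (phiMeasure H) ^ 2 =
      ENNReal.ofReal (|(t : ℝ) - s| ^ H) ^ 2 := by
    have e : (fun x => initInd t x - initInd s x) = (Ioc (s : ℝ) t).indicator fun _ => 1 :=
      funext (initInd_sub h)
    rw [← phiLift_sub, e, eLpNorm_phiLift_sq (measurable_const.indicator measurableSet_Ioc),
      normSqPhi_indicator hH0 hH s.2.1 h' t.2.2, ← ENNReal.ofReal_pow (by positivity),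
      abs_of_nonneg (sub_nonneg.2 h'), ← Real.rpow_mul_natCast (sub_nonneg.2 h')]
    congr 2
    push_cast
    ring
  exact (ENNReal.pow_right_strictMono two_ne_zero).injective h1

lemma phiLift_initInd_zero : phiLift (initInd 0) = 0 := by
  have : initInd 0 = fun _ => 0 := by
    ext x
    simp [initInd]
  ext q
  rcases q with q | x <;> simp [phiLift, this]

lemma memLp_phiLift_initInd (hH0 : 0 < H) (hH : H ≤ 1 / 2) (t : I) :
    MemLp (phiLift (initInd t)) 2 (phiMeasure H) := by
  refine ⟨(measurable_phiLift (measurable_initInd t)).aestronglyMeasurable, ?_⟩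
  have := eLpNorm_phiLift_initInd_sub hH0 hH 0 t
  rw [phiLift_initInd_zero, sub_zero] at this
  rw [this]
  exact ENNReal.ofReal_lt_top

lemma StepFunction.memLp_phiLift (s : StepFunction) (hH0 : 0 < H) (hH : H ≤ 1 / 2) :
    MemLp (phiLift s.eval) 2 (phiMeasure H) := by
  rw [s.phiLift_eval]
  exact memLp_finsetSum _ fun j _ => ((memLp_phiLift_initInd hH0 hH _).sub
    (memLp_phiLift_initInd hH0 hH _)).const_mul _

/-- The coefficients of a step function with respect to the functions `initInd t`. -/
def StepFunction.coeff (s : StepFunction) : I →₀ ℝ :=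
  ∑ j ∈ Finset.range s.N,
    s.c j • (Finsupp.single (s.a (j + 1)) (1 : ℝ) - Finsupp.single (s.a j) (1 : ℝ))

lemma StepFunction.linearCombination_coeff (s : StepFunction) {E : Type*} [AddCommGroup E]
    [Module ℝ E] (v : I → E) : Finsupp.linearCombination ℝ v s.coeff =
      ∑ j ∈ Finset.range s.N, s.c j • (v (s.a (j + 1)) - v (s.a j)) := by
  simp [StepFunction.coeff, map_sum]

variable {Ω : Type*} [MeasurableSpace Ω] {P : Measure Ω} {W : I → Ω → ℝ}

lemma IsFBm.memLp_integral (hW : IsFBm P H W) (s : StepFunction) : MemLp (s.integral W) 2 P :=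
  memLp_finsetSum _ fun _ _ => ((hW.memLp _).sub (hW.memLp _)).const_mul _

/-- W(t) and χ_(0,t] have the same mutual distances |t - s|^H, and both vanish at t = 0, so
`norm_linearCombination_eq` applies. Passing to `StepFunction.coeff` handles different partitions
without a common refinement. -/
lemma IsFBm.eLpNorm_integral_sub (hW : IsFBm P H W) (hH0 : 0 < H) (hH : H ≤ 1 / 2)
    (s s' : StepFunction) : eLpNorm (s.integral W - s'.integral W) 2 P =
      eLpNorm (phiLift s.eval - phiLift s'.eval) 2 (phiMeasure H) := by
  have hi := fun t => memLp_phiLift_initInd hH0 hH t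
  have e1 : ∀ s : StepFunction, (hW.memLp_integral s).toLp _ =
      Finsupp.linearCombination ℝ (fun t => (hW.memLp t).toLp _) s.coeff := fun s => by
    rw [s.linearCombination_coeff]
    exact toLp_sum_mul_sub (fun j => hW.memLp (s.a (j + 1))) (fun j => hW.memLp (s.a j)) _
  have e2 : ∀ s : StepFunction, (s.memLp_phiLift hH0 hH).toLp _ =
      Finsupp.linearCombination ℝ (fun t => (hi t).toLp _) s.coeff := fun s => by
    rw [s.linearCombination_coeff, ← toLp_sum_mul_sub (fun j => hi (s.a (j + 1)))
      (fun j => hi (s.a j)) (by rw [← s.phiLift_eval]; exact s.memLp_phiLift hH0 hH)]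
    congr 1
    exact s.phiLift_eval
  rw [eLpNorm_eq_ofReal_norm_toLp ((hW.memLp_integral s).sub (hW.memLp_integral s')),
    eLpNorm_eq_ofReal_norm_toLp ((s.memLp_phiLift hH0 hH).sub (s'.memLp_phiLift hH0 hH)),
    MemLp.toLp_sub (hW.memLp_integral s) (hW.memLp_integral s'),
    MemLp.toLp_sub (s.memLp_phiLift hH0 hH) (s'.memLp_phiLift hH0 hH), e1, e1, e2, e2,
    ← map_sub, ← map_sub]
  congr 1
  refine norm_linearCombination_eq (i₀ := 0) ?_ ?_ (fun t r => ?_) _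
  · rw [← norm_eq_zero, ← sq_eq_zero_iff, norm_toLp_sq]
    simp only [sq]
    rw [hW.covariance]
    simp [hH0.ne']
  · rw [← norm_eq_zero, ← sq_eq_zero_iff, norm_toLp_sq]
    simp [phiLift_initInd_zero]
  · have h1 := eLpNorm_eq_ofReal_norm_toLp ((hi t).sub (hi r))
    rw [eLpNorm_phiLift_initInd_sub hH0 hH r t, MemLp.toLp_sub (hi t),
      ENNReal.ofReal_eq_ofReal_iff (by positivity) (norm_nonneg _)] at h1
    rw [hW.norm_toLp_sub hH0, h1]

lemma tendsto_zero_of_sq {a : ℕ → ℝ≥0∞} (h : Tendsto (fun k => a k ^ 2) atTop (𝓝 0)) :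
    Tendsto a atTop (𝓝 0) := by
  have := (ENNReal.continuous_rpow_const (y := (1 / 2 : ℝ))).continuousAt.tendsto.comp h
  rw [ENNReal.zero_rpow_of_pos (by norm_num)] at this
  refine this.congr fun k => ?_
  rw [Function.comp_apply, ← ENNReal.rpow_natCast, ← ENNReal.rpow_mul]
  norm_num

lemma tendsto_normSqPhi_sub_iff {φ : ℝ → ℝ} (hφ : Measurable φ) (s : ℕ → StepFunction) :
    Tendsto (fun k => normSqPhi H fun x => φ x - (s k).eval x) atTop (𝓝 0) ↔
      Tendsto (fun k => eLpNorm (phiLift φ - phiLift (s k).eval) 2 (phiMeasure H)) atTop (𝓝 0) := by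
  have e : ∀ k, normSqPhi H (fun x => φ x - (s k).eval x) =
      eLpNorm (phiLift φ - phiLift (s k).eval) 2 (phiMeasure H) ^ 2 := fun k => by
    rw [← phiLift_sub, eLpNorm_phiLift_sq (φ := fun x => φ x - (s k).eval x)
      (hφ.sub (s k).measurable_eval)]
  simp only [e]
  refine ⟨tendsto_zero_of_sq, fun h => ?_⟩
  simpa using ENNReal.Tendsto.pow (n := 2) h

/-- The stochastic integral is well defined. -/
lemma IsFBm.integral_unique (hW : IsFBm P H W) (hH0 : 0 < H) (hH : H ≤ 1 / 2) {φ : ℝ → ℝ}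
    (hφ : Measurable φ) {Z Z' : Ω → ℝ} (hZ : IsFBmIntegral P H W φ Z)
    (hZ' : IsFBmIntegral P H W φ Z') : Z =ᵐ[P] Z' := by
  obtain ⟨-, hZm, s, hs, hsZ⟩ := hZ
  obtain ⟨-, hZm', s', hs', hsZ'⟩ := hZ'
  rw [tendsto_normSqPhi_sub_iff hφ] at hs hs'
  have ham : ∀ s : StepFunction, AEStronglyMeasurable (phiLift s.eval) (phiMeasure H) :=
    fun s => (measurable_phiLift s.measurable_eval).aestronglyMeasurable
  have hφm : AEStronglyMeasurable (phiLift φ) (phiMeasure H) :=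
    (measurable_phiLift hφ).aestronglyMeasurable
  have hle : ∀ k, eLpNorm (Z - Z') 2 P ≤
      eLpNorm (fun ω => (s k).integral W ω - Z ω) 2 P +
        (eLpNorm (phiLift φ - phiLift (s k).eval) 2 (phiMeasure H) +
          eLpNorm (phiLift φ - phiLift (s' k).eval) 2 (phiMeasure H)) +
        eLpNorm (fun ω => (s' k).integral W ω - Z' ω) 2 P := by
    intro k
    have m1 := (hW.memLp_integral (s k)).sub hZm
    have m2 := (hW.memLp_integral (s' k)).sub hZm'
    have m3 := (hW.memLp_integral (s k)).sub (hW.memLp_integral (s' k))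
    have e1 : Z - Z' = -((s k).integral W - Z) + ((s k).integral W - (s' k).integral W) +
        ((s' k).integral W - Z') := by abel
    have e2 : phiLift (s k).eval - phiLift (s' k).eval =
        -(phiLift φ - phiLift (s k).eval) + (phiLift φ - phiLift (s' k).eval) := by abel
    have h1 : eLpNorm ((s k).integral W - (s' k).integral W) 2 P ≤
        eLpNorm (phiLift φ - phiLift (s k).eval) 2 (phiMeasure H) +
          eLpNorm (phiLift φ - phiLift (s' k).eval) 2 (phiMeasure H) := by
      rw [hW.eLpNorm_integral_sub hH0 hH, e2]
      refine (eLpNorm_add_le (hφm.sub (ham _)).neg (hφm.sub (ham _)) (by norm_num)).trans ?_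
      rw [eLpNorm_neg]
    rw [e1]
    refine (eLpNorm_add_le (m1.neg.add m3).1 m2.1 (by norm_num)).trans ?_
    refine add_le_add ((eLpNorm_add_le m1.neg.1 m3.1 (by norm_num)).trans ?_) le_rfl
    rw [eLpNorm_neg]
    exact add_le_add le_rfl h1
  have h0 : eLpNorm (Z - Z') 2 P ≤ 0 := by
    refine ge_of_tendsto' (x := atTop) ?_ hle
    simpa using (hsZ.add (hs.add hs')).add hsZ'
  have h1 := (eLpNorm_eq_zero_iff (hZm.sub hZm').1 (by norm_num)).1 (le_antisymm h0 zero_le)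
  filter_upwards [h1] with ω hω
  exact sub_eq_zero.1 hω

end Isometry

/-! ### The stochastic integral of the Green function -/

section NoiseIntegral

variable {Ω : Type*} [MeasurableSpace Ω] {P : Measure Ω} {H : ℝ} {W : I → Ω → ℝ} {n : ℕ → ℕ}

lemma integral_cellFun {n i : ℕ} (hn : 0 < n) (hi : i < n) : ∫ t, cellFun n i t ∂volD = 1 := by
  have hn' : (0 : ℝ) < n := Nat.cast_pos.2 hn
  have h1 : (((i + 1 : ℕ) : ℝ) / n) ≤ 1 := (div_le_one hn').2 (by exact_mod_cast hi)
  have h2 : (i : ℝ) / n ≤ ((i + 1 : ℕ) : ℝ) / n := by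
    gcongr; exact Nat.le_succ i
  rw [integral_volD, cellFun, integral_indicator_Ioc (by positivity) h2 zero_le_one,
    min_eq_right h1, min_eq_right (h2.trans h1)]
  push_cast
  field_simp
  ring

/-- The Green operator applied to a cell function is the mean of G(x,·) over that cell, and G(x,·)
is 1-Lipschitz. -/
lemma abs_greenOp_cellFun_sub_le {n i : ℕ} (hn : 0 < n) (hi : i < n) {x y : ℝ}
    (hx : x ∈ Icc (0 : ℝ) 1) (hy : y ∈ Ioc ((i : ℝ) / n) (((i + 1 : ℕ) : ℝ) / n)) :
    |greenOp (cellFun n i) x - green x y| ≤ 1 / n := by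
  have hn' : (0 : ℝ) < n := Nat.cast_pos.2 hn
  have hc := integrable_cellFun n i
  have hgc : Integrable (fun t => green x t * cellFun n i t) volD := integrable_green_mul hc hx
  have h0 : ∀ t, 0 ≤ cellFun n i t := fun t => indicator_nonneg (fun _ _ => by positivity) t
  have e : greenOp (cellFun n i) x - green x y =
      ∫ t, (green x t - green x y) * cellFun n i t ∂volD := by
    simp only [sub_mul]
    rw [integral_sub hgc (hc.const_mul _), integral_const_mul, integral_cellFun hn hi, mul_one]
    rfl
  have h1 : ∫ t, 1 / (n : ℝ) * cellFun n i t ∂volD = 1 / n := by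
    rw [integral_const_mul, integral_cellFun hn hi, mul_one]
  rw [e, ← Real.norm_eq_abs, ← h1]
  refine norm_integral_le_of_norm_le (hc.const_mul _) (Eventually.of_forall fun t => ?_)
  rw [norm_mul, Real.norm_eq_abs, Real.norm_eq_abs, abs_of_nonneg (h0 t)]
  by_cases ht : t ∈ Ioc ((i : ℝ) / n) (((i + 1 : ℕ) : ℝ) / n)
  · refine mul_le_mul_of_nonneg_right ((lipschitz_green x hx t y).trans ?_) (h0 t)
    have e2 : ((i + 1 : ℕ) : ℝ) / n = i / n + 1 / n := by push_cast; ring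
    rw [e2] at ht hy
    rw [abs_le]
    constructor <;> linarith [ht.1, ht.2, hy.1, hy.2]
  · rw [cellFun, indicator_of_notMem ht, mul_zero, mul_zero]

/-- The step function of the cell averages of `green x`. -/
def greenStep (n : ℕ) (hn : 0 < n) (x : ℝ) : StepFunction where
  N := n
  pos := hn
  a := gridPoint n
  c j := greenOp (cellFun n j) x
  a_zero := by
    apply Subtype.ext
    rw [coe_gridPoint (Nat.zero_le n) hn]
    simp
  a_last := by
    apply Subtype.ext
    rw [coe_gridPoint le_rfl hn, div_self (Nat.cast_ne_zero.2 hn.ne')]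
    rfl
  a_lt j hj := by
    rw [← Subtype.coe_lt_coe, coe_gridPoint hj.le hn, coe_gridPoint hj hn]
    have : (0 : ℝ) < n := Nat.cast_pos.2 hn
    gcongr
    exact Nat.lt_succ_self j

omit [MeasurableSpace Ω] in
lemma greenStep_integral (hn : ∀ k, 0 < n k) (k : ℕ) {x : ℝ} (hx : x ∈ Icc (0 : ℝ) 1) :
    (greenStep (n k) (hn k) x).integral W = noiseConv W (n k) x := by
  ext ω
  exact (noiseConv_eq (hn k) hx ω).symm

lemma abs_greenStep_eval_sub_le {n : ℕ} (hn : 0 < n) {x y : ℝ} (hx : x ∈ Icc (0 : ℝ) 1)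
    (hy : y ∈ Ioc (0 : ℝ) 1) : |(greenStep n hn x).eval y - green x y| ≤ 1 / n := by
  set s := greenStep n hn x with hs
  have h1 : ∑ j ∈ Finset.range n, (initInd (s.a (j + 1)) y - initInd (s.a j) y) = 1 := by
    rw [Finset.sum_range_sub (fun j => initInd (s.a j) y)]
    have e0 : s.a 0 = 0 := s.a_zero
    have e1 : s.a n = 1 := s.a_last
    rw [e0, e1, initInd, initInd, indicator_of_mem (by simpa using hy)]
    simp
  have h2 : s.eval y - green x y = ∑ j ∈ Finset.range n,
      (greenOp (cellFun n j) x - green x y) * (initInd (s.a (j + 1)) y - initInd (s.a j) y) := by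
    simp only [sub_mul _ (green x y), Finset.sum_sub_distrib, ← Finset.mul_sum, h1, mul_one]
    rw [s.eval_eq]
    rfl
  have h3 : ∑ j ∈ Finset.range n, 1 / (n : ℝ) * (initInd (s.a (j + 1)) y - initInd (s.a j) y) =
      1 / n := by rw [← Finset.mul_sum, h1, mul_one]
  rw [h2, ← h3]
  refine (Finset.abs_sum_le_sum_abs _ _).trans (Finset.sum_le_sum fun j hj => ?_)
  have hj' := Finset.mem_range.1 hj
  rw [initInd_sub (s.a_lt j hj').le, abs_mul]
  by_cases h : y ∈ Ioc (s.a j : ℝ) (s.a (j + 1))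
  · rw [indicator_of_mem h, abs_one]
    refine mul_le_mul_of_nonneg_right (abs_greenOp_cellFun_sub_le hn hj' hx ?_) zero_le_one
    have ej : (s.a j : ℝ) = j / n := coe_gridPoint hj'.le hn
    have ej' : (s.a (j + 1) : ℝ) = ((j + 1 : ℕ) : ℝ) / n := coe_gridPoint hj' hn
    rwa [← ej, ← ej']
  · rw [indicator_of_notMem h, abs_zero, mul_zero, mul_zero]

lemma ae_phiMeasure {H : ℝ} {p : (ℝ × ℝ) ⊕ ℝ → Prop} (hp : MeasurableSet {q | p q})
    (h1 : ∀ x ∈ Ioo (0 : ℝ) 1, ∀ y ∈ Ioo (0 : ℝ) 1, p (Sum.inl (x, y)))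
    (h2 : ∀ x ∈ Ioo (0 : ℝ) 1, p (Sum.inr x)) : ∀ᵐ q ∂(phiMeasure H), p q := by
  rw [phiMeasure, ae_add_measure_iff]
  constructor
  · rw [ae_map_iff measurable_inl.aemeasurable hp]
    refine Measure.ae_smul_measure ((withDensity_absolutelyContinuous _ _).ae_le ?_) _
    rw [Measure.prod_restrict]
    refine (ae_restrict_iff' (measurableSet_Ioo.prod measurableSet_Ioo)).2
      (Eventually.of_forall fun q hq => h1 _ hq.1 _ hq.2)
  · rw [ae_map_iff measurable_inr.aemeasurable hp]
    exact Measure.ae_smul_measure ((withDensity_absolutelyContinuous _ _).ae_le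
      (ae_volD_of_forall h2)) _

/-- No Φ^H norm of G(x,·) is computed. The step functions of cell averages have the convergent
variables `noiseConv` as integrals, hence are Cauchy in Φ^H by the isometry. They also converge
pointwise to G(x,·), and Fatou's lemma turns the Cauchy property into convergence. -/
lemma IsFBm.isFBmIntegral_noiseField (hW : IsFBm P H W) (hH0 : 0 < H) (hH : H ≤ 1 / 2)
    (hn : ∀ k, 0 < n k ∧ 4 * (1 / (n k : ℝ)) ^ H ≤ (1 / 2) ^ (k + 2)) {x : ℝ}
    (hx : x ∈ Icc (0 : ℝ) 1) : IsFBmIntegral P H W (green x) (noiseField W n x) := by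
  have hn0 := fun k => (hn k).1
  set s : ℕ → StepFunction := fun k => greenStep (n k) (hn0 k) x with hs
  have hg : Measurable (green x) := (continuous_green_right x).measurable
  have hIs : ∀ k, (s k).integral W = noiseConv W (n k) x := fun k => greenStep_integral hn0 k hx
  have hI : ∀ k, eLpNorm (fun ω => (s k).integral W ω - noiseField W n x ω) 2 P ≤
      ENNReal.ofReal ((1 / 2) ^ (k + 2)) := fun k => by
    rw [hIs]
    exact (hW.eLpNorm_noiseConv_sub_le hH0 hn (hn0 k) hx).trans
      (ENNReal.ofReal_le_ofReal (hn k).2)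
  have hpow : Tendsto (fun k : ℕ => (1 / 2 : ℝ) ^ (k + 2)) atTop (𝓝 0) :=
    (tendsto_pow_atTop_nhds_zero_of_lt_one (r := (1 / 2 : ℝ)) (by norm_num)
      (by norm_num)).comp (tendsto_add_atTop_nat 2)
  have hpow' : Tendsto (fun k : ℕ => ENNReal.ofReal ((1 / 2) ^ (k + 2))) atTop (𝓝 0) := by
    simpa using ENNReal.tendsto_ofReal hpow
  have hZ := hW.memLp_noiseField hH0 hn hx
  refine ⟨hg.aemeasurable, hZ, s, ?_,
    tendsto_of_tendsto_of_tendsto_of_le_of_le tendsto_const_nhds hpow' (fun _ => zero_le) hI⟩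
  have hev : ∀ y ∈ Ioo (0 : ℝ) 1, Tendsto (fun k => (s k).eval y) atTop (𝓝 (green x y)) := by
    intro y hy
    have hninv : Tendsto (fun k => 1 / (n k : ℝ)) atTop (𝓝 0) := by
      have h1 := hpow.rpow_const (p := 1 / H) (Or.inr (by positivity))
      rw [Real.zero_rpow (by positivity)] at h1
      refine squeeze_zero (fun _ => by positivity) (fun k => ?_) h1
      have h2 : (1 / (n k : ℝ)) ^ H ≤ (1 / 2) ^ (k + 2) :=
        le_trans (le_mul_of_one_le_left (by positivity) (by norm_num)) (hn k).2
      have h3 := Real.rpow_le_rpow (z := 1 / H) (by positivity) h2 (by positivity)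
      rwa [← Real.rpow_mul (by positivity), mul_one_div_cancel hH0.ne', Real.rpow_one] at h3
    rw [tendsto_iff_norm_sub_tendsto_zero]
    exact squeeze_zero (fun _ => norm_nonneg _)
      (fun k => abs_greenStep_eval_sub_le (hn0 k) hx ⟨hy.1, hy.2.le⟩) hninv
  rw [tendsto_normSqPhi_sub_iff hg]
  have hm : ∀ k, Measurable (phiLift (s k).eval) := fun k => measurable_phiLift (s k).measurable_eval
  have hlim : ∀ᵐ q ∂(phiMeasure H), Tendsto (fun m => phiLift (s m).eval q) atTop
      (𝓝 (phiLift (green x) q)) := by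
    refine ae_phiMeasure (measurableSet_tendsto_fun hm (measurable_phiLift hg)) ?_ ?_
    · exact fun y hy y' hy' => (hev y hy).sub (hev y' hy')
    · exact hev
  have hle : ∀ k, eLpNorm (phiLift (green x) - phiLift (s k).eval) 2 (phiMeasure H) ≤
      ENNReal.ofReal ((1 / 2) ^ (k + 2)) + ENNReal.ofReal ((1 / 2) ^ (k + 2)) := by
    intro k
    refine (Lp.eLpNorm_lim_le_liminf_eLpNorm
      (f := fun m => phiLift (s m).eval - phiLift (s k).eval)
      (fun m => ((hm m).sub (hm k)).aestronglyMeasurable) _ ?_).trans ?_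
    · filter_upwards [hlim] with q hq
      exact hq.sub tendsto_const_nhds
    · refine liminf_le_of_frequently_le' (Eventually.frequently ?_)
      filter_upwards [eventually_ge_atTop k] with m hmk
      rw [← hW.eLpNorm_integral_sub hH0 hH]
      have e : (s m).integral W - (s k).integral W = ((s m).integral W - noiseField W n x) +
          -((s k).integral W - noiseField W n x) := by abel
      have m1 := fun k => (hW.memLp_integral (s k)).sub hZ
      rw [e]
      refine (eLpNorm_add_le (m1 m).1 (m1 k).neg.1 (by norm_num)).trans ?_
      rw [eLpNorm_neg]
      refine add_le_add ((hI m).trans (ENNReal.ofReal_le_ofReal ?_)) (hI k)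
      exact pow_le_pow_of_le_one (by norm_num) (by norm_num) (by omega)
  refine tendsto_of_tendsto_of_tendsto_of_le_of_le tendsto_const_nhds ?_ (fun _ => zero_le) hle
  simpa using hpow'.add hpow'

end NoiseIntegral

/-! ### Extension by zero outside D -/

section Extension

/-- Extension by zero of a field over `D = (0,1)`. -/
def extendD {α : Type*} (u : ℝ → α → ℝ) (x : ℝ) (a : α) : ℝ :=
  open Classical in if x ∈ Ioo (0 : ℝ) 1 then u x a else 0

lemma extendD_of_mem {α : Type*} {u : ℝ → α → ℝ} {x : ℝ} (hx : x ∈ Ioo (0 : ℝ) 1) :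
    extendD u x = u x := by
  ext a; rw [extendD, if_pos hx]

lemma extendD_of_notMem {α : Type*} {u : ℝ → α → ℝ} {x : ℝ} (hx : x ∉ Ioo (0 : ℝ) 1) :
    extendD u x = 0 := by
  ext a; rw [extendD, if_neg hx]; rfl

lemma measurable_extendD {α : Type*} [MeasurableSpace α] {u : ℝ → α → ℝ}
    (hu : Measurable fun p : Ioo (0 : ℝ) 1 × α => u p.1 p.2) :
    Measurable fun p : ℝ × α => extendD u p.1 p.2 := by
  have hs : MeasurableSet (Prod.fst ⁻¹' Ioo (0 : ℝ) 1 : Set (ℝ × α)) :=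
    measurable_fst measurableSet_Ioo
  refine measurable_of_restrict_of_restrict_compl hs ?_ ?_
  · have h1 : Measurable fun q : (Prod.fst ⁻¹' Ioo (0 : ℝ) 1 : Set (ℝ × α)) =>
        ((⟨q.1.1, q.2⟩, q.1.2) : Ioo (0 : ℝ) 1 × α) :=
      (Measurable.subtype_mk (measurable_fst.comp measurable_subtype_coe)).prodMk
        (measurable_snd.comp measurable_subtype_coe)
    convert hu.comp h1 using 1
    ext q
    exact congrFun (extendD_of_mem q.2) _
  · convert measurable_const (a := (0 : ℝ)) using 1
    ext q
    exact congrFun (extendD_of_notMem q.2) _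

lemma isMeasurableField_of_measurable {Ω : Type*} {m : MeasurableSpace Ω} {u : ℝ → Ω → ℝ}
    (hu : Measurable fun p : ℝ × Ω => u p.1 p.2) : IsMeasurableField m u :=
  hu.comp ((measurable_subtype_coe.comp measurable_fst).prodMk measurable_snd)

lemma IsMeasurableField.measurable_extendD {Ω : Type*} {m m0 : MeasurableSpace Ω} (hm : m ≤ m0)
    {u : ℝ → Ω → ℝ} (hu : IsMeasurableField m u) :
    Measurable fun p : ℝ × Ω => extendD u p.1 p.2 :=
  FBmBVP.measurable_extendD
    (hu.comp (measurable_fst.prodMk ((measurable_id'' hm).comp measurable_snd)))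

/-- The zero function satisfies both structural bounds, as L and β are positive, so nothing is lost
in passing from D to ℝ. -/
lemma isNonlinearity_extendD {f : ℝ → ℝ → ℝ}
    (hf_meas : Measurable (fun p : Ioo (0 : ℝ) 1 × ℝ => f p.1 p.2))
    (hf_zero : MemLp (fun x => f x 0) 2 volD) {L β : ℝ} (hL : 0 < L) (hβ : 0 < β)
    (hf_mono : ∀ x ∈ Ioo (0 : ℝ) 1, ∀ r s : ℝ, (f x r - f x s) * (r - s) ≥ -L * |r - s| ^ 2)
    (hf_growth : ∀ x ∈ Ioo (0 : ℝ) 1, ∀ r s : ℝ, |f x r - f x s| ≤ β * (1 + |r - s|)) :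
    IsNonlinearity (extendD f) L β where
  measurable := measurable_extendD hf_meas
  zero := hf_zero.ae_eq (ae_volD_of_forall fun x hx => by
    beta_reduce; rw [extendD_of_mem hx])
  L_pos := hL
  β_pos := hβ
  mono x r s := by
    by_cases hx : x ∈ Ioo (0 : ℝ) 1
    · rw [extendD_of_mem hx, ← sq_abs]; exact hf_mono x hx r s
    · rw [extendD_of_notMem hx]
      simp only [Pi.zero_apply, sub_self, zero_mul, ge_iff_le]
      nlinarith [sq_nonneg (r - s)]
  growth x r s := by
    by_cases hx : x ∈ Ioo (0 : ℝ) 1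
    · rw [extendD_of_mem hx]; exact hf_growth x hx r s
    · rw [extendD_of_notMem hx]
      simp only [Pi.zero_apply, sub_self, abs_zero]
      positivity

lemma measurable_greenOp {m : ℝ → ℝ} (hm : AEStronglyMeasurable m volD) :
    Measurable (greenOp m) := by
  rw [show greenOp m = greenOp (hm.mk m) from funext (greenOp_congr hm.ae_eq_mk)]
  exact (measurable_greenField (Ω := Unit) (h := fun p => hm.mk m p.1)
    (hm.stronglyMeasurable_mk.measurable.comp measurable_fst)).comp
      (measurable_id.prodMk measurable_const : Measurable fun x : ℝ => (x, ()))

end Extension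

/-! ### Stability of random solutions -/

section Stability

variable {f : ℝ → ℝ → ℝ} {γ L β : ℝ}

lemma greenOp_comp_congr {u v : ℝ → ℝ} (h : u =ᵐ[volD] v) (x : ℝ) :
    greenOp (fun y => f y (u y)) x = greenOp (fun y => f y (v y)) x :=
  greenOp_congr (h.mono fun y hy => by simp only [hy]) x

variable {Ω : Type*} [MeasurableSpace Ω] {P : Measure Ω} [IsProbabilityMeasure P]

omit [IsProbabilityMeasure P] in
lemma eLpNorm_prod_le [SFinite P] {F : ℝ × Ω → ℝ} (hF : Measurable F) {C : ℝ≥0∞}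
    (hC : ∀ x ∈ Ioo (0 : ℝ) 1, eLpNorm (fun ω => F (x, ω)) 2 P ≤ C) :
    eLpNorm F 2 (volD.prod P) ≤ C := by
  have h1 : eLpNorm F 2 (volD.prod P) ^ 2 ≤ C ^ 2 := by
    rw [eLpNorm_two_sq, lintegral_prod _ (by fun_prop)]
    calc ∫⁻ x, ∫⁻ ω, ENNReal.ofReal (F (x, ω) ^ 2) ∂P ∂volD
        ≤ ∫⁻ x, C ^ 2 ∂volD := by
          refine lintegral_mono_ae (ae_volD_of_forall fun x hx => ?_)
          rw [← eLpNorm_two_sq (fun ω => F (x, ω))]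
          exact ENNReal.pow_le_pow_left (hC x hx)
      _ = C ^ 2 := by simp
  exact (ENNReal.pow_right_strictMono two_ne_zero).le_iff_le.1 h1

/-- `u + K f(u) = z` for almost every path. -/
def IsPathSolution (P : Measure Ω) (f : ℝ → ℝ → ℝ) (z u : ℝ → Ω → ℝ) : Prop :=
  ∀ᵐ ω ∂P, MemLp (fun x => u x ω) 2 volD ∧
    ∀ᵐ x ∂volD, u x ω + greenOp (fun y => f y (u y ω)) x = z x ω

lemma IsNonlinearity.ae_eq_of_isPathSolution (hf : IsNonlinearity f L β)
    (hγ : IsPoincareConstant γ) (hLγ : L < γ) {z u v : ℝ → Ω → ℝ}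
    (hz : MemLp (fun p : ℝ × Ω => z p.1 p.2) 2 (volD.prod P)) (hu : IsPathSolution P f z u)
    (hv : IsPathSolution P f z v) : ∀ᵐ ω ∂P, (fun x => u x ω) =ᵐ[volD] fun x => v x ω := by
  filter_upwards [hu, hv, ae_memLp_section hz] with ω h1 h2 h3
  exact hf.unique hγ hLγ h1.1 h2.1 h3 h1.2 h2.2

/-- The pathwise stability estimate is integrated over Ω; on a probability space the L¹ norm is at
most the L² norm. -/
lemma IsNonlinearity.eLpNorm_sub_sq_le (hf : IsNonlinearity f L β)
    (hγ : IsPoincareConstant γ) (hLγ : L < γ) {z w u v : ℝ → Ω → ℝ}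
    (hz : MemLp (fun p : ℝ × Ω => z p.1 p.2) 2 (volD.prod P))
    (hw : MemLp (fun p : ℝ × Ω => w p.1 p.2) 2 (volD.prod P))
    (hum : AEStronglyMeasurable (fun p : ℝ × Ω => u p.1 p.2) (volD.prod P))
    (hvm : AEStronglyMeasurable (fun p : ℝ × Ω => v p.1 p.2) (volD.prod P))
    (hu : IsPathSolution P f z u) (hv : IsPathSolution P f w v) :
    eLpNorm (fun p : ℝ × Ω => u p.1 p.2 - v p.1 p.2) 2 (volD.prod P) ^ 2 ≤
      ENNReal.ofReal (((2 * γ + β) / (γ - L)) ^ 2) *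
          eLpNorm (fun p : ℝ × Ω => z p.1 p.2 - w p.1 p.2) 2 (volD.prod P) ^ 2 +
        ENNReal.ofReal (2 * β / (γ - L)) *
          eLpNorm (fun p : ℝ × Ω => z p.1 p.2 - w p.1 p.2) 2 (volD.prod P) := by
  have hβ := hf.β_pos
  have hd : 0 < γ - L := sub_pos.2 hLγ
  have hm1 : AEMeasurable (fun p : ℝ × Ω => ENNReal.ofReal ((u p.1 p.2 - v p.1 p.2) ^ 2))
      (volD.prod P) := ((hum.sub hvm).aemeasurable.pow_const 2).ennreal_ofReal
  have hm2 : AEMeasurable (fun p : ℝ × Ω => ENNReal.ofReal ((z p.1 p.2 - w p.1 p.2) ^ 2))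
      (volD.prod P) := ((hz.sub hw).1.aemeasurable.pow_const 2).ennreal_ofReal
  have hm3 : AEMeasurable (fun p : ℝ × Ω => ‖z p.1 p.2 - w p.1 p.2‖ₑ) (volD.prod P) :=
    (hz.sub hw).1.aemeasurable.enorm
  have h1 : eLpNorm (fun p : ℝ × Ω => z p.1 p.2 - w p.1 p.2) 1 (volD.prod P) ≤
      eLpNorm (fun p : ℝ × Ω => z p.1 p.2 - w p.1 p.2) 2 (volD.prod P) :=
    eLpNorm_le_eLpNorm_of_exponent_le (by norm_num) (hz.sub hw).1
  refine le_trans ?_ (add_le_add le_rfl (mul_le_mul_right h1 _))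
  rw [eLpNorm_two_sq, eLpNorm_two_sq, eLpNorm_one_eq_lintegral_enorm,
    lintegral_prod_symm _ hm1, lintegral_prod_symm _ hm2, lintegral_prod_symm _ hm3,
    ← lintegral_const_mul' _ _ ENNReal.ofReal_ne_top,
    ← lintegral_const_mul' _ _ ENNReal.ofReal_ne_top,
    ← lintegral_add_left' (hm2.lintegral_prod_left'.const_mul _)]
  refine lintegral_mono_ae ?_
  filter_upwards [hu, hv, ae_memLp_section hz, ae_memLp_section hw] with ω a1 a2 a3 a4
  have hst := hf.stability hγ hLγ a1.1 a2.1 a3 a4 a1.2 a2.2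
  have i1 : Integrable (fun x => (u x ω - v x ω) ^ 2) volD := (a1.1.sub a2.1).integrable_sq
  have i2 : Integrable (fun x => (z x ω - w x ω) ^ 2) volD := (a3.sub a4).integrable_sq
  have i3 : Integrable (fun x => z x ω - w x ω) volD := (a3.sub a4).integrable (by norm_num)
  calc ∫⁻ x, ENNReal.ofReal ((u x ω - v x ω) ^ 2) ∂volD
      = ENNReal.ofReal (∫ x, (u x ω - v x ω) ^ 2 ∂volD) :=
        (ofReal_integral_eq_lintegral_ofReal i1
          (Eventually.of_forall fun x => sq_nonneg _)).symm
    _ ≤ _ := ENNReal.ofReal_le_ofReal hst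
    _ = _ := by
        rw [ENNReal.ofReal_add (mul_nonneg (by positivity)
            (integral_nonneg fun x => sq_nonneg _))
          (mul_nonneg (by positivity) (integral_nonneg fun x => abs_nonneg _)),
          ENNReal.ofReal_mul (by positivity), ENNReal.ofReal_mul (by positivity),
          ofReal_integral_eq_lintegral_ofReal i2 (Eventually.of_forall fun x => sq_nonneg _),
          ofReal_integral_eq_lintegral_ofReal i3.abs (Eventually.of_forall fun x => abs_nonneg _)]
        simp only [Real.enorm_eq_ofReal_abs]

/-- Comparison with the zero function, which solves the equation with right-hand side K f(·,0). -/
lemma IsNonlinearity.memLp_of_isPathSolution (hf : IsNonlinearity f L β)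
    (hγ : IsPoincareConstant γ) (hLγ : L < γ) {z u : ℝ → Ω → ℝ}
    (hz : MemLp (fun p : ℝ × Ω => z p.1 p.2) 2 (volD.prod P))
    (hum : AEStronglyMeasurable (fun p : ℝ × Ω => u p.1 p.2) (volD.prod P))
    (hu : IsPathSolution P f z u) : MemLp (fun p : ℝ × Ω => u p.1 p.2) 2 (volD.prod P) := by
  have h0 : IsPathSolution P f (fun x _ => greenOp (fun y => f y 0) x) fun _ _ => 0 :=
    Eventually.of_forall fun ω => ⟨MemLp.zero, Eventually.of_forall fun x => by simp⟩
  have hw : MemLp (fun p : ℝ × Ω => greenOp (fun y => f y 0) p.1) 2 (volD.prod P) :=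
    (memLp_greenOp (hf.zero.integrable (by norm_num)) 2).comp_fst P
  have h1 := hf.eLpNorm_sub_sq_le hγ hLγ hz hw hum aestronglyMeasurable_const hu h0
  simp only [sub_zero] at h1
  refine ⟨hum, ?_⟩
  have h2 := (hz.sub hw).2
  have h3 := h1.trans_lt (ENNReal.add_lt_top.2 ⟨ENNReal.mul_lt_top ENNReal.ofReal_lt_top
    (ENNReal.pow_lt_top h2), ENNReal.mul_lt_top ENNReal.ofReal_lt_top h2⟩)
  exact (ENNReal.pow_lt_top_iff.1 h3).resolve_right (by norm_num)

lemma IsNonlinearity.tendsto_of_isPathSolution (hf : IsNonlinearity f L β)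
    (hγ : IsPoincareConstant γ) (hLγ : L < γ) {z u : ℝ → Ω → ℝ} {zn un : ℕ → ℝ → Ω → ℝ}
    (hz : MemLp (fun p : ℝ × Ω => z p.1 p.2) 2 (volD.prod P))
    (hum : AEStronglyMeasurable (fun p : ℝ × Ω => u p.1 p.2) (volD.prod P))
    (hu : IsPathSolution P f z u)
    (hzn : ∀ᶠ n in atTop, MemLp (fun p : ℝ × Ω => zn n p.1 p.2) 2 (volD.prod P))
    (hunm : ∀ᶠ n in atTop, AEStronglyMeasurable (fun p : ℝ × Ω => un n p.1 p.2) (volD.prod P))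
    (hun : ∀ᶠ n in atTop, IsPathSolution P f (zn n) (un n))
    (hlim : Tendsto (fun n => eLpNorm (fun p : ℝ × Ω => zn n p.1 p.2 - z p.1 p.2) 2 (volD.prod P))
      atTop (𝓝 0)) :
    Tendsto (fun n => eLpNorm (fun p : ℝ × Ω => un n p.1 p.2 - u p.1 p.2) 2 (volD.prod P))
      atTop (𝓝 0) := by
  have h1 := (ENNReal.Tendsto.const_mul (a := ENNReal.ofReal (((2 * γ + β) / (γ - L)) ^ 2))
    (ENNReal.Tendsto.pow (n := 2) hlim) (Or.inr ENNReal.ofReal_ne_top)).add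
    (ENNReal.Tendsto.const_mul (a := ENNReal.ofReal (2 * β / (γ - L))) hlim
      (Or.inr ENNReal.ofReal_ne_top))
  simp only [ne_eq, OfNat.ofNat_ne_zero, not_false_eq_true, zero_pow, mul_zero, add_zero] at h1
  have h2 : Tendsto (fun n =>
      eLpNorm (fun p : ℝ × Ω => un n p.1 p.2 - u p.1 p.2) 2 (volD.prod P) ^ 2) atTop (𝓝 0) := by
    refine tendsto_of_tendsto_of_tendsto_of_le_of_le' tendsto_const_nhds h1
      (Eventually.of_forall fun _ => zero_le) ?_
    filter_upwards [hzn, hunm, hun] with n a1 a2 a3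
    exact hf.eLpNorm_sub_sq_le hγ hLγ a1 hz a2 hum a3 hu
  exact tendsto_zero_of_sq h2

end Stability

/-! ### Measurability with respect to the data -/

section SubSigmaAlgebra

variable {f : ℝ → ℝ → ℝ} {γ L β : ℝ}

/-- The equation is solved on the target Ω' and the solution is pulled back. With T the identity
onto Ω carrying a smaller σ-algebra, this yields a solution measurable for that σ-algebra. -/
lemma IsNonlinearity.exists_solution_comp {Ω Ω' : Type*} [MeasurableSpace Ω] [MeasurableSpace Ω']
    {P : Measure Ω} [IsProbabilityMeasure P] {P' : Measure Ω'} (hf : IsNonlinearity f L β)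
    (hγ : IsPoincareConstant γ) (hLγ : L < γ) {T : Ω → Ω'} (hT : MeasurePreserving T P P')
    {z : ℝ → Ω' → ℝ} (hz : Measurable fun p : ℝ × Ω' => z p.1 p.2)
    (hz2 : MemLp (fun p : ℝ × Ω => z p.1 (T p.2)) 2 (volD.prod P))
    (h : HasSmallBalls P (fun x ω => z x (T ω)) ∨ ∀ x, Continuous (f x)) :
    ∃ u : ℝ → Ω' → ℝ, (Measurable fun p : ℝ × Ω' => u p.1 p.2) ∧
      MemLp (fun p : ℝ × Ω => u p.1 (T p.2)) 2 (volD.prod P) ∧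
      ∀ᵐ ω ∂P, ∀ x, u x (T ω) + greenOp (fun y => f y (u y (T ω))) x = z x (T ω) := by
  have : IsProbabilityMeasure P' := hT.map_eq ▸ Measure.isProbabilityMeasure_map hT.aemeasurable
  have hTp : MeasurePreserving (Prod.map id T) (volD.prod P) (volD.prod P') :=
    (MeasurePreserving.id volD).prod hT
  have hmem : ∀ {v : ℝ → Ω' → ℝ}, (Measurable fun p : ℝ × Ω' => v p.1 p.2) →
      (MemLp (fun p : ℝ × Ω => v p.1 (T p.2)) 2 (volD.prod P) ↔
        MemLp (fun p : ℝ × Ω' => v p.1 p.2) 2 (volD.prod P')) := fun {v} hv => by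
    rw [← hTp.map_eq, memLp_map_measure_iff (hv.aestronglyMeasurable) hTp.aemeasurable]
    rfl
  obtain ⟨u, hu, hu2, hsol⟩ := hf.exists_solution hγ hLγ hz ((hmem hz).1 hz2)
    (h.imp_left fun h => h.of_comp hT fun x => hz.comp measurable_prodMk_left)
  exact ⟨u, hu, (hmem hu).2 hu2, hT.quasiMeasurePreserving.ae hsol⟩

/-- Solutions can be chosen measurable with respect to the `σ`-algebra generated by the data. -/
lemma IsNonlinearity.exists_solution_of_le {Ω : Type*} {m m0 : MeasurableSpace Ω}
    {P : Measure[m0] Ω} [IsProbabilityMeasure P] (hm : m ≤ m0) (hf : IsNonlinearity f L β)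
    (hγ : IsPoincareConstant γ) (hLγ : L < γ) {z : ℝ → Ω → ℝ}
    (hz : Measurable[borel ℝ |>.prod m] fun p : ℝ × Ω => z p.1 p.2)
    (hz2 : MemLp (fun p : ℝ × Ω => z p.1 p.2) 2 (volD.prod P))
    (h : HasSmallBalls P z ∨ ∀ x, Continuous (f x)) :
    ∃ u : ℝ → Ω → ℝ, (Measurable[(inferInstance : MeasurableSpace ℝ).prod m]
        fun p : ℝ × Ω => u p.1 p.2) ∧
      MemLp (fun p : ℝ × Ω => u p.1 p.2) 2 (volD.prod P) ∧
      ∀ᵐ ω ∂P, ∀ x, u x ω + greenOp (fun y => f y (u y ω)) x = z x ω :=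
  @IsNonlinearity.exists_solution_comp f γ L β Ω Ω m0 m P _ (P.trim hm) hf hγ hLγ id
    (@MeasurePreserving.mk Ω Ω m0 m id P (P.trim hm) (measurable_id'' hm) (trim_eq_map hm).symm) z hz hz2 h

end SubSigmaAlgebra

/-! ### Right-hand sides of the integral equations -/

section Noise

variable {Ω : Type*} [MeasurableSpace Ω] {P : Measure Ω} [IsProbabilityMeasure P]
  {H : ℝ} {W : I → Ω → ℝ} {k : ℕ → ℕ} {g : ℝ → ℝ}

/-- The right-hand side of the integral form of the approximate problem. -/
def approxField (W : I → Ω → ℝ) (g : ℝ → ℝ) (n : ℕ) (x : ℝ) (ω : Ω) : ℝ :=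
  greenOp g x + noiseConv W n x ω

/-- The right-hand side of the mild equation. -/
def mildField (W : I → Ω → ℝ) (g : ℝ → ℝ) (k : ℕ → ℕ) (x : ℝ) (ω : Ω) : ℝ :=
  greenOp g x + noiseField W k x ω

lemma measurable_approxField (hW : ∀ t, Measurable (W t)) (hg : MemLp g 2 volD) (n : ℕ) :
    Measurable fun p : ℝ × Ω => approxField W g n p.1 p.2 :=
  ((measurable_greenOp hg.1).comp measurable_fst).add (measurable_noiseConv hW n)

lemma measurable_mildField (hW : ∀ t, Measurable (W t)) (hg : MemLp g 2 volD) (k : ℕ → ℕ) :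
    Measurable fun p : ℝ × Ω => mildField W g k p.1 p.2 :=
  ((measurable_greenOp hg.1).comp measurable_fst).add (measurable_noiseField hW k)

omit [MeasurableSpace Ω] in
lemma integrable_noiseApprox (n : ℕ) (ω : Ω) : Integrable (fun x => noiseApprox W n x ω) volD :=
  integrable_finsetSum _ fun _ _ => (integrable_const _).indicator measurableSet_Ioc

lemma IsFBm.memLp_noiseApprox (hW : IsFBm P H W) (n : ℕ) :
    MemLp (fun p : ℝ × Ω => noiseApprox W n p.1 p.2) 2 (volD.prod P) := by
  refine memLp_finsetSum _ fun i _ => ?_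
  have h1 : MemLp (fun p : ℝ × Ω =>
      (n : ℝ) * (W (gridPoint n (i + 1)) p.2 - W (gridPoint n i) p.2)) 2 (volD.prod P) :=
    (((hW.memLp _).sub (hW.memLp _)).const_mul _).comp_snd volD
  exact h1.indicator (s := Prod.fst ⁻¹' Ioc _ _) (measurable_fst measurableSet_Ioc)

lemma memLp_greenOp_fst (hg : MemLp g 2 volD) :
    MemLp (fun p : ℝ × Ω => greenOp g p.1) 2 (volD.prod P) :=
  (memLp_greenOp (hg.integrable (by norm_num)) 2).comp_fst P

lemma IsFBm.memLp_noiseConv_prod (hW : IsFBm P H W) (hWm : ∀ t, Measurable (W t)) (n : ℕ) :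
    MemLp (fun p : ℝ × Ω => noiseConv W n p.1 p.2) 2 (volD.prod P) :=
  memLp_greenField (measurable_noiseApprox hWm n) (hW.memLp_noiseApprox n)

lemma IsFBm.eLpNorm_noiseConv_sub_prod_le (hW : IsFBm P H W) (hH : 0 < H)
    (hWm : ∀ t, Measurable (W t))
    (hk : ∀ j, 0 < k j ∧ 4 * (1 / (k j : ℝ)) ^ H ≤ (1 / 2) ^ (j + 2)) {n : ℕ} (hn : 0 < n) :
    eLpNorm (fun p : ℝ × Ω => noiseConv W n p.1 p.2 - noiseField W k p.1 p.2) 2 (volD.prod P) ≤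
      ENNReal.ofReal (4 * (1 / (n : ℝ)) ^ H) :=
  eLpNorm_prod_le ((measurable_noiseConv hWm n).sub (measurable_noiseField hWm k)) fun _ hx =>
    hW.eLpNorm_noiseConv_sub_le hH hk hn (Ioo_subset_Icc_self hx)

lemma IsFBm.memLp_approxField (hW : IsFBm P H W) (hWm : ∀ t, Measurable (W t))
    (hg : MemLp g 2 volD) (n : ℕ) :
    MemLp (fun p : ℝ × Ω => approxField W g n p.1 p.2) 2 (volD.prod P) :=
  (memLp_greenOp_fst hg).add (hW.memLp_noiseConv_prod hWm n)

lemma IsFBm.memLp_mildField (hW : IsFBm P H W) (hH : 0 < H) (hWm : ∀ t, Measurable (W t))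
    (hk : ∀ j, 0 < k j ∧ 4 * (1 / (k j : ℝ)) ^ H ≤ (1 / 2) ^ (j + 2)) (hg : MemLp g 2 volD) :
    MemLp (fun p : ℝ × Ω => mildField W g k p.1 p.2) 2 (volD.prod P) := by
  have h1 : MemLp (fun p : ℝ × Ω => noiseConv W 1 p.1 p.2 - noiseField W k p.1 p.2) 2
      (volD.prod P) :=
    ⟨((measurable_noiseConv hWm 1).sub (measurable_noiseField hWm k)).aestronglyMeasurable,
      (hW.eLpNorm_noiseConv_sub_prod_le hH hWm hk one_pos).trans_lt ENNReal.ofReal_lt_top⟩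
  refine ((hW.memLp_approxField hWm hg 1).sub h1).ae_eq (Eventually.of_forall fun p => ?_)
  simp only [Pi.sub_apply, approxField, mildField]
  ring

lemma IsFBm.tendsto_approxField (hW : IsFBm P H W) (hH : 0 < H) (hWm : ∀ t, Measurable (W t))
    (hk : ∀ j, 0 < k j ∧ 4 * (1 / (k j : ℝ)) ^ H ≤ (1 / 2) ^ (j + 2)) :
    Tendsto (fun n => eLpNorm (fun p : ℝ × Ω => approxField W g n p.1 p.2 -
      mildField W g k p.1 p.2) 2 (volD.prod P)) atTop (𝓝 0) := by
  have h1 : Tendsto (fun n : ℕ => ENNReal.ofReal (4 * (1 / (n : ℝ)) ^ H)) atTop (𝓝 0) := by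
    have := (tendsto_one_div_atTop_nhds_zero_nat (𝕜 := ℝ)).rpow_const (p := H) (Or.inr hH.le)
    rw [Real.zero_rpow hH.ne'] at this
    simpa using ENNReal.tendsto_ofReal (this.const_mul 4)
  refine tendsto_of_tendsto_of_tendsto_of_le_of_le' tendsto_const_nhds h1
    (Eventually.of_forall fun _ => zero_le) ?_
  filter_upwards [eventually_gt_atTop 0] with n hn
  simp only [approxField, mildField, add_sub_add_left_eq_sub]
  exact hW.eLpNorm_noiseConv_sub_prod_le hH hWm hk hn

omit [MeasurableSpace Ω] in
lemma greenOp_add_noiseApprox (hg : MemLp g 2 volD) (n : ℕ) {x : ℝ} (hx : x ∈ Icc (0 : ℝ) 1)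
    (ω : Ω) : greenOp (fun y => g y + noiseApprox W n y ω) x = approxField W g n x ω :=
  greenOp_add (hg.integrable (by norm_num)) (integrable_noiseApprox n ω) hx

end Noise

/-! ### Mild and variational solutions as solutions of the integral equation -/

section Solutions

variable {Ω : Type*} [mΩ : MeasurableSpace Ω] {P : Measure Ω} [IsProbabilityMeasure P]
  {ℱ : Filtration I mΩ} {H : ℝ} {W : I → Ω → ℝ} {k : ℕ → ℕ} {g : ℝ → ℝ} {f : ℝ → ℝ → ℝ}
  {u v : ℝ → Ω → ℝ}

lemma greenOp_extendD (f : ℝ → ℝ → ℝ) (w : ℝ → ℝ) (x : ℝ) :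
    greenOp (fun y => extendD f y (w y)) x = greenOp (fun y => f y (w y)) x :=
  greenOp_congr (ae_volD_of_forall fun y hy => by rw [extendD_of_mem hy]) x

omit [IsProbabilityMeasure P] in
lemma IsMildSolution.ae_eq (hW : IsFBm P H W) (hH0 : 0 < H) (hH : H ≤ 1 / 2)
    (hk : ∀ j, 0 < k j ∧ 4 * (1 / (k j : ℝ)) ^ H ≤ (1 / 2) ^ (j + 2))
    (hv : IsMildSolution P ℱ H W f g v) {x : ℝ} (hx : x ∈ Ioo (0 : ℝ) 1) :
    ∀ᵐ ω ∂P, v x ω + greenOp (fun y => f y (v y ω)) x = mildField W g k x ω := by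
  obtain ⟨-, Z, hZ, hZe⟩ := hv.2 x hx
  filter_upwards [hZe, hW.integral_unique hH0 hH (continuous_green_right x).measurable hZ
    (hW.isFBmIntegral_noiseField hH0 hH hk (Ioo_subset_Icc_self hx))] with ω h1 h2
  rw [h2] at h1
  exact h1

omit [IsProbabilityMeasure P] in
lemma aestronglyMeasurable_of_isMeasurableField (hv : IsMeasurableField (ℱ 1) v) :
    AEStronglyMeasurable (fun p : ℝ × Ω => v p.1 p.2) (volD.prod P) := by
  refine (hv.measurable_extendD (ℱ.le 1)).aestronglyMeasurable.congr ?_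
  filter_upwards [ae_prod_fst ae_mem_volD] with p hp
  rw [extendD_of_mem hp]

/-- The mild equation has a null set depending on x; Fubini, with the jointly measurable noise
field, exchanges it for one exceptional set of paths. Square integrability of the paths then needs
the integrability condition only at x = 1/2. -/
lemma IsMildSolution.isPathSolution (hW : IsFBm P H W) (hH0 : 0 < H) (hH : H ≤ 1 / 2)
    (hWm : ∀ t, Measurable (W t))
    (hk : ∀ j, 0 < k j ∧ 4 * (1 / (k j : ℝ)) ^ H ≤ (1 / 2) ^ (j + 2)) (hg : MemLp g 2 volD)
    (hf : Measurable fun p : ℝ × ℝ => extendD f p.1 p.2) (hv : IsMildSolution P ℱ H W f g v) :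
    IsPathSolution P (extendD f) (mildField W g k) v := by
  have hvm := hv.1.measurable_extendD (ℱ.le 1)
  have e : ∀ ω x, greenField (fun p : ℝ × Ω => extendD f p.1 (extendD v p.1 p.2)) (x, ω) =
      greenOp (fun y => extendD f y (v y ω)) x := fun ω x =>
    greenOp_congr (ae_volD_of_forall fun y hy => by beta_reduce; rw [extendD_of_mem (u := v) hy]) x
  have h1 : ∀ᵐ ω ∂P, ∀ᵐ x ∂volD, extendD v x ω +
      greenField (fun p : ℝ × Ω => extendD f p.1 (extendD v p.1 p.2)) (x, ω) =
        mildField W g k x ω := by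
    rw [← Measure.ae_ae_comm]
    · refine ae_volD_of_forall fun x hx => ?_
      filter_upwards [hv.ae_eq hW hH0 hH hk hx] with ω hω
      rw [e, greenOp_extendD, extendD_of_mem hx, hω]
    · exact measurableSet_eq_fun (hvm.add (measurable_greenField (hf.comp
        (measurable_fst.prodMk hvm)))) (measurable_mildField hWm hg k)
  filter_upwards [h1, ae_memLp_section (hW.memLp_mildField hH0 hWm hk hg),
    (hv.2 (1 / 2) (by norm_num)).1] with ω h1 h2 h3
  have h4 : ∀ᵐ x ∂volD, v x ω + greenOp (fun y => extendD f y (v y ω)) x = mildField W g k x ω := by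
    filter_upwards [h1, ae_mem_volD] with x hx hx'
    rwa [e, extendD_of_mem hx'] at hx
  refine ⟨memLp_of_eq_sub_greenOp ?_ h2 (h := fun y => f y (v y ω)) h3 ?_, h4⟩
  · refine (hvm.comp (measurable_prodMk_right (y := ω))).aestronglyMeasurable.congr
      (ae_volD_of_forall fun x hx => ?_)
    simp only [Function.comp_apply, extendD_of_mem hx]
  · simpa only [greenOp_extendD] using h4

omit [IsProbabilityMeasure P] in
lemma IsApproxSolution.ae_eq (hg : MemLp g 2 volD) {n : ℕ}
    (hv : IsApproxSolution P ℱ W f g n v) :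
    ∀ᵐ ω ∂P, MemLp (fun x => v x ω) 2 volD ∧ ∀ x ∈ Icc (0 : ℝ) 1,
      v x ω + greenOp (fun y => f y (v y ω)) x = approxField W g n x ω := by
  filter_upwards [hv.2] with ω hω
  refine ⟨memLp_of_absolutelyContinuous hω.1.1 2, fun x hx => ?_⟩
  rw [eq_greenOp_of_weak hω.1 hω.2 hx, greenOp_add_noiseApprox hg n hx]

omit [IsProbabilityMeasure P] in
lemma IsApproxSolution.isPathSolution (hg : MemLp g 2 volD) {n : ℕ}
    (hv : IsApproxSolution P ℱ W f g n v) :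
    IsPathSolution P (extendD f) (approxField W g n) v := by
  filter_upwards [hv.ae_eq hg] with ω hω
  refine ⟨hω.1, ae_volD_of_forall fun x hx => ?_⟩
  rw [greenOp_extendD]
  exact hω.2 x (Ioo_subset_Icc_self hx)

/-- Solutions of the integral equation are mild solutions. -/
lemma isMildSolution_of_eq {L β : ℝ} (hW : IsFBm P H W) (hH0 : 0 < H) (hH : H ≤ 1 / 2)
    (hk : ∀ j, 0 < k j ∧ 4 * (1 / (k j : ℝ)) ^ H ≤ (1 / 2) ^ (j + 2))
    (hf : IsNonlinearity (extendD f) L β) (hum : IsMeasurableField (ℱ 1) u)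
    (hu2 : MemLp (fun p : ℝ × Ω => u p.1 p.2) 2 (volD.prod P))
    (hu : ∀ᵐ ω ∂P, ∀ x, u x ω + greenOp (fun y => extendD f y (u y ω)) x = mildField W g k x ω) :
    IsMildSolution P ℱ H W f g u := by
  refine ⟨hum, fun x hx => ⟨?_, noiseField W k x,
    hW.isFBmIntegral_noiseField hH0 hH hk (Ioo_subset_Icc_self hx), ?_⟩⟩
  · filter_upwards [ae_memLp_section hu2] with ω hω
    have h1 := integrable_green_mul ((hf.memLp_comp measurable_id hf.zero hω).integrable
      (by norm_num)) (Ioo_subset_Icc_self hx)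
    refine h1.congr (ae_volD_of_forall fun y hy => ?_)
    simp only [id, extendD_of_mem hy]
  · filter_upwards [hu] with ω hω
    have := hω x
    rw [greenOp_extendD] at this
    exact this

lemma integral_deriv_greenOp_sub_mul {m q φ : ℝ → ℝ} (hm : Integrable m volD)
    (hq : Integrable q volD) (hφ : InH10 φ) :
    ∫ x, deriv (greenOp fun y => m y - q y) x * deriv φ x ∂volD + ∫ x, q x * φ x ∂volD =
      ∫ x, m x * φ x ∂volD := by
  have hmul : ∀ {m : ℝ → ℝ}, Integrable m volD → Integrable (fun x => m x * φ x) volD := by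
    intro m hm
    obtain ⟨C, hC⟩ := hφ.1.exists_bound
    rw [uIcc_of_le zero_le_one] at hC
    exact hm.mul_bdd (memLp_of_absolutelyContinuous hφ.1 2).1
      (ae_volD_of_forall fun x hx => hC x (Ioo_subset_Icc_self hx))
  rw [integral_deriv_greenOp_mul (m := fun y => m y - q y) (hm.sub hq) hφ]
  simp only [sub_mul]
  rw [integral_sub (hmul hm) (hmul hq), sub_add_cancel]

/-- Solutions of the integral equation provide solutions of the approximate problem. -/
lemma exists_isApproxSolution_of_eq {L β : ℝ} (hWm : ∀ t, Measurable[ℱ 1] (W t))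
    (hg : MemLp g 2 volD) (hf : IsNonlinearity (extendD f) L β) {n : ℕ}
    (hum : Measurable[(inferInstance : MeasurableSpace ℝ).prod (ℱ 1)]
      fun p : ℝ × Ω => u p.1 p.2)
    (hu2 : MemLp (fun p : ℝ × Ω => u p.1 p.2) 2 (volD.prod P))
    (hu : ∀ᵐ ω ∂P, ∀ x,
      u x ω + greenOp (fun y => extendD f y (u y ω)) x = approxField W g n x ω) :
    ∃ v : ℝ → Ω → ℝ, IsApproxSolution P ℱ W f g n v := by
  -- A measurable representative of g is needed for the joint measurability of K(g + Ẇⁿ - f(u)).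
  -- This field coincides with u on [0,1] for almost every path, and its paths lie in H¹₀ by
  -- construction.
  obtain ⟨g', hg', hgg'⟩ := hg.1
  let h : ℝ × Ω → ℝ := fun p => g' p.1 + noiseApprox W n p.1 p.2 - extendD f p.1 (u p.1 p.2)
  have hhm : Measurable[(inferInstance : MeasurableSpace ℝ).prod (ℱ 1)] h :=
    ((hg'.measurable.comp measurable_fst).add (@measurable_noiseApprox Ω (ℱ 1) W hWm n)).sub
      (hf.measurable.comp (measurable_fst.prodMk hum))
  have hvm : IsMeasurableField (ℱ 1) fun x ω => greenField h (x, ω) :=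
    isMeasurableField_of_measurable (@measurable_greenField Ω (ℱ 1) h hhm)
  refine ⟨fun x ω => greenField h (x, ω), hvm, ?_⟩
  filter_upwards [hu, ae_memLp_section hu2] with ω h1 h2
  have hfi : Integrable (fun y => extendD f y (u y ω)) volD :=
    (hf.memLp_comp measurable_id hf.zero h2).integrable (by norm_num)
  have hgi : Integrable (fun y => g y + noiseApprox W n y ω) volD :=
    (hg.integrable (by norm_num)).add (integrable_noiseApprox n ω)
  have e : (fun x => greenField h (x, ω)) =
      greenOp fun y => (g y + noiseApprox W n y ω) - extendD f y (u y ω) :=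
    funext fun x => greenOp_congr (hgg'.mono fun y hy => by simp only [h, hy]) x
  have hv : ∀ x ∈ Icc (0 : ℝ) 1,
      greenOp (fun y => (g y + noiseApprox W n y ω) - extendD f y (u y ω)) x = u x ω :=
    fun x hx => by
      rw [greenOp_sub hgi hfi hx, greenOp_add_noiseApprox hg n hx, ← h1 x, add_sub_cancel_right]
  have hq : ∀ φ : ℝ → ℝ, ∫ x, f x (greenOp (fun y => (g y + noiseApprox W n y ω) -
      extendD f y (u y ω)) x) * φ x ∂volD = ∫ x, extendD f x (u x ω) * φ x ∂volD := fun φ =>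
    integral_congr_ae (ae_volD_of_forall fun x hx => by
      beta_reduce; rw [hv x (Ioo_subset_Icc_self hx), extendD_of_mem hx])
  rw [e]
  refine ⟨inH10_greenOp (hgi.sub hfi), fun φ hφ => ?_⟩
  have e' : ∀ x, greenField h (x, ω) = greenOp (fun y => (g y + noiseApprox W n y ω) -
      extendD f y (u y ω)) x := congrFun e
  simp only [e']
  rw [hq]
  exact integral_deriv_greenOp_sub_mul hgi hfi hφ

end Solutions

end FBmBVP

end

/-! ### The theorem -/

theorem mainTheorem3 {Ω : Type*} [mΩ : MeasurableSpace Ω] (P : Measure Ω)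
    [IsProbabilityMeasure P] (ℱ : Filtration I mΩ)
    (H : ℝ) (hH0 : 0 < H) (hH : H ≤ 1 / 2)
    (W : I → Ω → ℝ) (hW : IsFBm P H W) (hWℱ : Adapted ℱ W)
    (g : ℝ → ℝ) (hg : MemLp g 2 volD)
    (f : ℝ → ℝ → ℝ)
    (hf_meas : Measurable (fun p : Ioo (0 : ℝ) 1 × ℝ => f p.1 p.2))
    (hf_zero : MemLp (fun x => f x 0) 2 volD)
    (γ L β : ℝ) (hγ : IsPoincareConstant γ) (hL : 0 < L) (hLγ : L < γ) (hβ : 0 < β)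
    (hf_mono : ∀ x ∈ Ioo (0 : ℝ) 1, ∀ r s : ℝ, (f x r - f x s) * (r - s) ≥ -L * |r - s| ^ 2)
    (hf_growth : ∀ x ∈ Ioo (0 : ℝ) 1, ∀ r s : ℝ, |f x r - f x s| ≤ β * (1 + |r - s|)) :
    ∃ u : ℝ → Ω → ℝ,
      -- `u` is a mild solution, and the only one up to modification
      IsMildSolution P ℱ H W f g u ∧
      (∀ v : ℝ → Ω → ℝ, IsMildSolution P ℱ H W f g v →
        ∀ x ∈ Ioo (0 : ℝ) 1, ∀ᵐ ω ∂P, v x ω = u x ω) ∧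
      MemLp (fun p : ℝ × Ω => u p.1 p.2) 2 (volD.prod P) ∧
      -- the approximate problems have at most one solution, which is in `L²(D × Ω)`
      (∀ n : ℕ, 1 ≤ n → ∀ v : ℝ → Ω → ℝ, IsApproxSolution P ℱ W f g n v →
        MemLp (fun p : ℝ × Ω => v p.1 p.2) 2 (volD.prod P) ∧
        ∀ w : ℝ → Ω → ℝ, IsApproxSolution P ℱ W f g n w →
          ∀ᵐ ω ∂P, ∀ x ∈ Icc (0 : ℝ) 1, v x ω = w x ω) ∧
      -- they do have a solution when `f` is continuous in its second variable
      ((∀ x ∈ Ioo (0 : ℝ) 1, Continuous (f x)) →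
        ∀ n : ℕ, 1 ≤ n → ∃ v : ℝ → Ω → ℝ, IsApproxSolution P ℱ W f g n v) ∧
      -- the solutions of the approximate problems converge to `u` in `L²(D × Ω)`
      (∀ un : ℕ → ℝ → Ω → ℝ, (∀ᶠ n in atTop, IsApproxSolution P ℱ W f g n (un n)) →
        Tendsto (fun n => eLpNorm (fun p : ℝ × Ω => un n p.1 p.2 - u p.1 p.2) 2 (volD.prod P))
          atTop (𝓝 0)) := by
  have hWm1 : ∀ t, Measurable[ℱ 1] (W t) := fun t =>
    (hWℱ t).mono (ℱ.mono (Subtype.coe_le_coe.1 t.2.2)) le_rfl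
  have hWm : ∀ t, Measurable (W t) := fun t => (hWm1 t).mono (ℱ.le 1) le_rfl
  have hfe := isNonlinearity_extendD hf_meas hf_zero hL hβ hf_mono hf_growth
  obtain ⟨k, hk⟩ := exists_fastIndex hH0
  have hz2 := hW.memLp_mildField hH0 hWm hk hg
  obtain ⟨u, hum, hu2, hu⟩ := hfe.exists_solution_of_le (P := P) (ℱ.le 1) hγ hLγ
    (@measurable_mildField Ω (ℱ 1) W g hWm1 hg k) hz2
    (Or.inl (hW.hasSmallBalls hH0 (by linarith) hk (greenOp g)))
  have hmild : IsMildSolution P ℱ H W f g u :=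
    isMildSolution_of_eq hW hH0 hH hk hfe (isMeasurableField_of_measurable hum) hu2 hu
  have hpath : ∀ v, IsMildSolution P ℱ H W f g v →
      IsPathSolution P (extendD f) (mildField W g k) v :=
    fun v hv => hv.isPathSolution hW hH0 hH hWm hk hg hfe.measurable
  refine ⟨u, hmild, fun v hv x hx => ?_, hu2, fun n _ v hv => ⟨?_, fun w hw => ?_⟩,
    fun hf n _ => ?_, fun un hun => ?_⟩
  -- Stability only gives equality for almost every x. K ignores null sets, so the two equations at
  -- the prescribed x force equality there as well.
  · filter_upwards [hfe.ae_eq_of_isPathSolution hγ hLγ hz2 (hpath v hv) (hpath u hmild),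
      hv.ae_eq hW hH0 hH hk hx, hmild.ae_eq hW hH0 hH hk hx] with ω h1 h2 h3
    rw [greenOp_comp_congr h1] at h2
    linarith
  · exact hfe.memLp_of_isPathSolution hγ hLγ (hW.memLp_approxField hWm hg n)
      (aestronglyMeasurable_of_isMeasurableField hv.1) (hv.isPathSolution hg)
  · filter_upwards [hfe.ae_eq_of_isPathSolution hγ hLγ (hW.memLp_approxField hWm hg n)
      (hv.isPathSolution hg) (hw.isPathSolution hg), hv.ae_eq hg, hw.ae_eq hg]
      with ω h1 h2 h3 x hx
    have h4 := h2.2 x hx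
    rw [greenOp_comp_congr h1] at h4
    linarith [h3.2 x hx]
  · have hfc : ∀ x, Continuous (extendD f x) := fun x => by
      by_cases hx : x ∈ Ioo (0 : ℝ) 1
      · rw [extendD_of_mem hx]; exact hf x hx
      · rw [extendD_of_notMem hx]; exact continuous_const
    obtain ⟨v, hvm, hv2, hv⟩ := hfe.exists_solution_of_le (P := P) (ℱ.le 1) hγ hLγ
      (@measurable_approxField Ω (ℱ 1) W g hWm1 hg n) (hW.memLp_approxField hWm hg n)
      (Or.inr hfc)
    exact exists_isApproxSolution_of_eq hWm1 hg hfe hvm hv2 hv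
  · exact hfe.tendsto_of_isPathSolution hγ hLγ hz2 hu2.1 (hpath u hmild)
      (Eventually.of_forall fun n => hW.memLp_approxField hWm hg n)
      (hun.mono fun n hn => aestronglyMeasurable_of_isMeasurableField hn.1)
      (hun.mono fun n hn => hn.isPathSolution hg)
      (hW.tendsto_approxField hH0 hWm hk)
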